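/- **Setting.** Let $\Omega\subset\mathbb R^d$, $d\ge 2$, be a bounded Lipschitz domain, $T>0$, and let $A,B$ be nonempty compact metric spaces. Let $(\alpha,\beta)\mapsto(a^{\alpha\beta},b^{\alpha\beta},c^{\alpha\beta},f^{\alpha\beta})$ be continuous from $A\times B$ into $C(\overline\Omega)\times C(\overline\Omega,\mathbb R^d)\times C(\overline\Omega)\times C(\overline\Omega)$ with $a^{\alpha\beta}\ge 0$ on $\Omega$, let $g\in W^{1,\infty}(\mathbb R^d)$ with $\Delta g\in L^\infty(\Omega)$, and let $v_T\in C(\overline\Omega)$ with $v_T=g$ on $\partial\Omega$. Consider the problem $-\partial_t v+\inf_\beta\sup_\alpha(-a^{\alpha\beta}\Delta v-b^{\alpha\beta}\cdot\nabla v+c^{\alpha\beta}v-f^{\alpha\beta})=0$ in $(0,T)\times\Omega$, $v=g$ on $(0,T)\times\partial\Omega$, $v=v_T$ on $\{T\}\times\overline\Omega$, and put $$F(t,x,q,p,r,s)=\begin{cases}-r+\inf_\beta\sup_\alpha\bigl(-a^{\alpha\beta}(x)q-b^{\alpha\beta}(x)\cdot p+c^{\alpha\beta}(x)s-f^{\alpha\beta}(x)\bigr)&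 x\in\Omega,\ t<T,\\ s-g(x)& x\in\partial\Omega,\ t<T,\\ s-v_T(x)& t=T.\end{cases}$$ Upper and lower semicontinuous envelopes (relative to $[0,T]\times\overline\Omega$, respectively to the domain $[0,T]\times\overline\Omega\times\mathbb R\times\mathbb R^d\times\mathbb R\times\mathbb R$ of $F$) are denoted by $^*$ and $_*$. A bounded $v:[0,T]\times\overline\Omega\to\mathbb R$ is a *viscosity subsolution* (with Dirichlet conditions imposed only in the viscosity sense) if for all $\psi\in C^2(\mathbb R\times\mathbb R^d)$ and $(t,x)\in[0,T)\times\overline\Omega$ at which $v^*-\psi$ has a local maximum relative to $[0,T)\times\overline\Omega$ one has $F_*(t,x,\Delta\psi,\nabla\psi,\partial_t\psi,v^*(t,x))\le 0$ (derivatives of $\psi$ at $(t,x)$), and $u=v^*$ satisfies $u^*(T,x)=u_*(T,x)=v_T(x)$ for all $x\in\overline\Omega$. It is a *viscosity supersolution* if for all such $\psi$ and $(t,x)$ at which $v_*-\psi$ has a local minimum one has $F^*(t,x,\Delta\psi,\nabla\psi,\partial_t\psi,v_*(t,x))\ge 0$, and $u=v_*$ satisfies $u^*(T,x)=u_*(T,x)=v_T(x)$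 for all $x\in\overline\Omega$. **Scheme.** For $i\in\mathbb N$ let $V_i$ be the space of continuous piecewise affine functions on a simplicial mesh of $\overline\Omega$; the meshes are shape-regular and the mesh sizes tend to $0$. Let $\phi_i^y$ be the hat function of the node $y$, $\hat\phi_i^y=\phi_i^y/\|\phi_i^y\|_{L^1(\Omega)}$; nodes in $\Omega$ are internal. Let $h_i=T/N_i\to0$ with integers $N_i\ge 1$. Let $P_i$ be linear maps into $V_i$ with $\langle\nabla P_iw,\nabla\hat\phi_i^y\rangle=\langle\nabla w,\nabla\hat\phi_i^y\rangle$ for $w\in H^1(\Omega)$ and internal $y$, with $\|P_iw\|_{W^{1,\infty}(\Omega)}\le C\|w\|_{W^{1,\infty}(\Omega)}$ and $\|P_iw-w\|_{W^{1,\infty}(\Omega)}\to0$ for all $w\in C^\infty(\mathbb R^d)$ ($C$ independent of $i,w$), and with $P_ig\to g$ uniformly on $\partial\Omega$ and $P_iv_T\to v_T$ uniformly on $\overline\Omega$. Let explicit coefficients $(\bar a_i,\bar b_i,\bar c_i)^{\alpha\beta}$, implicit coefficients $(\bar{\bar a}_i,\bar{\bar b}_i,\bar{\bar c}_i)^{\alpha\beta}$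 and sources $f_i^{\alpha\beta}$ be given which for each $i$ depend continuously on $(\alpha,\beta)$ (in $L^\infty(\Omega)$; for $\bar a_i,\bar{\bar a}_i$, at each internal node) and satisfy: $\bar c_i,\bar{\bar c}_i\ge0$; $\|\bar c_i^{\alpha\beta}\|_{L^\infty(\Omega)}+\|\bar{\bar c}_i^{\alpha\beta}\|_{L^\infty(\Omega)}\le\gamma$ with $\gamma$ independent of $i,\alpha,\beta$; and $$\sup_{\alpha,\beta}\Bigl(\sup_{y\text{ internal}}\|a^{\alpha\beta}-(\bar a_i^{\alpha\beta}(y)+\bar{\bar a}_i^{\alpha\beta}(y))\|_{L^\infty(\mathrm{supp}\,\phi_i^y)}+\|b^{\alpha\beta}-\bar b_i^{\alpha\beta}-\bar{\bar b}_i^{\alpha\beta}\|_{L^\infty(\Omega)}+\|c^{\alpha\beta}-\bar c_i^{\alpha\beta}-\bar{\bar c}_i^{\alpha\beta}\|_{L^\infty(\Omega)}+\|f^{\alpha\beta}-f_i^{\alpha\beta}\|_{L^\infty(\Omega)}\Bigr)\to0 .$$ For internal $y$ let $(E_i^{\alpha\beta}w)(y)=\bar a_i^{\alpha\beta}(y)\langle\nabla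 w,\nabla\hat\phi_i^y\rangle+\langle-\bar b_i^{\alpha\beta}\cdot\nabla w+\bar c_i^{\alpha\beta}w,\hat\phi_i^y\rangle$, define $I_i^{\alpha\beta}$ in the same way from the implicit coefficients, and let $F_i^{\alpha\beta}(y)=\langle f_i^{\alpha\beta},\hat\phi_i^y\rangle$. Assume monotonicity for all $i,\alpha,\beta$: $(E_i^{\alpha\beta}\phi_i^z)(y)\le0$ for internal $y$ and nodes $z\ne y$; $h_i(E_i^{\alpha\beta}\phi_i^y)(y)\le1$ for internal $y$; and $(I_i^{\alpha\beta}w)(y)\le0$ whenever $w\in V_i$ has a non-positive local minimum at the internal node $y$. Let $v_i(kh_i,\cdot)\in V_i$, $0\le k\le N_i$, be a numerical solution: $v_i(T,\cdot)=P_iv_T$, and for $k<N_i$, $v_i(kh_i,\cdot)=P_ig$ on $\partial\Omega$ and, at every internal node $y$, $$-\frac{v_i((k+1)h_i,y)-v_i(kh_i,y)}{h_i}+\inf_\beta\sup_\alpha\bigl(E_i^{\alpha\beta}v_i((k+1)h_i,\cdot)+I_i^{\alpha\beta}v_i(kh_i,\cdot)-F_i^{\alpha\beta}\bigr)(y)=0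 .$$ Let $\overline v(t,x)$ and $\underline v(t,x)$ be the $\limsup$ and the $\liminf$ of $v_i(kh_i,y)$ as $i\to\infty$ and $(kh_i,y)\to(t,x)$, over $0\le k\le N_i$ and nodes $y$ of the $i$-th mesh. **Lemma.** The functions $v_i$ are bounded uniformly in $i$, $\overline v$ is a viscosity subsolution, and $\underline v$ is a viscosity supersolution. -/

import Mathlib

open Set Filter Topology MeasureTheory
open scoped ENNReal NNReal ContDiff

namespace Isaacs

/-- The Euclidean space `ℝ^d`. -/
abbrev Pt (d : ℕ) : Type := EuclideanSpace ℝ (Fin d)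

noncomputable section

/-! ### Domains and function spaces -/

/-- `Ω` is a bounded Lipschitz domain: a nonempty bounded connected open set which, near each of its
boundary points and in suitable orthogonal coordinates (`e` is the vertical direction), is the set
of points strictly above the graph of a Lipschitz function of the horizontal variables. -/
structure IsLipschitzDomain {d : ℕ} (Ω : Set (Pt d)) : Prop where
  isOpen : IsOpen Ω
  isConnected : IsConnected Ω
  isBounded : Bornology.IsBounded Ω
  boundary : ∀ x₀ ∈ frontier Ω, ∃ (e : Pt d) (r : ℝ) (γ : Pt d → ℝ) (L : ℝ≥0),
    ‖e‖ = 1 ∧ 0 < r ∧ LipschitzWith L γ ∧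
      Ω ∩ Metric.ball x₀ r =
        {x | γ (x - inner ℝ e x • e) < inner ℝ e x} ∩ Metric.ball x₀ r

/-- `G` is the weak gradient of `w` on the open set `Ω`. -/
def IsWeakGradient {d : ℕ} (Ω : Set (Pt d)) (w : Pt d → ℝ) (G : Pt d → Pt d) : Prop :=
  ∀ θ : Pt d → ℝ, ContDiff ℝ ∞ θ → HasCompactSupport θ → tsupport θ ⊆ Ω →
    ∫ x in Ω, w x • gradient θ x = - ∫ x in Ω, θ x • G x

/-- `D` is the distributional Laplacian of `w` on the open set `Ω`. -/
def IsWeakLaplacian {d : ℕ} (Ω : Set (Pt d)) (w D : Pt d → ℝ) : Prop :=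
  ∀ θ : Pt d → ℝ, ContDiff ℝ ∞ θ → HasCompactSupport θ → tsupport θ ⊆ Ω →
    ∫ x in Ω, w x * Laplacian.laplacian θ x = ∫ x in Ω, D x * θ x

/-- The `L^∞(Ω)` norm. -/
def normLinf {d : ℕ} {F : Type*} [NormedAddCommGroup F] (Ω : Set (Pt d)) (w : Pt d → F) : ℝ≥0∞ :=
  eLpNorm w ∞ (volume.restrict Ω)

/-- The `W^{1,∞}(Ω)` norm of a function that is smooth, or continuous and piecewise affine, or a
sum of such functions; its weak gradient is its classical gradient, which exists almost
everywhere. -/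
def normW1inf {d : ℕ} (Ω : Set (Pt d)) (w : Pt d → ℝ) : ℝ≥0∞ :=
  normLinf Ω w + normLinf Ω (gradient w)

/-- The family `u` of functions consists of elements of `L^∞(Ω)` and depends, as a map into
`L^∞(Ω)`, continuously on the pair of parameters. -/
def ContinuousIntoLinf {d : ℕ} {A B F : Type*} [TopologicalSpace A] [TopologicalSpace B]
    [NormedAddCommGroup F] (Ω : Set (Pt d)) (u : A → B → Pt d → F) : Prop :=
  (∀ α β, MemLp (u α β) ∞ (volume.restrict Ω)) ∧
    ∀ p : A × B, Tendsto (fun q : A × B => normLinf Ω (fun x => u q.1 q.2 x - u p.1 p.2 x))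
      (𝓝 p) (𝓝 0)

/-! ### The Isaacs problem -/

/-- The data of an isotropic Isaacs problem. The functions `a α β` and so on matter only on the
closure of `Ω`; joint continuity on `A × B × closure Ω` is the same as continuity of
`(α, β) ↦ a α β` as a map into the space `C(closure Ω)`, because the closure of `Ω` is compact.
A function in `W^{1,∞}(ℝ^d)` is a bounded Lipschitz function. -/
structure Problem (d : ℕ) (A B : Type*) [MetricSpace A] [MetricSpace B] where
  Ω : Set (Pt d)
  T : ℝ
  a : A → B → Pt d → ℝ
  b : A → B → Pt d → Pt d
  c : A → B → Pt d → ℝ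
  f : A → B → Pt d → ℝ
  g : Pt d → ℝ
  vT : Pt d → ℝ
  domain : IsLipschitzDomain Ω
  T_pos : 0 < T
  a_cont : ContinuousOn (fun z : A × B × Pt d => a z.1 z.2.1 z.2.2) {z | z.2.2 ∈ closure Ω}
  b_cont : ContinuousOn (fun z : A × B × Pt d => b z.1 z.2.1 z.2.2) {z | z.2.2 ∈ closure Ω}
  c_cont : ContinuousOn (fun z : A × B × Pt d => c z.1 z.2.1 z.2.2) {z | z.2.2 ∈ closure Ω}
  f_cont : ContinuousOn (fun z : A × B × Pt d => f z.1 z.2.1 z.2.2) {z | z.2.2 ∈ closure Ω}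
  a_nonneg : ∀ α β, ∀ x ∈ Ω, 0 ≤ a α β x
  g_bounded : ∃ M, ∀ x, |g x| ≤ M
  g_lipschitz : ∃ L, LipschitzWith L g
  g_laplacian : ∃ D, MemLp D ∞ (volume.restrict Ω) ∧ IsWeakLaplacian Ω g D
  vT_cont : ContinuousOn vT (closure Ω)
  vT_eq_g : ∀ x ∈ frontier Ω, vT x = g x

/-- The cylinder `[0,T] × closure Ω`. -/
def Problem.cyl {d : ℕ} {A B : Type*} [MetricSpace A] [MetricSpace B] (pb : Problem d A B) :
    Set (ℝ × Pt d) :=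
  Icc 0 pb.T ×ˢ closure pb.Ω

open Classical in
/-- The operator `F(t,x,q,p,r,s)`, where `q`, `p`, `r`, `s` stand for the Laplacian, the gradient,
the time derivative and the value. -/
def Problem.F {d : ℕ} {A B : Type*} [MetricSpace A] [MetricSpace B] (pb : Problem d A B)
    (z : ℝ × Pt d × ℝ × Pt d × ℝ × ℝ) : ℝ :=
  match z with
  | (t, x, q, p, r, s) =>
    if t < pb.T then
      if x ∈ pb.Ω then
        -r + ⨅ β, ⨆ α, (-(pb.a α β x) * q - inner ℝ (pb.b α β x) p + pb.c α β x * s - pb.f α β x)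
      else s - pb.g x
    else s - pb.vT x

/-- The domain `[0,T] × closure Ω × ℝ × ℝ^d × ℝ × ℝ` of `F`. -/
def Problem.domF {d : ℕ} {A B : Type*} [MetricSpace A] [MetricSpace B] (pb : Problem d A B) :
    Set (ℝ × Pt d × ℝ × Pt d × ℝ × ℝ) :=
  {z | z.1 ∈ Icc 0 pb.T ∧ z.2.1 ∈ closure pb.Ω}

/-- The upper semicontinuous envelope, relative to the set `S`, of a locally bounded function. -/
def uscEnv {X : Type*} [TopologicalSpace X] (S : Set X) (v : X → ℝ) (x : X) : ℝ :=
  limsup v (𝓝[S] x)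

/-- The lower semicontinuous envelope, relative to the set `S`, of a locally bounded function. -/
def lscEnv {X : Type*} [TopologicalSpace X] (S : Set X) (v : X → ℝ) (x : X) : ℝ :=
  liminf v (𝓝[S] x)

section Viscosity

variable {d : ℕ} {A B : Type*} [MetricSpace A] [MetricSpace B] (pb : Problem d A B)

/-- The tuple `(t, x, Δψ(t,x), ∇ψ(t,x), ∂ₜψ(t,x), s)`. -/
def jet (ψ : ℝ × Pt d → ℝ) (t : ℝ) (x : Pt d) (s : ℝ) : ℝ × Pt d × ℝ × Pt d × ℝ × ℝ :=
  (t, x, Laplacian.laplacian (fun y => ψ (t, y)) x, gradient (fun y => ψ (t, y)) x,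
    deriv (fun τ => ψ (τ, x)) t, s)

/-- `v` satisfies the Dirichlet boundary condition at `x` strongly. -/
def StrongDirichletAt (v : ℝ × Pt d → ℝ) (x : Pt d) : Prop :=
  ∀ t ∈ Icc 0 pb.T, uscEnv pb.cyl v (t, x) = pb.g x ∧ lscEnv pb.cyl v (t, x) = pb.g x

/-- `v` satisfies the final time condition at `x` strongly. -/
def StrongFinalAt (v : ℝ × Pt d → ℝ) (x : Pt d) : Prop :=
  uscEnv pb.cyl v (pb.T, x) = pb.vT x ∧ lscEnv pb.cyl v (pb.T, x) = pb.vT x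

/-- `v` is a viscosity subsolution, strongly on `ω₀`. -/
structure IsViscositySubsolution (ω₀ : Set (Pt d)) (v : ℝ × Pt d → ℝ) : Prop where
  bounded : ∃ M, ∀ p ∈ pb.cyl, |v p| ≤ M
  test : ∀ ψ : ℝ × Pt d → ℝ, ContDiff ℝ 2 ψ → ∀ t ∈ Ico 0 pb.T, ∀ x ∈ closure pb.Ω,
    IsLocalMaxOn (fun p => uscEnv pb.cyl v p - ψ p) (Ico 0 pb.T ×ˢ closure pb.Ω) (t, x) →
      lscEnv pb.domF pb.F (jet ψ t x (uscEnv pb.cyl v (t, x))) ≤ 0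
  final : ∀ x ∈ closure pb.Ω, StrongFinalAt pb (uscEnv pb.cyl v) x
  dirichlet : ∀ x ∈ ω₀, StrongDirichletAt pb (uscEnv pb.cyl v) x

/-- `v` is a viscosity supersolution, strongly on `ω₀`. -/
structure IsViscositySupersolution (ω₀ : Set (Pt d)) (v : ℝ × Pt d → ℝ) : Prop where
  bounded : ∃ M, ∀ p ∈ pb.cyl, |v p| ≤ M
  test : ∀ ψ : ℝ × Pt d → ℝ, ContDiff ℝ 2 ψ → ∀ t ∈ Ico 0 pb.T, ∀ x ∈ closure pb.Ω,
    IsLocalMinOn (fun p => lscEnv pb.cyl v p - ψ p) (Ico 0 pb.T ×ˢ closure pb.Ω) (t, x) →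
      0 ≤ uscEnv pb.domF pb.F (jet ψ t x (lscEnv pb.cyl v (t, x)))
  final : ∀ x ∈ closure pb.Ω, StrongFinalAt pb (lscEnv pb.cyl v) x
  dirichlet : ∀ x ∈ ω₀, StrongDirichletAt pb (lscEnv pb.cyl v) x

end Viscosity

/-! ### Piecewise linear finite elements -/

/-- The simplicial complex `K` is a mesh of `closure Ω`: it has finitely many faces, each of which
belongs to a `d`-dimensional element, and they cover exactly the closure of `Ω`. -/
structure IsMesh {d : ℕ} (K : Geometry.SimplicialComplex ℝ (Pt d)) (Ω : Set (Pt d)) : Prop where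
  finite : K.faces.Finite
  space_eq : K.space = closure Ω
  pure : ∀ s ∈ K.faces, ∃ t ∈ K.faces, s ⊆ t ∧ t.card = d + 1

/-- The largest diameter of an element. -/
def meshSize {d : ℕ} (K : Geometry.SimplicialComplex ℝ (Pt d)) : ℝ :=
  sSup ((fun s : Finset (Pt d) => Metric.diam (convexHull ℝ (s : Set (Pt d)))) '' K.faces)

/-- The space of continuous functions on the closure of `Ω` which are affine on each element,
extended by zero. (They are continuous on the closure of `Ω` because the faces are closed and
finite in number.) -/
def P1Space {d : ℕ} (K : Geometry.SimplicialComplex ℝ (Pt d)) : Submodule ℝ (Pt d → ℝ) where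
  carrier := {w | (∀ s ∈ K.faces, ∃ l : Pt d →ᵃ[ℝ] ℝ, EqOn w l (convexHull ℝ (s : Set (Pt d)))) ∧
    ∀ x, x ∉ K.space → w x = 0}
  add_mem' := by
    rintro u w ⟨hu, hu0⟩ ⟨hw, hw0⟩
    refine ⟨fun s hs => ?_, fun x hx => by simp [hu0 x hx, hw0 x hx]⟩
    obtain ⟨l, hl⟩ := hu s hs
    obtain ⟨m, hm⟩ := hw s hs
    exact ⟨l + m, fun x hx => by simp [hl hx, hm hx]⟩
  zero_mem' := ⟨fun s _ => ⟨0, fun x _ => by simp⟩, fun x _ => rfl⟩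
  smul_mem' := by
    rintro r w ⟨hw, hw0⟩
    refine ⟨fun s hs => ?_, fun x hx => by simp [hw0 x hx]⟩
    obtain ⟨m, hm⟩ := hw s hs
    exact ⟨r • m, fun x hx => by simp [hm hx]⟩

/-- `w` is the family of barycentric coordinates of `x`: the points with a positive coordinate are
the vertices of the unique face of the complex whose relative interior contains `x`. -/
def IsBary {d : ℕ} (K : Geometry.SimplicialComplex ℝ (Pt d)) (x : Pt d) (w : Pt d →₀ ℝ) : Prop :=
  w.support ∈ K.faces ∧ (∀ z, 0 ≤ w z) ∧ (w.sum fun _ r => r) = 1 ∧ (w.sum fun z r => r • z) = x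

open Classical in
/-- The hat function of the node `y`: the coordinate of `x` with respect to `y` in the face that
contains `x`, and zero outside of the mesh. -/
def hat {d : ℕ} (K : Geometry.SimplicialComplex ℝ (Pt d)) (y x : Pt d) : ℝ :=
  if h : ∃ w : Pt d →₀ ℝ, IsBary K x w then h.choose y else 0

/-- The hat function of the node `y`, normalised in `L^1(Ω)`. -/
def hatN {d : ℕ} (K : Geometry.SimplicialComplex ℝ (Pt d)) (Ω : Set (Pt d)) (y x : Pt d) : ℝ :=
  hat K y x / ∫ z in Ω, |hat K y z|

/-- The number
`a(y) ⟨∇w, ∇φ̂⟩ + ⟨-b · ∇w + c w, φ̂⟩`, where `φ̂` is the normalised hat function of `y`. -/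
def discreteOp {d : ℕ} (K : Geometry.SimplicialComplex ℝ (Pt d)) (Ω : Set (Pt d))
    (a : Pt d → ℝ) (b : Pt d → Pt d) (c : Pt d → ℝ) (w : Pt d → ℝ) (y : Pt d) : ℝ :=
  a y * (∫ x in Ω, inner ℝ (gradient w x) (gradient (hatN K Ω y) x)) +
    ∫ x in Ω, (-(inner ℝ (b x) (gradient w x)) + c x * w x) * hatN K Ω y x

/-- The local monotonicity property of the operator `G` on `P1Space K`; internal nodes are the
nodes in `Ω`. -/
def LMP {d : ℕ} (K : Geometry.SimplicialComplex ℝ (Pt d)) (Ω : Set (Pt d))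
    (G : (Pt d → ℝ) → Pt d → ℝ) : Prop :=
  ∀ v ∈ P1Space K, ∀ y ∈ K.vertices ∩ Ω, v y ≤ 0 → IsLocalMinOn v (closure Ω) y → G v y ≤ 0

/-! ### The numerical scheme -/

/-- The choices that define the numerical method: a sequence of meshes, the number `N i` of time
steps, elliptic projections `P i`, and the coefficients of the explicit (`aE`, `bE`, `cE`) and of
the implicit (`aI`, `bI`, `cI`) part of the splitting, with the source terms `fD`. -/
structure Method (d : ℕ) (A B : Type*) where
  mesh : ℕ → Geometry.SimplicialComplex ℝ (Pt d)
  N : ℕ → ℕ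
  P : ∀ i, (Pt d → ℝ) →ₗ[ℝ] P1Space (mesh i)
  aE : ℕ → A → B → Pt d → ℝ
  bE : ℕ → A → B → Pt d → Pt d
  cE : ℕ → A → B → Pt d → ℝ
  aI : ℕ → A → B → Pt d → ℝ
  bI : ℕ → A → B → Pt d → Pt d
  cI : ℕ → A → B → Pt d → ℝ
  fD : ℕ → A → B → Pt d → ℝ

section Scheme

variable {d : ℕ} {A B : Type*} [MetricSpace A] [MetricSpace B]
  (pb : Problem d A B) (me : Method d A B)

/-- The time step size. -/
def Method.h (i : ℕ) : ℝ := pb.T / me.N i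

/-- The explicit operator, at internal nodes. -/
def Method.opE (i : ℕ) (α : A) (β : B) (w : Pt d → ℝ) (y : Pt d) : ℝ :=
  discreteOp (me.mesh i) pb.Ω (me.aE i α β) (me.bE i α β) (me.cE i α β) w y

/-- The implicit operator, at internal nodes. -/
def Method.opI (i : ℕ) (α : A) (β : B) (w : Pt d → ℝ) (y : Pt d) : ℝ :=
  discreteOp (me.mesh i) pb.Ω (me.aI i α β) (me.bI i α β) (me.cI i α β) w y

/-- The forcing term, at internal nodes. -/
def Method.opF (i : ℕ) (α : A) (β : B) (y : Pt d) : ℝ :=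
  ∫ x in pb.Ω, me.fD i α β x * hatN (me.mesh i) pb.Ω y x

/-- The meshes are shape-regular triangulations of the domain and the mesh sizes and time step
sizes tend to zero. -/
structure Method.IsAdmissible : Prop where
  mesh : ∀ i, IsMesh (me.mesh i) pb.Ω
  shape_regular : ∃ ρ > 0, ∀ i, ∀ s ∈ (me.mesh i).faces, s.card = d + 1 →
    ∃ x, Metric.ball x (ρ * Metric.diam (convexHull ℝ (s : Set (Pt d)))) ⊆
      convexHull ℝ (s : Set (Pt d))
  meshSize_tendsto : Tendsto (fun i => meshSize (me.mesh i)) atTop (𝓝 0)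
  N_pos : ∀ i, 0 < me.N i
  h_tendsto : Tendsto (fun i => me.h pb i) atTop (𝓝 0)

/-- The maps `P i` are elliptic projections (first field, with test functions from the span of the
hat functions of internal nodes), stable in `W^{1,∞}(Ω)` and convergent for smooth functions;
and they approximate the boundary data `g` and the final data `vT` uniformly. -/
structure Method.IsEllipticProjection : Prop where
  galerkin : ∀ i (w : Pt d → ℝ) (G : Pt d → Pt d), MemLp w 2 (volume.restrict pb.Ω) →
    MemLp G 2 (volume.restrict pb.Ω) → IsWeakGradient pb.Ω w G →
    ∀ y ∈ (me.mesh i).vertices ∩ pb.Ω,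
      ∫ x in pb.Ω, inner ℝ (gradient (me.P i w : Pt d → ℝ) x)
          (gradient (hatN (me.mesh i) pb.Ω y) x) =
        ∫ x in pb.Ω, inner ℝ (G x) (gradient (hatN (me.mesh i) pb.Ω y) x)
  stable : ∃ C : ℝ≥0, ∀ w : Pt d → ℝ, ContDiff ℝ ∞ w → ∀ i,
    normW1inf pb.Ω (me.P i w : Pt d → ℝ) ≤ C * normW1inf pb.Ω w
  convergent : ∀ w : Pt d → ℝ, ContDiff ℝ ∞ w →
    Tendsto (fun i => normW1inf pb.Ω (fun x => (me.P i w : Pt d → ℝ) x - w x)) atTop (𝓝 0)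
  boundary_data : TendstoUniformlyOn (fun i => (me.P i pb.g : Pt d → ℝ)) pb.g atTop (frontier pb.Ω)
  final_data : TendstoUniformlyOn (fun i => (me.P i pb.vT : Pt d → ℝ)) pb.vT atTop (closure pb.Ω)

/-- The splitting is consistent. The diffusion coefficients `aE` and `aI` enter the scheme only
through their values at the internal nodes. -/
structure Method.IsConsistent : Prop where
  limit : Tendsto (fun i => ⨆ (α : A) (β : B),
      ((⨆ y ∈ (me.mesh i).vertices ∩ pb.Ω,
          normLinf (tsupport (hat (me.mesh i) y))
            (fun x => pb.a α β x - (me.aE i α β y + me.aI i α β y))) +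
        normLinf pb.Ω (fun x => pb.b α β x - (me.bE i α β x + me.bI i α β x)) +
        normLinf pb.Ω (fun x => pb.c α β x - (me.cE i α β x + me.cI i α β x)) +
        normLinf pb.Ω (fun x => pb.f α β x - me.fD i α β x))) atTop (𝓝 0)
  cE_nonneg : ∀ i α β, ∀ᵐ x ∂volume.restrict pb.Ω, 0 ≤ me.cE i α β x
  cI_nonneg : ∀ i α β, ∀ᵐ x ∂volume.restrict pb.Ω, 0 ≤ me.cI i α β x
  c_bound : ∃ γ : ℝ≥0, ∀ i α β, normLinf pb.Ω (me.cE i α β) + normLinf pb.Ω (me.cI i α β) ≤ γ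
  aE_cont : ∀ i, ∀ y ∈ (me.mesh i).vertices ∩ pb.Ω, Continuous fun p : A × B => me.aE i p.1 p.2 y
  aI_cont : ∀ i, ∀ y ∈ (me.mesh i).vertices ∩ pb.Ω, Continuous fun p : A × B => me.aI i p.1 p.2 y
  bE_cont : ∀ i, ContinuousIntoLinf pb.Ω (me.bE i)
  bI_cont : ∀ i, ContinuousIntoLinf pb.Ω (me.bI i)
  cE_cont : ∀ i, ContinuousIntoLinf pb.Ω (me.cE i)
  cI_cont : ∀ i, ContinuousIntoLinf pb.Ω (me.cI i)
  fD_cont : ∀ i, ContinuousIntoLinf pb.Ω (me.fD i)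

/-- The explicit operators have non-positive off-diagonal entries, all entries of `h E - Id` are
non-positive, and the implicit operators have the local monotonicity property. (The rows of the
explicit operator at boundary nodes vanish.) -/
structure Method.IsMonotone : Prop where
  offdiag : ∀ i α β, ∀ y ∈ (me.mesh i).vertices ∩ pb.Ω, ∀ z ∈ (me.mesh i).vertices, z ≠ y →
    me.opE pb i α β (hat (me.mesh i) z) y ≤ 0
  diag : ∀ i α β, ∀ y ∈ (me.mesh i).vertices ∩ pb.Ω,
    me.h pb i * me.opE pb i α β (hat (me.mesh i) y) y - 1 ≤ 0
  lmp : ∀ i α β, LMP (me.mesh i) pb.Ω (me.opI pb i α β)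

/-- `v i k` is the numerical solution at refinement level `i` and time `k * h i`: it is the
projection of the final data for `k = N i`; for `k < N i` it attains the projection of `g` on the
boundary and solves the scheme at the internal nodes. -/
structure Method.IsNumericalSolution (v : ∀ i, ℕ → P1Space (me.mesh i)) : Prop where
  final : ∀ i, v i (me.N i) = me.P i pb.vT
  boundary : ∀ i, ∀ k < me.N i, ∀ x ∈ frontier pb.Ω,
    (v i k : Pt d → ℝ) x = (me.P i pb.g : Pt d → ℝ) x
  scheme : ∀ i, ∀ k < me.N i, ∀ y ∈ (me.mesh i).vertices ∩ pb.Ω,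
    -(((v i (k + 1) : Pt d → ℝ) y - (v i k : Pt d → ℝ) y) / me.h pb i) +
      (⨅ β, ⨆ α, (me.opE pb i α β (v i (k + 1) : Pt d → ℝ) y +
        me.opI pb i α β (v i k : Pt d → ℝ) y - me.opF pb i α β y)) = 0

/-- The filter of triples `(i, k, y)`, where `y` is a node of the `i`-th mesh and `k ≤ N i`, such
that `i → ∞` and `(k * h i, y) → p`. -/
def Method.gridFilter (p : ℝ × Pt d) : Filter (ℕ × ℕ × Pt d) :=
  comap (fun j : ℕ × ℕ × Pt d => (j.1, ((j.2.1 : ℝ) * me.h pb j.1, j.2.2))) (atTop ×ˢ 𝓝 p) ⊓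
    𝓟 {j | j.2.1 ≤ me.N j.1 ∧ j.2.2 ∈ (me.mesh j.1).vertices}

/-- The numerical upper envelope. -/
def Method.upperEnv (v : ∀ i, ℕ → P1Space (me.mesh i)) (p : ℝ × Pt d) : ℝ :=
  limsup (fun j : ℕ × ℕ × Pt d => (v j.1 j.2.1 : Pt d → ℝ) j.2.2) (me.gridFilter pb p)

/-- The numerical lower envelope. -/
def Method.lowerEnv (v : ∀ i, ℕ → P1Space (me.mesh i)) (p : ℝ × Pt d) : ℝ :=
  liminf (fun j : ℕ × ℕ × Pt d => (v j.1 j.2.1 : Pt d → ℝ) j.2.2) (me.gridFilter pb p)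

end Scheme

end

end Isaacs

namespace Isaacs

noncomputable section

variable {d : ℕ} {K : Geometry.SimplicialComplex ℝ (Pt d)} {Ω : Set (Pt d)}

/-! ### Barycentric coordinates on a simplicial complex -/

/-! The proof is the method of half-relaxed limits: a stable, monotone and consistent scheme has
envelopes that are viscosity sub- and supersolutions.

Monotonicity. The sign conditions on the explicit matrix and the locality of the basis give
`Method.IsMonotone.opE_le`; the implicit operator has the local monotonicity property. Together they
yield `Method.IsMonotone.touching`: if a numerical solution is touched from above at an internal
node and dominated nearby one time step later, then the scheme evaluated on the touching functions
has a non-positive residual. Comparison with barriers (`Method.IsMonotone.le_barrier`) follows by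
backward induction in time. Constant barriers give stability, and parabolas above the final data
give the attainment of the final data (`upperEnv_final_le`).

Consistency. Piecewise affine functions have no pointwise Laplacian, so the scheme tests gradients
against normalised hat functions. The Galerkin identity replaces the gradient of a projection by
that of the function itself. For a quadratic function this gradient is affine, and integration by
parts against a function of mass one that vanishes outside the domain gives minus the trace of the
Hessian exactly (`IsMesh.integral_inner_gradient_hatN`). Lower order terms converge because the
projections converge in `W^{1,∞}` and the coefficients are uniformly continuous, uniformly in the
controls (`Method.IsConsistent.eventually_op_close`). Quadratic functions suffice: by Taylor's
theorem a `C²` test function lies below a quadratic in space plus a quadratic in time, at the cost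
of a small increase of the Laplacian (`exists_quadratic_upper_bound`), which the semicontinuous
envelope of the operator tolerates.

Limit. A strict maximum of the upper envelope minus a test function is a limit of maxima of the
numerical solutions over grid points (`Method.exists_contact`), where `touching` applies if the node
is internal. At a boundary point there are two cases: either the envelope is at most `g` and the
boundary branch of the operator gives the inequality, or it exceeds `g` and the contact nodes must
be internal, because boundary nodes carry nearly the value `g`.

Duality. Of the inf-sup, only monotonicity and additivity with respect to constants are used,
recorded in `IsValue`. This property survives `u ↦ -Φ(-u)`, so the negative of a numerical solution
solves a scheme of the same kind (`Method.IsApproximation.neg`), and each lower estimate is an upper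
estimate for the negative. -/

theorem mem_convexHull_iff_weights {s : Finset (Pt d)} {x : Pt d} :
    x ∈ convexHull ℝ (s : Set (Pt d)) ↔
      ∃ w : Pt d → ℝ, (∀ z ∈ s, 0 ≤ w z) ∧ ∑ z ∈ s, w z = 1 ∧ ∑ z ∈ s, w z • z = x := by
  rw [Finset.mem_convexHull']

theorem weights_unique {s : Finset (Pt d)} (hs : s ∈ K.faces) {w w' : Pt d → ℝ}
    (hw : ∑ z ∈ s, w z = ∑ z ∈ s, w' z) (hx : ∑ z ∈ s, w z • z = ∑ z ∈ s, w' z • z) :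
    ∀ z ∈ s, w z = w' z := by
  intro z hz
  have h := affineIndependent_iff.1 (K.indep hs) Finset.univ (fun z : s => w z - w' z)
    (by
      rw [Finset.sum_sub_distrib, Finset.univ_eq_attach, Finset.sum_attach s w,
        Finset.sum_attach s w', hw, sub_self])
    (by
      simp_rw [sub_smul]
      rw [Finset.sum_sub_distrib, Finset.univ_eq_attach,
        Finset.sum_attach s (fun z => w z • z), Finset.sum_attach s (fun z => w' z • z), hx,
        sub_self]) ⟨z, hz⟩ (Finset.mem_univ _)
  exact sub_eq_zero.1 h

theorem IsBary.mem_convexHull {x : Pt d} {w : Pt d →₀ ℝ} (h : IsBary K x w) :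
    x ∈ convexHull ℝ (w.support : Set (Pt d)) :=
  mem_convexHull_iff_weights.2 ⟨w, fun z _ => h.2.1 z, h.2.2.1, h.2.2.2⟩

/-- Two faces that contain `x` meet in the hull of their common vertices. The weights of `x` on
these vertices, extended by zero, are weights in either face, and by affine independence they agree
with both given families. -/
theorem IsBary.eq_weights {s : Finset (Pt d)} (hs : s ∈ K.faces) {x : Pt d} {w : Pt d →₀ ℝ}
    (h : IsBary K x w) {u : Pt d → ℝ} (h0 : ∀ z ∈ s, 0 ≤ u z) (h1 : ∑ z ∈ s, u z = 1)
    (hx : ∑ z ∈ s, u z • z = x) : (∀ z ∈ s, w z = u z) ∧ ∀ z ∉ s, w z = 0 := by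
  classical
  have hxs : x ∈ convexHull ℝ (s : Set (Pt d)) := mem_convexHull_iff_weights.2 ⟨u, h0, h1, hx⟩
  have hxi := K.inter_subset_convexHull h.1 hs ⟨h.mem_convexHull, hxs⟩
  rw [← Finset.coe_inter, mem_convexHull_iff_weights] at hxi
  obtain ⟨ν, -, ν1, νx⟩ := hxi
  have extend : ∀ t : Finset (Pt d), w.support ∩ s ⊆ t →
      (∑ z ∈ t, (if z ∈ w.support ∩ s then ν z else 0)) = 1 ∧
      (∑ z ∈ t, (if z ∈ w.support ∩ s then ν z else 0) • z) = x := by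
    intro t ht
    constructor
    · rw [← ν1, Finset.sum_ite_mem, Finset.inter_eq_right.2 ht]
    · simp_rw [ite_smul, zero_smul]
      rw [Finset.sum_ite_mem, Finset.inter_eq_right.2 ht, νx]
  obtain ⟨a1, a2⟩ := extend w.support Finset.inter_subset_left
  obtain ⟨b1, b2⟩ := extend s Finset.inter_subset_right
  have hw := weights_unique h.1 (w := w)
    (w' := fun z => if z ∈ w.support ∩ s then ν z else 0)
    (by rw [a1]; exact h.2.2.1) (by rw [a2]; exact h.2.2.2)
  have hu := weights_unique hs (w := u)
    (w' := fun z => if z ∈ w.support ∩ s then ν z else 0) (by rw [b1, h1]) (by rw [b2, hx])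
  have hz : ∀ z ∉ s, w z = 0 := by
    intro z hz
    by_cases hzw : z ∈ w.support
    · rw [hw z hzw, if_neg]
      simp [hz]
    · simpa using hzw
  refine ⟨fun z hzs => ?_, hz⟩
  by_cases hzw : z ∈ w.support
  · rw [hw z hzw, hu z hzs]
  · rw [hu z hzs, if_neg (by simp_all), Finsupp.notMem_support_iff.1 hzw]

theorem exists_isBary {s : Finset (Pt d)} (hs : s ∈ K.faces) {x : Pt d} {u : Pt d → ℝ}
    (h0 : ∀ z ∈ s, 0 ≤ u z) (h1 : ∑ z ∈ s, u z = 1) (hx : ∑ z ∈ s, u z • z = x) :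
    ∃ w, IsBary K x w := by
  classical
  let w : Pt d →₀ ℝ := Finsupp.onFinset s (fun z => if z ∈ s then u z else 0) (by
    intro z hz
    by_contra h
    simp [h] at hz)
  have hsup : w.support ⊆ s := Finsupp.support_onFinset_subset
  have hws : ∀ z ∈ s, w z = u z := fun z hz => by simp [w, hz]
  have hw1 : (w.sum fun _ r => r) = 1 := by
    rw [Finsupp.sum_of_support_subset w hsup _ (by simp), ← h1]
    exact Finset.sum_congr rfl hws
  refine ⟨w, K.down_closed hs hsup ?_, fun z => ?_, hw1, ?_⟩
  · rw [Finset.nonempty_iff_ne_empty]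
    intro h
    rw [Finsupp.sum, h] at hw1
    simp at hw1
  · by_cases hz : z ∈ s
    · rw [hws z hz]; exact h0 z hz
    · simp [w, hz]
  · rw [Finsupp.sum_of_support_subset w hsup _ (by simp), ← hx]
    exact Finset.sum_congr rfl fun z hz => by rw [hws z hz]

/-- Barycentric coordinates are unique across faces, so the choice in the definition of `hat` is
harmless and hat functions can be computed in any face that contains the point. -/
theorem hat_eq_weight {s : Finset (Pt d)} (hs : s ∈ K.faces) {x : Pt d} {u : Pt d → ℝ}
    (h0 : ∀ z ∈ s, 0 ≤ u z) (h1 : ∑ z ∈ s, u z = 1) (hx : ∑ z ∈ s, u z • z = x) :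
    (∀ z ∈ s, hat K z x = u z) ∧ ∀ z ∉ s, hat K z x = 0 := by
  have h := exists_isBary hs h0 h1 hx
  have := h.choose_spec.eq_weights hs h0 h1 hx
  constructor
  · intro z hz
    rw [hat, dif_pos h]
    exact this.1 z hz
  · intro z hz
    rw [hat, dif_pos h]
    exact this.2 z hz

theorem hat_nonneg (y x : Pt d) : 0 ≤ hat K y x := by
  unfold hat
  split_ifs with h
  · exact h.choose_spec.2.1 y
  · rfl

theorem hat_of_notMem_space {x : Pt d} (hx : x ∉ K.space) (y : Pt d) : hat K y x = 0 := by
  rw [hat, dif_neg]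
  rintro ⟨w, hw⟩
  exact hx (K.convexHull_subset_space hw.1 hw.mem_convexHull)

theorem hat_self {y : Pt d} (hy : y ∈ K.vertices) : hat K y y = 1 :=
  (hat_eq_weight (s := {y}) hy (u := fun _ => 1) (by simp) (by simp) (by simp)).1 y (by simp)

theorem hat_of_ne {y z : Pt d} (hy : y ∈ K.vertices) (h : z ≠ y) : hat K z y = 0 :=
  (hat_eq_weight (s := {y}) hy (u := fun _ => 1) (by simp) (by simp) (by simp)).2 z (by simpa)

/-! ### Elements -/

/-- The affine basis that consists of the vertices of a `d`-dimensional face. -/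
def elementBasis {t : Finset (Pt d)} (ht : t ∈ K.faces) (hc : t.card = d + 1) :
    AffineBasis t ℝ (Pt d) where
  toFun := fun z => z
  ind' := K.indep ht
  tot' := by
    rw [(K.indep ht).affineSpan_eq_top_iff_card_eq_finrank_add_one]
    simp [hc]

theorem range_elementBasis {t : Finset (Pt d)} (ht : t ∈ K.faces) (hc : t.card = d + 1) :
    range (elementBasis ht hc) = (t : Set (Pt d)) := by
  ext x
  constructor
  · rintro ⟨z, rfl⟩
    exact z.2
  · intro hx
    exact ⟨⟨x, hx⟩, rfl⟩

open Classical in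
/-- The affine function on the whole space which agrees on the element `t` with the hat function of
the node `y`. -/
def elementHat {t : Finset (Pt d)} (ht : t ∈ K.faces) (hc : t.card = d + 1) (y : Pt d) :
    Pt d →ᵃ[ℝ] ℝ :=
  if hy : y ∈ t then (elementBasis ht hc).coord ⟨y, hy⟩ else 0

theorem elementHat_of_notMem {t : Finset (Pt d)} (ht : t ∈ K.faces) (hc : t.card = d + 1)
    {y : Pt d} (hy : y ∉ t) : elementHat ht hc y = 0 := dif_neg hy

theorem mem_convexHull_iff_elementHat {t : Finset (Pt d)} (ht : t ∈ K.faces)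
    (hc : t.card = d + 1) {x : Pt d} :
    x ∈ convexHull ℝ (t : Set (Pt d)) ↔ ∀ z ∈ t, 0 ≤ elementHat ht hc z x := by
  rw [← range_elementBasis ht hc, AffineBasis.convexHull_eq_nonneg_coord]
  constructor
  · intro h z hz
    rw [elementHat, dif_pos hz]
    exact h _
  · intro h i
    have := h i i.2
    rwa [elementHat, dif_pos i.2] at this

theorem sum_elementHat {t : Finset (Pt d)} (ht : t ∈ K.faces) (hc : t.card = d + 1) (x : Pt d) :
    ∑ z ∈ t, elementHat ht hc z x = 1 := by
  rw [← (elementBasis ht hc).sum_coord_apply_eq_one x, ← Finset.sum_attach]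
  exact Finset.sum_congr rfl fun z _ => by rw [elementHat, dif_pos z.2]

theorem sum_elementHat_smul {t : Finset (Pt d)} (ht : t ∈ K.faces) (hc : t.card = d + 1)
    (x : Pt d) : ∑ z ∈ t, elementHat ht hc z x • z = x := by
  conv_rhs => rw [← (elementBasis ht hc).linear_combination_coord_eq_self x]
  rw [← Finset.sum_attach]
  refine Finset.sum_congr rfl fun z _ => ?_
  rw [elementHat, dif_pos z.2]
  rfl

theorem hat_eq_elementHat {t : Finset (Pt d)} (ht : t ∈ K.faces) (hc : t.card = d + 1)
    {x : Pt d} (hx : x ∈ convexHull ℝ (t : Set (Pt d))) (y : Pt d) :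
    hat K y x = elementHat ht hc y x := by
  have h := hat_eq_weight ht ((mem_convexHull_iff_elementHat ht hc).1 hx)
    (sum_elementHat ht hc x) (sum_elementHat_smul ht hc x)
  by_cases hy : y ∈ t
  · exact h.1 y hy
  · rw [h.2 y hy, elementHat_of_notMem ht hc hy]
    rfl

theorem affineMap_eq_sum_elementHat {t : Finset (Pt d)} (ht : t ∈ K.faces) (hc : t.card = d + 1)
    (l : Pt d →ᵃ[ℝ] ℝ) (x : Pt d) : l x = ∑ z ∈ t, l z * elementHat ht hc z x := by
  have h := sum_elementHat_smul ht hc x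
  have h1 := sum_elementHat ht hc x
  have hl : ∀ y, l y = l.linear y + l 0 := fun y => congrFun l.decomp y
  calc l x = l.linear (∑ z ∈ t, elementHat ht hc z x • z) +
        l 0 * ∑ z ∈ t, elementHat ht hc z x := by rw [h, h1, mul_one, ← hl]
    _ = ∑ z ∈ t, l z * elementHat ht hc z x := by
        rw [map_sum, Finset.mul_sum, ← Finset.sum_add_distrib]
        refine Finset.sum_congr rfl fun z _ => ?_
        rw [map_smul, smul_eq_mul, hl z]
        ring

/-- A point of the mesh belongs to an element. -/
theorem IsMesh.exists_element (hK : IsMesh K Ω) {x : Pt d} (hx : x ∈ closure Ω) :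
    ∃ t, ∃ _ : t ∈ K.faces, t.card = d + 1 ∧ x ∈ convexHull ℝ (t : Set (Pt d)) := by
  rw [← hK.space_eq, Geometry.SimplicialComplex.mem_space_iff] at hx
  obtain ⟨s, hs, hx⟩ := hx
  obtain ⟨t, ht, hst, hc⟩ := hK.pure s hs
  exact ⟨t, ht, hc, convexHull_mono (by exact_mod_cast hst) hx⟩

/-! ### Continuous piecewise affine functions -/

theorem IsMesh.finite_vertices (hK : IsMesh K Ω) : K.vertices.Finite := by
  rw [Geometry.SimplicialComplex.vertices_eq]
  exact hK.finite.biUnion fun s _ => s.finite_toSet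

theorem IsMesh.vertices_subset (hK : IsMesh K Ω) : K.vertices ⊆ closure Ω :=
  hK.space_eq ▸ K.vertices_subset_space

theorem mem_vertices_of_mem_face {t : Finset (Pt d)} (ht : t ∈ K.faces) {z : Pt d} (hz : z ∈ t) :
    z ∈ K.vertices := by
  rw [Geometry.SimplicialComplex.vertices_eq]
  exact mem_biUnion ht hz

theorem hat_mem_P1Space (hK : IsMesh K Ω) (y : Pt d) : hat K y ∈ P1Space K := by
  refine ⟨fun s hs => ?_, fun x hx => hat_of_notMem_space hx y⟩
  obtain ⟨t, ht, hst, hc⟩ := hK.pure s hs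
  exact ⟨elementHat ht hc y, fun x hx =>
    hat_eq_elementHat ht hc (convexHull_mono (by exact_mod_cast hst) hx) y⟩

/-- The constant function on the mesh. -/
def constP1 (K : Geometry.SimplicialComplex ℝ (Pt d)) (r : ℝ) : P1Space K :=
  ⟨K.space.indicator fun _ => r, fun s hs => ⟨AffineMap.const ℝ _ r, fun x hx => by
    rw [indicator_of_mem (K.convexHull_subset_space hs hx)]
    rfl⟩, fun x hx => indicator_of_notMem hx _⟩

theorem IsMesh.constP1_apply (hK : IsMesh K Ω) (r : ℝ) {x : Pt d} (hx : x ∈ closure Ω) :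
    (constP1 K r : Pt d → ℝ) x = r :=
  indicator_of_mem (f := fun _ => r) (hK.space_eq ▸ hx : x ∈ K.space)

theorem P1Space.eqOn_element {w : Pt d → ℝ} (hw : w ∈ P1Space K) {t : Finset (Pt d)}
    (ht : t ∈ K.faces) (hc : t.card = d + 1) {x : Pt d}
    (hx : x ∈ convexHull ℝ (t : Set (Pt d))) :
    w x = ∑ z ∈ t, w z * elementHat ht hc z x := by
  obtain ⟨l, hl⟩ := hw.1 t ht
  rw [hl hx, affineMap_eq_sum_elementHat ht hc]
  exact Finset.sum_congr rfl fun z hz => by rw [hl (subset_convexHull ℝ _ hz)]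

theorem IsMesh.eq_sum_hat (hK : IsMesh K Ω) {w : Pt d → ℝ} (hw : w ∈ P1Space K) :
    w = ∑ z ∈ hK.finite_vertices.toFinset, w z • hat K z := by
  ext x
  simp only [Finset.sum_apply, Pi.smul_apply, smul_eq_mul]
  by_cases hx : x ∈ K.space
  · obtain ⟨t, ht, hc, hxt⟩ := hK.exists_element (hK.space_eq ▸ hx)
    rw [P1Space.eqOn_element hw ht hc hxt]
    simp_rw [hat_eq_elementHat ht hc hxt]
    refine Finset.sum_subset (fun z hz => ?_) fun z _ hz => ?_
    · exact hK.finite_vertices.mem_toFinset.2 (mem_vertices_of_mem_face ht hz)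
    · rw [elementHat_of_notMem ht hc hz]
      simp
  · simp [hw.2 x hx, hat_of_notMem_space hx]

/-- Nodal upper bounds of a piecewise affine function are upper bounds. -/
theorem IsMesh.le_of_vertices_le (hK : IsMesh K Ω) {w : Pt d → ℝ} (hw : w ∈ P1Space K) {m : ℝ}
    (h : ∀ z ∈ K.vertices, w z ≤ m) {x : Pt d} (hx : x ∈ closure Ω) : w x ≤ m := by
  obtain ⟨t, ht, hc, hxt⟩ := hK.exists_element hx
  rw [P1Space.eqOn_element hw ht hc hxt]
  calc _ ≤ ∑ z ∈ t, m * elementHat ht hc z x := Finset.sum_le_sum fun z hz =>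
        mul_le_mul_of_nonneg_right (h z (mem_vertices_of_mem_face ht hz))
          ((mem_convexHull_iff_elementHat ht hc).1 hxt z hz)
    _ = m := by rw [← Finset.mul_sum, sum_elementHat, mul_one]

theorem IsMesh.le_of_vertices_ge (hK : IsMesh K Ω) {w : Pt d → ℝ} (hw : w ∈ P1Space K) {m : ℝ}
    (h : ∀ z ∈ K.vertices, m ≤ w z) {x : Pt d} (hx : x ∈ closure Ω) : m ≤ w x := by
  have := hK.le_of_vertices_le ((P1Space K).neg_mem hw) (m := -m)
    (fun z hz => by simpa using h z hz) hx
  simpa using this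

theorem isClosed_convexHull_face (t : Finset (Pt d)) :
    IsClosed (convexHull ℝ (t : Set (Pt d))) :=
  (t.finite_toSet.isCompact_convexHull ℝ).isClosed

/-- Near a node `y`, the mesh consists of elements that contain `y`. -/
theorem IsMesh.eventually_mem_star (hK : IsMesh K Ω) {y : Pt d} (hy : y ∈ K.vertices) :
    ∀ᶠ x in 𝓝 y, ∀ t ∈ K.faces, x ∈ convexHull ℝ (t : Set (Pt d)) → y ∈ t := by
  rw [eventually_all_finite hK.finite]
  intro t ht
  by_cases hyt : y ∈ t
  · exact Eventually.of_forall fun _ _ => hyt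
  · have : y ∈ (convexHull ℝ (t : Set (Pt d)))ᶜ := fun h =>
      hyt ((Geometry.SimplicialComplex.vertex_mem_convexHull_iff hy ht).1 h)
    filter_upwards [(isClosed_convexHull_face t).isOpen_compl.mem_nhds this] with x hx hx'
    exact absurd hx' hx

theorem IsMesh.bddAbove_diam (hK : IsMesh K Ω) :
    BddAbove ((fun s : Finset (Pt d) => Metric.diam (convexHull ℝ (s : Set (Pt d)))) '' K.faces) :=
  (hK.finite.image _).bddAbove

theorem IsMesh.dist_le_meshSize (hK : IsMesh K Ω) {t : Finset (Pt d)} (ht : t ∈ K.faces)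
    {x y : Pt d} (hx : x ∈ convexHull ℝ (t : Set (Pt d)))
    (hy : y ∈ convexHull ℝ (t : Set (Pt d))) : dist x y ≤ meshSize K :=
  (Metric.dist_le_diam_of_mem (t.finite_toSet.isCompact_convexHull ℝ).isBounded hx hy).trans
    (le_csSup hK.bddAbove_diam (mem_image_of_mem _ ht))

theorem IsMesh.exists_vertex_near (hK : IsMesh K Ω) {x : Pt d} (hx : x ∈ closure Ω) :
    ∃ y ∈ K.vertices, dist y x ≤ meshSize K := by
  obtain ⟨t, ht, hc, hxt⟩ := hK.exists_element hx
  obtain ⟨y, hy⟩ := K.nonempty_of_mem_faces ht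
  exact ⟨y, mem_vertices_of_mem_face ht hy,
    hK.dist_le_meshSize ht (subset_convexHull ℝ _ hy) hxt⟩

/-- Around a point where the hat function of `y` does not vanish. -/
theorem IsMesh.dist_le_of_hat_ne_zero (hK : IsMesh K Ω) {y x : Pt d} (h : hat K y x ≠ 0) :
    dist x y ≤ meshSize K := by
  by_cases hx : x ∈ closure Ω
  · obtain ⟨t, ht, hc, hxt⟩ := hK.exists_element hx
    rw [hat_eq_elementHat ht hc hxt] at h
    by_cases hy : y ∈ t
    · exact hK.dist_le_meshSize ht hxt (subset_convexHull ℝ _ hy)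
    · rw [elementHat_of_notMem ht hc hy] at h
      exact absurd rfl h
  · exact absurd (hat_of_notMem_space (hK.space_eq ▸ hx) y) h

theorem IsMesh.continuousOn (hK : IsMesh K Ω) {w : Pt d → ℝ} (hw : w ∈ P1Space K) :
    ContinuousOn w (closure Ω) := by
  have : Finite K.faces := hK.finite
  have h : closure Ω = ⋃ s : K.faces, convexHull ℝ ((s : Finset (Pt d)) : Set (Pt d)) := by
    rw [← hK.space_eq, Geometry.SimplicialComplex.space, biUnion_eq_iUnion]
  rw [h]
  refine (locallyFinite_of_finite _).continuousOn_iUnion (fun s => isClosed_convexHull_face _)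
    fun s => ?_
  obtain ⟨l, hl⟩ := hw.1 s s.2
  exact (l.continuous_of_finiteDimensional.continuousOn).congr hl

/-! ### The star of an internal node -/

/-- A Lipschitz domain lies on one side of its boundary: arbitrarily close to a boundary point,
vertically below it, there is an open region under the graph that misses the domain. Hence no
boundary point is interior to the closure. -/
theorem IsLipschitzDomain.interior_closure (hΩ : IsLipschitzDomain Ω) :
    interior (closure Ω) = Ω := by
  refine Subset.antisymm (fun x hx => ?_) (hΩ.isOpen.subset_interior_iff.2 subset_closure)
  by_contra hxΩ
  have hxf : x ∈ frontier Ω := ⟨interior_subset hx, by rwa [hΩ.isOpen.interior_eq]⟩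
  obtain ⟨e, r, γ, L, he, hr, hγ, hloc⟩ := hΩ.boundary x hxf
  have hγx : inner ℝ e x ≤ γ (x - inner ℝ e x • e) := by
    by_contra! h
    have : x ∈ Ω ∩ Metric.ball x r := hloc ▸ ⟨h, Metric.mem_ball_self hr⟩
    exact hxΩ this.1
  have hcont : Tendsto (fun τ : ℝ => x - τ • e) (𝓝[>] 0) (𝓝 x) := by
    have : Continuous fun τ : ℝ => x - τ • e := by fun_prop
    simpa using (this.tendsto 0).mono_left nhdsWithin_le_nhds
  obtain ⟨τ, ⟨hτc, hτb⟩, hτ⟩ := ((hcont.eventually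
    (inter_mem (isOpen_interior.mem_nhds hx) (Metric.ball_mem_nhds x hr))).and
      self_mem_nhdsWithin).exists
  have hτc := interior_subset hτc
  have hopen : IsOpen {z : Pt d | inner ℝ e z < γ (z - inner ℝ e z • e)} :=
    isOpen_lt (by fun_prop) (hγ.continuous.comp (by fun_prop))
  have hee : inner ℝ e e = (1 : ℝ) := by rw [real_inner_self_eq_norm_sq, he]; norm_num
  have hmem : x - τ • e ∈ {z : Pt d | inner ℝ e z < γ (z - inner ℝ e z • e)} := by
    have h1 : inner ℝ e (x - τ • e) = inner ℝ e x - τ := by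
      rw [inner_sub_right, inner_smul_right, hee, mul_one]
    have h2 : x - τ • e - (inner ℝ e x - τ) • e = x - inner ℝ e x • e := by
      rw [sub_smul]; abel
    rw [Set.mem_ofPred_eq, h1, h2]
    have : (0 : ℝ) < τ := hτ
    linarith
  obtain ⟨z, ⟨hz1, hz2⟩, hzΩ⟩ := mem_closure_iff.1 hτc _
    (hopen.inter Metric.isOpen_ball) ⟨hmem, hτb⟩
  have : z ∈ {x | γ (x - inner ℝ e x • e) < inner ℝ e x} ∩ Metric.ball x r := hloc ▸ ⟨hzΩ, hz2⟩
  have h1 : γ (z - inner ℝ e z • e) < inner ℝ e z := this.1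
  have h2 : inner ℝ e z < γ (z - inner ℝ e z • e) := hz1
  exact lt_asymm h1 h2

/-- The points where the hat function of an internal node is positive are interior points of the
mesh. -/
theorem IsMesh.mem_interior_of_hat_pos (hK : IsMesh K Ω) (hΩ : IsOpen Ω) {y x : Pt d}
    (hy : y ∈ K.vertices) (hyΩ : y ∈ Ω) (hx : 0 < hat K y x) : x ∈ interior (closure Ω) := by
  have hxc : x ∈ closure Ω := by
    by_contra h
    rw [hat_of_notMem_space (hK.space_eq ▸ h)] at hx
    exact lt_irrefl _ hx
  obtain ⟨s, hs, hsc, hxs⟩ := hK.exists_element hxc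
  rw [hat_eq_elementHat hs hsc hxs] at hx
  have hys : y ∈ s := by
    by_contra h
    rw [elementHat_of_notMem hs hsc h] at hx
    exact lt_irrefl _ hx
  -- a homothety with centre `y` moves a neighbourhood of `x` into the star of `y`
  have hhom : ∀ z : Pt d, Tendsto (fun ε : ℝ => AffineMap.lineMap y z ε) (𝓝[>] 0) (𝓝 y) := by
    intro z
    have : Continuous fun ε : ℝ => (AffineMap.lineMap y z ε : Pt d) := AffineMap.lineMap_continuous
    simpa using (this.tendsto 0).mono_left nhdsWithin_le_nhds
  have hU := inter_mem (hK.eventually_mem_star hy) (hΩ.mem_nhds hyΩ)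
  obtain ⟨ε, ⟨hεU, hε1⟩, hε0⟩ := (((hhom x).eventually (eventually_mem_nhds_iff.2 hU)).and
    (nhdsWithin_le_nhds (Iio_mem_nhds (zero_lt_one' ℝ)))).and self_mem_nhdsWithin |>.exists
  have hε0 : 0 < ε := hε0
  have hε1 : ε < 1 := hε1
  have hcont : Continuous fun z : Pt d => (AffineMap.lineMap y z ε : Pt d) := by
    simp only [AffineMap.lineMap_apply]
    fun_prop
  have coordeq : ∀ {t : Finset (Pt d)} (ht : t ∈ K.faces) (hc : t.card = d + 1) (z q : Pt d),
      elementHat ht hc q (AffineMap.lineMap y z ε) =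
        (1 - ε) * elementHat ht hc q y + ε * elementHat ht hc q z := by
    intro t ht hc z q
    rw [AffineMap.apply_lineMap, AffineMap.lineMap_apply_ring']
    ring
  have coordy : ∀ {t : Finset (Pt d)} (ht : t ∈ K.faces) (hc : t.card = d + 1) (q : Pt d),
      y ∈ t → elementHat ht hc q y = if q = y then 1 else 0 := by
    intro t ht hc q hyt
    rw [← hat_eq_elementHat ht hc (subset_convexHull ℝ _ hyt)]
    split_ifs with h
    · rw [h, hat_self hy]
    · exact hat_of_ne hy h
  have hpx : AffineMap.lineMap y x ε ∈ convexHull ℝ (s : Set (Pt d)) :=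
    (convex_convexHull ℝ _).segment_subset (subset_convexHull ℝ _ hys) hxs
      (by rw [segment_eq_image_lineMap]; exact ⟨ε, ⟨hε0.le, hε1.le⟩, rfl⟩)
  -- If `t` contains the contracted `x`, then `s` and `t` give the same value of the hat function
  -- there, hence the two affine extensions agree at `x`, and positivity persists nearby. If `t`
  -- misses the contracted `x`, it also misses the contracted `x'` for `x'` near `x`.
  have near : ∀ᶠ x' in 𝓝 x, ∀ t ∈ K.faces, ∀ (ht : t ∈ K.faces) (hc : t.card = d + 1), y ∈ t →
      AffineMap.lineMap y x' ε ∈ convexHull ℝ (t : Set (Pt d)) → 0 < elementHat ht hc y x' := by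
    rw [eventually_all_finite hK.finite]
    intro t ht
    by_cases hc : t.card = d + 1
    swap
    · exact Eventually.of_forall fun _ _ h => absurd h hc
    by_cases hyt : y ∈ t
    swap
    · exact Eventually.of_forall fun _ _ _ h => absurd h hyt
    by_cases hxt : AffineMap.lineMap y x ε ∈ convexHull ℝ (t : Set (Pt d))
    · have hval : 0 < elementHat ht hc y x := by
        have e1 := hat_eq_elementHat ht hc hxt y
        rw [hat_eq_elementHat hs hsc hpx, coordeq, coordeq, coordy hs hsc y hys,
          coordy ht hc y hyt] at e1
        have : elementHat hs hsc y x = elementHat ht hc y x := by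
          have := mul_left_cancel₀ hε0.ne' (add_left_cancel e1)
          exact this
        rwa [← this]
      filter_upwards [(elementHat ht hc y).continuous_of_finiteDimensional.continuousAt.eventually
        (lt_mem_nhds hval)] with x' hx' _ _ _ _
      exact hx'
    · filter_upwards [hcont.continuousAt.eventually
        ((isClosed_convexHull_face t).isOpen_compl.mem_nhds hxt)] with x' hx' _ _ _ h
      exact absurd h hx'
  rw [mem_interior_iff_mem_nhds]
  filter_upwards [near, hcont.continuousAt.eventually hεU] with x' hx' hU'
  obtain ⟨t, ht, hc, hpt⟩ := hK.exists_element (subset_closure hU'.2)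
  have hyt := hU'.1 t ht hpt
  rw [← hK.space_eq]
  -- The homothety multiplies every coordinate other than that of `y` by `ε`, so its sign at `x'` is
  -- its sign at the contracted point; the coordinate of `y` is positive by `near`.
  refine K.convexHull_subset_space ht ((mem_convexHull_iff_elementHat ht hc).2 fun z hz => ?_)
  by_cases hzy : z = y
  · subst hzy
    exact (hx' t ht ht hc hyt hpt).le
  · have h0 := (mem_convexHull_iff_elementHat ht hc).1 hpt z hz
    rw [coordeq, coordy ht hc z hyt, if_neg hzy, mul_zero, zero_add] at h0
    exact nonneg_of_mul_nonneg_right h0 hε0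

theorem IsMesh.hat_eq_zero_of_notMem (hK : IsMesh K Ω) (hΩ : IsLipschitzDomain Ω) {y x : Pt d}
    (hy : y ∈ K.vertices ∩ Ω) (hx : x ∉ Ω) : hat K y x = 0 := by
  by_contra h
  exact hx (hΩ.interior_closure ▸ hK.mem_interior_of_hat_pos hΩ.isOpen hy.1 hy.2
    (lt_of_le_of_ne (hat_nonneg y x) (Ne.symm h)))

/-! ### Lipschitz continuity of hat functions -/

/-- Continuous induction along the segment from `x` to `y`. The pieces need not be convex and the
segment may cross between them many times, so the bound is only propagated a little to the right of
each parameter at which it holds. -/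
theorem lipschitzWith_of_finite_closed_cover {ι : Type*} [Finite ι] {S : ι → Set (Pt d)}
    (hS : ∀ i, IsClosed (S i)) (hcov : ∀ x, ∃ i, x ∈ S i) {u : Pt d → ℝ} (hu : Continuous u)
    {L : ℝ≥0} (h : ∀ i, LipschitzOnWith L u (S i)) : LipschitzWith L u := by
  refine LipschitzWith.of_dist_le_mul fun x y => ?_
  set γ : ℝ → Pt d := fun τ => AffineMap.lineMap x y τ with hγ
  have hγc : Continuous γ := AffineMap.lineMap_continuous
  have key : Icc (0 : ℝ) 1 ⊆ {τ | dist (u x) (u (γ τ)) ≤ L * (τ * dist x y)} := by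
    refine IsClosed.Icc_subset_of_forall_exists_gt ?_ ?_ ?_
    · refine IsClosed.inter (isClosed_le ?_ ?_) isClosed_Icc
      · exact continuous_const.dist (hu.comp hγc)
      · fun_prop
    · simp [hγ]
    · rintro τ ⟨hτ, hτI⟩ τ' hτ'
      -- Since there are finitely many pieces, one of them is visited by parameters arbitrarily
      -- close to `τ` on the right; being closed, it also contains the point at `τ`.
      obtain ⟨i, hi⟩ : ∃ i, ∃ᶠ σ in 𝓝[>] τ, γ σ ∈ S i := by
        by_contra! hcon
        have : ∀ᶠ σ in 𝓝[>] τ, ∀ i, γ σ ∉ S i :=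
          eventually_all.2 fun i => by simpa [Filter.not_frequently] using hcon i
        obtain ⟨σ, hσ⟩ := this.exists
        obtain ⟨i, hi⟩ := hcov (γ σ)
        exact hσ i hi
      have hτi : γ τ ∈ S i :=
        (hS i).mem_of_frequently_of_tendsto hi ((hγc.tendsto τ).mono_left nhdsWithin_le_nhds)
      obtain ⟨σ, hσi, hσ⟩ := (hi.and_eventually (Ioc_mem_nhdsGT hτ')).exists
      refine ⟨σ, ?_, hσ⟩
      have h1 := (h i).dist_le_mul _ hτi _ hσi
      have h2 : dist (γ τ) (γ σ) = (σ - τ) * dist x y := by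
        simp only [hγ, dist_lineMap_lineMap]
        rw [dist_comm, Real.dist_eq, abs_of_pos (sub_pos.2 hσ.1)]
      rw [h2] at h1
      have h3 : dist (u x) (u (γ τ)) ≤ L * (τ * dist x y) := hτ
      calc dist (u x) (u (γ σ)) ≤ dist (u x) (u (γ τ)) + dist (u (γ τ)) (u (γ σ)) :=
            dist_triangle _ _ _
        _ ≤ L * (τ * dist x y) + L * ((σ - τ) * dist x y) := add_le_add h3 h1
        _ = L * (σ * dist x y) := by ring
  have := key (right_mem_Icc.2 zero_le_one)
  simpa [hγ] using this

/-- The pieces of the cover are the elements, where the hat function is affine, and the complement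
of `Ω`, where it vanishes because the node is internal. Lipschitz continuity on the whole space is
what allows integration by parts without boundary terms. -/
theorem IsMesh.exists_lipschitzWith_hat (hK : IsMesh K Ω) (hΩ : IsLipschitzDomain Ω) {y : Pt d}
    (hy : y ∈ K.vertices ∩ Ω) : ∃ L, LipschitzWith L (hat K y) := by
  classical
  have : Finite K.faces := hK.finite
  let S : Option K.faces → Set (Pt d) := fun o =>
    o.elim Ωᶜ fun s => convexHull ℝ ((s : Finset (Pt d)) : Set (Pt d))
  have hS : ∀ i, IsClosed (S i) := by
    rintro (_ | s)
    · exact hΩ.isOpen.isClosed_compl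
    · exact isClosed_convexHull_face _
  have hcov : ∀ x, ∃ i, x ∈ S i := by
    intro x
    by_cases hx : x ∈ Ω
    · obtain ⟨t, ht, -, hxt⟩ := hK.exists_element (subset_closure hx)
      exact ⟨some ⟨t, ht⟩, hxt⟩
    · exact ⟨none, hx⟩
  have hloc : ∀ i, ∃ L, LipschitzOnWith L (hat K y) (S i) := by
    rintro (_ | s)
    · refine ⟨0, LipschitzOnWith.of_dist_le_mul fun x hx z hz => ?_⟩
      rw [hK.hat_eq_zero_of_notMem hΩ hy hx, hK.hat_eq_zero_of_notMem hΩ hy hz]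
      simp
    · obtain ⟨l, hl⟩ := (hat_mem_P1Space hK y).1 s s.2
      let m := LinearMap.toContinuousLinearMap l.linear
      refine ⟨‖m‖₊, LipschitzOnWith.of_dist_le_mul fun x hx z hz => ?_⟩
      rw [hl hx, hl hz, Real.dist_eq, dist_eq_norm]
      have : l x - l z = m (x - z) := by
        have := l.linearMap_vsub x z
        simpa [m] using this.symm
      rw [this]
      exact m.le_opNorm _
  choose L hL using hloc
  obtain ⟨C, hC⟩ := (finite_range L).bddAbove
  have hL' : ∀ i, LipschitzOnWith C (hat K y) (S i) := fun i =>
    (hL i).weaken (hC (mem_range_self i))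
  refine ⟨C, lipschitzWith_of_finite_closed_cover hS hcov ?_ hL'⟩
  exact (locallyFinite_of_finite S).continuous (eq_univ_of_forall fun x => mem_iUnion.2 (hcov x)) hS
    fun i => (hL' i).continuousOn

/-! ### Gradients of piecewise affine functions -/

theorem IsLipschitzDomain.isFiniteMeasure (hΩ : IsLipschitzDomain Ω) :
    IsFiniteMeasure (volume.restrict Ω) :=
  ⟨by simpa using hΩ.isBounded.measure_lt_top⟩

/-- Frontiers of convex sets are null sets and there are finitely many faces. Gradients of piecewise
affine functions are thus classical almost everywhere. -/
theorem IsMesh.ae_mem_interior (hK : IsMesh K Ω) (hΩ : MeasurableSet Ω) :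
    ∀ᵐ x ∂volume.restrict Ω, ∃ t ∈ K.faces, t.card = d + 1 ∧
      x ∈ interior (convexHull ℝ (t : Set (Pt d))) := by
  have h0 : ∀ᵐ x ∂(volume : Measure (Pt d)), ∀ t ∈ K.faces,
      x ∉ frontier (convexHull ℝ (t : Set (Pt d))) := by
    rw [ae_ball_iff hK.finite.countable]
    intro t _
    exact measure_eq_zero_iff_ae_notMem.1 ((convex_convexHull ℝ _).addHaar_frontier volume)
  filter_upwards [ae_restrict_of_ae h0, ae_restrict_mem hΩ] with x hx hxΩ
  obtain ⟨t, ht, hc, hxt⟩ := hK.exists_element (subset_closure hxΩ)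
  refine ⟨t, ht, hc, ?_⟩
  by_contra hi
  exact hx t ht ⟨subset_closure hxt, hi⟩

theorem P1Space.exists_hasGradientAt {w : Pt d → ℝ} (hw : w ∈ P1Space K) {t : Finset (Pt d)}
    (ht : t ∈ K.faces) :
    ∃ G : Pt d, ∀ x ∈ interior (convexHull ℝ (t : Set (Pt d))), HasGradientAt w G x := by
  obtain ⟨l, hl⟩ := hw.1 t ht
  refine ⟨(InnerProductSpace.toDual ℝ (Pt d)).symm (LinearMap.toContinuousLinearMap l.linear),
    fun x hx => ?_⟩
  rw [hasGradientAt_iff_hasFDerivAt, LinearIsometryEquiv.apply_symm_apply]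
  have h1 : HasFDerivAt l (LinearMap.toContinuousLinearMap l.linear) x := by
    have h2 := ((LinearMap.toContinuousLinearMap l.linear).hasFDerivAt (x := x)).add_const (l 0)
    refine h2.congr_of_eventuallyEq (Eventually.of_forall fun z => ?_)
    exact congrFun l.decomp z
  exact h1.congr_of_eventuallyEq
    (Filter.eventuallyEq_of_mem (mem_interior_iff_mem_nhds.1 hx) hl)

theorem IsMesh.ae_differentiableAt (hK : IsMesh K Ω) (hΩ : MeasurableSet Ω) {w : Pt d → ℝ}
    (hw : w ∈ P1Space K) : ∀ᵐ x ∂volume.restrict Ω, DifferentiableAt ℝ w x := by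
  filter_upwards [hK.ae_mem_interior hΩ] with x hx
  obtain ⟨t, ht, -, hxt⟩ := hx
  obtain ⟨G, hG⟩ := P1Space.exists_hasGradientAt hw ht
  exact (hG x hxt).differentiableAt

theorem measurable_gradient (w : Pt d → ℝ) : Measurable (gradient w) :=
  (InnerProductSpace.toDual ℝ (Pt d)).symm.continuous.measurable.comp (measurable_fderiv ℝ w)

theorem IsMesh.memLp_gradient (hK : IsMesh K Ω) (hΩ : MeasurableSet Ω) {w : Pt d → ℝ}
    (hw : w ∈ P1Space K) : MemLp (gradient w) ∞ (volume.restrict Ω) := by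
  have h : ∀ t : K.faces, ∃ G : Pt d,
      ∀ x ∈ interior (convexHull ℝ ((t : Finset (Pt d)) : Set (Pt d))), HasGradientAt w G x :=
    fun t => P1Space.exists_hasGradientAt hw t.2
  choose G hG using h
  have : Finite K.faces := hK.finite
  obtain ⟨C, hC⟩ := (finite_range fun t => ‖G t‖).bddAbove
  refine memLp_top_of_bound (measurable_gradient w).aestronglyMeasurable C ?_
  filter_upwards [hK.ae_mem_interior hΩ] with x hx
  obtain ⟨t, ht, -, hxt⟩ := hx
  rw [(hG ⟨t, ht⟩ x hxt).gradient]
  exact hC (mem_range_self _)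

theorem IsMesh.exists_abs_le (hK : IsMesh K Ω) {w : Pt d → ℝ} (hw : w ∈ P1Space K) :
    ∃ C, ∀ x ∈ closure Ω, |w x| ≤ C := by
  obtain ⟨C, hC⟩ := (hK.finite_vertices.image fun z => |w z|).bddAbove
  have hz : ∀ z ∈ K.vertices, |w z| ≤ C := fun z hz => hC (mem_image_of_mem _ hz)
  exact ⟨C, fun x hx => abs_le.2
    ⟨hK.le_of_vertices_ge hw (fun z h => (abs_le.1 (hz z h)).1) hx,
      hK.le_of_vertices_le hw (fun z h => (abs_le.1 (hz z h)).2) hx⟩⟩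

theorem IsMesh.memLp (hK : IsMesh K Ω) (hΩ : MeasurableSet Ω) {w : Pt d → ℝ}
    (hw : w ∈ P1Space K) : MemLp w ∞ (volume.restrict Ω) := by
  obtain ⟨C, hC⟩ := hK.exists_abs_le hw
  refine memLp_top_of_bound
    (((hK.continuousOn hw).mono subset_closure).aestronglyMeasurable hΩ) C ?_
  filter_upwards [ae_restrict_mem hΩ] with x hx
  exact hC x (subset_closure hx)

theorem memLp_top_inner {μ : Measure (Pt d)} {u w : Pt d → Pt d} (hu : MemLp u ∞ μ)
    (hw : MemLp w ∞ μ) : MemLp (fun x => inner ℝ (u x) (w x)) ∞ μ := by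
  refine MemLp.of_le_mul (c := 1) (g := fun x => ‖u x‖ * ‖w x‖) (hw.norm.mul' hu.norm)
    (hu.1.inner hw.1) (Eventually.of_forall fun x => ?_)
  rw [one_mul, norm_mul, norm_norm, norm_norm]
  exact norm_inner_le_norm _ _

/-! ### Normalised hat functions -/

theorem hatN_eq_smul (y : Pt d) : hatN K Ω y = (∫ z in Ω, |hat K y z|)⁻¹ • hat K y := by
  ext x
  rw [hatN, Pi.smul_apply, smul_eq_mul, div_eq_inv_mul]

theorem hatN_mem_P1Space (hK : IsMesh K Ω) (y : Pt d) : hatN K Ω y ∈ P1Space K := by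
  rw [hatN_eq_smul]
  exact (P1Space K).smul_mem _ (hat_mem_P1Space hK y)

theorem hatN_nonneg (y x : Pt d) : 0 ≤ hatN K Ω y x :=
  div_nonneg (hat_nonneg y x) (integral_nonneg fun _ => abs_nonneg _)

theorem hat_ne_zero_of_hatN_ne_zero {y x : Pt d} (h : hatN K Ω y x ≠ 0) : hat K y x ≠ 0 :=
  fun h0 => h (by rw [hatN, h0, zero_div])

theorem IsMesh.integral_hat_pos (hK : IsMesh K Ω) (hΩ : IsLipschitzDomain Ω) {y : Pt d}
    (hy : y ∈ K.vertices ∩ Ω) : 0 < ∫ z in Ω, |hat K y z| := by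
  have := hΩ.isFiniteMeasure
  have hi : Integrable (fun z => |hat K y z|) (volume.restrict Ω) :=
    ((hK.memLp hΩ.isOpen.measurableSet (hat_mem_P1Space hK y)).integrable le_top).abs
  rw [setIntegral_pos_iff_support_of_nonneg_ae (Eventually.of_forall fun _ => abs_nonneg _) hi]
  refine Measure.measure_pos_of_mem_nhds volume (x := y) (inter_mem ?_ (hΩ.isOpen.mem_nhds hy.2))
  have hc : ContinuousAt (hat K y) y := (hK.continuousOn (hat_mem_P1Space hK y)).continuousAt
    (mem_of_superset (hΩ.isOpen.mem_nhds hy.2) subset_closure)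
  have h1 : (0 : ℝ) < hat K y y := by rw [hat_self hy.1]; exact one_pos
  filter_upwards [hc.eventually (lt_mem_nhds h1)] with z hz
  rw [Function.mem_support]
  exact abs_ne_zero.2 hz.ne'

theorem IsMesh.integral_hatN (hK : IsMesh K Ω) (hΩ : IsLipschitzDomain Ω) {y : Pt d}
    (hy : y ∈ K.vertices ∩ Ω) : ∫ z in Ω, hatN K Ω y z = 1 := by
  simp_rw [hatN, integral_div]
  rw [div_eq_one_iff_eq (hK.integral_hat_pos hΩ hy).ne']
  exact integral_congr_ae (Eventually.of_forall fun x => (abs_of_nonneg (hat_nonneg y x)).symm)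

/-- Averages against a normalised hat function. -/
theorem IsMesh.abs_average_sub_le (hK : IsMesh K Ω) (hΩ : IsLipschitzDomain Ω) {y : Pt d}
    (hy : y ∈ K.vertices ∩ Ω) {u : Pt d → ℝ} (hu : MemLp u ∞ (volume.restrict Ω)) {m δ : ℝ}
    (h : ∀ᵐ x ∂volume.restrict Ω, hat K y x ≠ 0 → |u x - m| ≤ δ) :
    |(∫ x in Ω, u x * hatN K Ω y x) - m| ≤ δ := by
  have := hΩ.isFiniteMeasure
  have hφ := hK.memLp hΩ.isOpen.measurableSet (hatN_mem_P1Space (Ω := Ω) hK y)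
  have h1 := hK.integral_hatN hΩ hy
  have hm : (∫ x in Ω, u x * hatN K Ω y x) - m = ∫ x in Ω, (u x - m) * hatN K Ω y x := by
    simp_rw [sub_mul]
    rw [integral_sub ((hφ.mul' hu : MemLp _ ∞ _).integrable le_top)
      ((hφ.integrable le_top).const_mul m), integral_const_mul, h1, mul_one]
  rw [hm, ← Real.norm_eq_abs]
  calc _ ≤ ∫ x in Ω, δ * hatN K Ω y x := by
        refine norm_integral_le_of_norm_le ((hφ.integrable le_top).const_mul δ) ?_
        filter_upwards [h] with x hx
        rw [norm_mul, Real.norm_eq_abs, Real.norm_eq_abs, abs_of_nonneg (hatN_nonneg y x)]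
        by_cases h0 : hatN K Ω y x = 0
        · simp [h0]
        · exact mul_le_mul_of_nonneg_right (hx (hat_ne_zero_of_hatN_ne_zero h0)) (hatN_nonneg y x)
    _ = δ := by rw [integral_const_mul, h1, mul_one]

/-! ### Integration by parts -/

/-- A non-negative function has a minimum where it vanishes; its derivative there is zero, by
default also where it fails to be differentiable. Integrals over `Ω` against this gradient are
therefore integrals over the whole space. -/
theorem IsMesh.gradient_hatN_eq_zero (hK : IsMesh K Ω) (hΩ : IsLipschitzDomain Ω) {y x : Pt d}
    (hy : y ∈ K.vertices ∩ Ω) (hx : x ∉ Ω) : gradient (hatN K Ω y) x = 0 := by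
  have : IsLocalMin (hatN K Ω y) x := by
    refine Eventually.of_forall fun z => ?_
    rw [hatN, hK.hat_eq_zero_of_notMem hΩ hy hx, zero_div]
    exact hatN_nonneg y z
  rw [gradient, this.fderiv_eq_zero, map_zero]

/-- Integration by parts for affine vector fields. -/
theorem IsMesh.integral_inner_gradient_hatN (hK : IsMesh K Ω) (hΩ : IsLipschitzDomain Ω)
    {y : Pt d} (hy : y ∈ K.vertices ∩ Ω) (p : Pt d) (H : Pt d →L[ℝ] Pt d) :
    ∫ x in Ω, inner ℝ (p + H x) (gradient (hatN K Ω y) x) =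
      -∑ j, H (EuclideanSpace.single j 1) j := by
  have := hΩ.isFiniteMeasure
  obtain ⟨L, hL⟩ := hK.exists_lipschitzWith_hat hΩ hy
  have hLN : LipschitzWith (‖(∫ z in Ω, |hat K y z|)⁻¹‖₊ * L) (hatN K Ω y) := by
    rw [hatN_eq_smul]
    exact (lipschitzWith_smul _).comp hL
  have hsupp : HasCompactSupport (hatN K Ω y) := by
    refine HasCompactSupport.intro (K := closure Ω) hΩ.isBounded.isCompact_closure fun x hx => ?_
    rw [hatN, hat_of_notMem_space (hK.space_eq ▸ hx), zero_div]
  set φ := hatN K Ω y with hφ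
  have hφ1 := hK.integral_hatN hΩ hy
  have hdiff : ∀ᵐ x ∂(volume : Measure (Pt d)), DifferentiableAt ℝ φ x := hLN.ae_differentiableAt
  have hgrad : ∀ x (j : Fin d), gradient φ x j = fderiv ℝ φ x (EuclideanSpace.single j 1) := by
    intro x j
    rw [gradient, ← InnerProductSpace.toDual_symm_apply, real_inner_comm,
      EuclideanSpace.inner_single_left]
    simp
  have hcoord : ∀ j : Fin d, ∫ x in Ω, (p + H x) j * gradient φ x j =
      -H (EuclideanSpace.single j 1) j := by
    intro j
    let G : Pt d → ℝ := fun x => (p + H x) j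
    let m : Pt d →L[ℝ] ℝ := (EuclideanSpace.proj j : Pt d →L[ℝ] ℝ).comp H
    have hG : ∀ x, HasFDerivAt G m x := fun x => by
      have := (m.hasFDerivAt (x := x)).const_add (p j)
      exact this
    have hGL : LipschitzWith ‖m‖₊ G := by
      refine LipschitzWith.of_dist_le_mul fun x z => ?_
      have e : G x - G z = m (x - z) := by
        simp only [G, m, map_sub]
        simp
      rw [Real.dist_eq, e, dist_eq_norm]
      exact m.le_opNorm _
    -- Both functions are Lipschitz and one has compact support, so there is no boundary term. The
    -- derivative of the affine factor is constant and the normalised hat function has integral one.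
    have key := hGL.integral_lineDeriv_mul_eq (μ := volume) hLN hsupp (EuclideanSpace.single j 1)
    have e1 : ∀ x, lineDeriv ℝ G x (EuclideanSpace.single j 1) = H (EuclideanSpace.single j 1) j := by
      intro x
      rw [(hG x).differentiableAt.lineDeriv_eq_fderiv, (hG x).fderiv]
      rfl
    simp_rw [e1] at key
    rw [integral_const_mul, ← setIntegral_eq_integral_of_forall_compl_eq_zero (s := Ω)
      (f := hatN K Ω y) (fun x hx => by rw [hatN, hK.hat_eq_zero_of_notMem hΩ hy hx, zero_div]),
      hφ1, mul_one] at key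
    rw [key, setIntegral_eq_integral_of_forall_compl_eq_zero, ← integral_neg]
    · refine integral_congr_ae ?_
      filter_upwards [hdiff] with x hx
      rw [lineDeriv_neg, hx.lineDeriv_eq_fderiv, hgrad]
      simp only [G]
      ring
    · intro x hx
      rw [hφ, hK.gradient_hatN_eq_zero hΩ hy hx]
      simp
  have hint : ∀ j ∈ Finset.univ, Integrable (fun x => (p + H x) j * gradient φ x j)
      (volume.restrict Ω) := by
    intro j _
    have hg : MemLp (fun x => gradient φ x j) ∞ (volume.restrict Ω) := by
      have := (EuclideanSpace.proj j : Pt d →L[ℝ] ℝ).comp_memLp'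
        (hK.memLp_gradient hΩ.isOpen.measurableSet (hatN_mem_P1Space (Ω := Ω) hK y))
      exact this
    have hc : Continuous fun x => (p + H x) j := by fun_prop
    obtain ⟨C, hC⟩ := (hΩ.isBounded.isCompact_closure).exists_bound_of_continuousOn hc.continuousOn
    have hb : MemLp (fun x => (p + H x) j) ∞ (volume.restrict Ω) := by
      refine memLp_top_of_bound hc.aestronglyMeasurable C ?_
      filter_upwards [ae_restrict_mem hΩ.isOpen.measurableSet] with x hx
      exact hC x (subset_closure hx)
    exact (hg.mul' hb : MemLp _ ∞ _).integrable le_top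
  rw [← Finset.sum_neg_distrib, ← Finset.sum_congr rfl fun j _ => hcoord j,
    ← integral_finsetSum _ hint]
  refine integral_congr_ae (Eventually.of_forall fun x => ?_)
  simp only [PiLp.inner_apply]
  refine Finset.sum_congr rfl fun j _ => ?_
  simp [mul_comm]

/-! ### The discrete operators -/

theorem IsMesh.memLp_drift (hK : IsMesh K Ω) (hΩ : MeasurableSet Ω) {b : Pt d → Pt d}
    {c : Pt d → ℝ} (hb : MemLp b ∞ (volume.restrict Ω)) (hc : MemLp c ∞ (volume.restrict Ω))
    {w : Pt d → ℝ} (hw : w ∈ P1Space K) :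
    MemLp (fun x => -(inner ℝ (b x) (gradient w x)) + c x * w x) ∞ (volume.restrict Ω) :=
  (memLp_top_inner hb (hK.memLp_gradient hΩ hw)).neg.add ((hK.memLp hΩ hw).mul' hc)

theorem IsMesh.integrable_mul_hatN (hK : IsMesh K Ω) (hΩ : IsLipschitzDomain Ω) {u : Pt d → ℝ}
    (hu : MemLp u ∞ (volume.restrict Ω)) (y : Pt d) :
    Integrable (fun x => u x * hatN K Ω y x) (volume.restrict Ω) := by
  have := hΩ.isFiniteMeasure
  exact (((hK.memLp hΩ.isOpen.measurableSet (hatN_mem_P1Space hK y)).mul' hu :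
    MemLp _ ∞ _)).integrable le_top

theorem IsMesh.integrable_inner_gradient (hK : IsMesh K Ω) (hΩ : IsLipschitzDomain Ω)
    {w : Pt d → ℝ} (hw : w ∈ P1Space K) (y : Pt d) :
    Integrable (fun x => inner ℝ (gradient w x) (gradient (hatN K Ω y) x))
      (volume.restrict Ω) := by
  have := hΩ.isFiniteMeasure
  exact (memLp_top_inner (hK.memLp_gradient hΩ.isOpen.measurableSet hw)
    (hK.memLp_gradient hΩ.isOpen.measurableSet (hatN_mem_P1Space hK y))).integrable le_top

theorem gradient_add_apply {u w : Pt d → ℝ} {x : Pt d} (hu : DifferentiableAt ℝ u x)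
    (hw : DifferentiableAt ℝ w x) : gradient (u + w) x = gradient u x + gradient w x := by
  rw [gradient, fderiv_add hu hw, map_add]
  rfl

theorem gradient_smul_apply {w : Pt d → ℝ} {x : Pt d} (hw : DifferentiableAt ℝ w x) (r : ℝ) :
    gradient (r • w) x = r • gradient w x := by
  rw [gradient, fderiv_const_smul hw, map_smul]
  rfl

/-- The discrete operator at the node `y`, as a linear functional of piecewise affine functions. -/
def discreteLin (hK : IsMesh K Ω) (hΩ : IsLipschitzDomain Ω) (a : Pt d → ℝ) {b : Pt d → Pt d}
    {c : Pt d → ℝ} (hb : MemLp b ∞ (volume.restrict Ω)) (hc : MemLp c ∞ (volume.restrict Ω))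
    (y : Pt d) : P1Space K →ₗ[ℝ] ℝ where
  toFun w := discreteOp K Ω a b c w y
  map_add' u w := by
    have hm := hΩ.isOpen.measurableSet
    have hg : ∀ᵐ x ∂volume.restrict Ω, gradient ((u + w : P1Space K) : Pt d → ℝ) x =
        gradient (u : Pt d → ℝ) x + gradient (w : Pt d → ℝ) x := by
      filter_upwards [hK.ae_differentiableAt hm u.2, hK.ae_differentiableAt hm w.2] with x h1 h2
      exact gradient_add_apply h1 h2
    have e1 : ∫ x in Ω, inner ℝ (gradient ((u + w : P1Space K) : Pt d → ℝ) x)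
        (gradient (hatN K Ω y) x) =
        (∫ x in Ω, inner ℝ (gradient (u : Pt d → ℝ) x) (gradient (hatN K Ω y) x)) +
        ∫ x in Ω, inner ℝ (gradient (w : Pt d → ℝ) x) (gradient (hatN K Ω y) x) := by
      rw [← integral_add (hK.integrable_inner_gradient hΩ u.2 y)
        (hK.integrable_inner_gradient hΩ w.2 y)]
      refine integral_congr_ae ?_
      filter_upwards [hg] with x hx
      rw [hx, inner_add_left]
    have e2 : ∫ x in Ω, (-(inner ℝ (b x) (gradient ((u + w : P1Space K) : Pt d → ℝ) x)) +
          c x * ((u + w : P1Space K) : Pt d → ℝ) x) * hatN K Ω y x =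
        (∫ x in Ω, (-(inner ℝ (b x) (gradient (u : Pt d → ℝ) x)) + c x * (u : Pt d → ℝ) x) *
          hatN K Ω y x) +
        ∫ x in Ω, (-(inner ℝ (b x) (gradient (w : Pt d → ℝ) x)) + c x * (w : Pt d → ℝ) x) *
          hatN K Ω y x := by
      rw [← integral_add (hK.integrable_mul_hatN hΩ (hK.memLp_drift hm hb hc u.2) y)
        (hK.integrable_mul_hatN hΩ (hK.memLp_drift hm hb hc w.2) y)]
      refine integral_congr_ae ?_
      filter_upwards [hg] with x hx
      rw [hx, inner_add_right, Submodule.coe_add, Pi.add_apply]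
      ring
    simp only [discreteOp]
    rw [e1, e2]
    ring
  map_smul' r w := by
    have hm := hΩ.isOpen.measurableSet
    have hg : ∀ᵐ x ∂volume.restrict Ω, gradient ((r • w : P1Space K) : Pt d → ℝ) x =
        r • gradient (w : Pt d → ℝ) x := by
      filter_upwards [hK.ae_differentiableAt hm w.2] with x h1
      exact gradient_smul_apply h1 r
    have e1 : ∫ x in Ω, inner ℝ (gradient ((r • w : P1Space K) : Pt d → ℝ) x)
        (gradient (hatN K Ω y) x) =
        r * ∫ x in Ω, inner ℝ (gradient (w : Pt d → ℝ) x) (gradient (hatN K Ω y) x) := by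
      rw [← integral_const_mul]
      refine integral_congr_ae ?_
      filter_upwards [hg] with x hx
      rw [hx, inner_smul_left]
      rfl
    have e2 : ∫ x in Ω, (-(inner ℝ (b x) (gradient ((r • w : P1Space K) : Pt d → ℝ) x)) +
          c x * ((r • w : P1Space K) : Pt d → ℝ) x) * hatN K Ω y x =
        r * ∫ x in Ω, (-(inner ℝ (b x) (gradient (w : Pt d → ℝ) x)) + c x * (w : Pt d → ℝ) x) *
          hatN K Ω y x := by
      rw [← integral_const_mul]
      refine integral_congr_ae ?_
      filter_upwards [hg] with x hx
      rw [hx, inner_smul_right, Submodule.coe_smul, Pi.smul_apply, smul_eq_mul]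
      ring
    simp only [discreteOp, RingHom.id_apply, smul_eq_mul]
    rw [e1, e2]
    ring

theorem gradient_eq_zero_of_eqOn {w : Pt d → ℝ} {t : Finset (Pt d)} {r : ℝ}
    (h : EqOn w (fun _ => r) (convexHull ℝ (t : Set (Pt d)))) {x : Pt d}
    (hx : x ∈ interior (convexHull ℝ (t : Set (Pt d)))) : gradient w x = 0 :=
  ((hasGradientAt_const x r).congr_of_eventuallyEq
    (Filter.eventuallyEq_of_mem (mem_interior_iff_mem_nhds.1 hx) h)).gradient

/-- Only the zeroth order term sees constants. By linearity this determines the effect of shifting a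
test function or a barrier by a constant. -/
theorem discreteOp_constP1 (hK : IsMesh K Ω) (hΩ : IsLipschitzDomain Ω) (a : Pt d → ℝ)
    (b : Pt d → Pt d) (c : Pt d → ℝ) (r : ℝ) (y : Pt d) :
    discreteOp K Ω a b c (constP1 K r) y = r * ∫ x in Ω, c x * hatN K Ω y x := by
  have hg : ∀ x ∈ Ω, gradient (constP1 K r : Pt d → ℝ) x = 0 := fun x hx =>
    ((hasGradientAt_const x r).congr_of_eventuallyEq (Filter.eventuallyEq_of_mem
      (hΩ.isOpen.mem_nhds hx) fun z hz => hK.constP1_apply r (subset_closure hz))).gradient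
  have e1 : ∫ x in Ω, inner ℝ (gradient (constP1 K r : Pt d → ℝ) x)
      (gradient (hatN K Ω y) x) = 0 := by
    rw [setIntegral_congr_fun hΩ.isOpen.measurableSet (g := fun _ => (0 : ℝ)) fun x hx => by
      simp only [hg x hx, inner_zero_left]]
    simp
  rw [discreteOp, e1, ← integral_const_mul, mul_zero, zero_add]
  refine setIntegral_congr_fun hΩ.isOpen.measurableSet fun x hx => ?_
  simp only [hg x hx, inner_zero_right, hK.constP1_apply r (subset_closure hx)]
  ring

/-- The discrete operators are local. -/
theorem discreteOp_hat_eq_zero (hK : IsMesh K Ω) (hΩ : IsLipschitzDomain Ω) (a : Pt d → ℝ)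
    (b : Pt d → Pt d) (c : Pt d → ℝ) {y z : Pt d} (h : meshSize K < dist z y) :
    discreteOp K Ω a b c (hat K z) y = 0 := by
  -- The nodes are further apart than any element is wide, so each element misses one of them, and
  -- the corresponding function vanishes identically on that element.
  have key : ∀ᵐ x ∂volume.restrict Ω, (gradient (hat K z) x = 0 ∧ hat K z x = 0) ∨
      (gradient (hatN K Ω y) x = 0 ∧ hatN K Ω y x = 0) := by
    filter_upwards [hK.ae_mem_interior hΩ.isOpen.measurableSet] with x hx
    obtain ⟨t, ht, hc, hxt⟩ := hx
    have hzero : ∀ q ∉ t, EqOn (hat K q) (fun _ => 0) (convexHull ℝ (t : Set (Pt d))) := by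
      intro q hq x' hx'
      rw [hat_eq_elementHat ht hc hx', elementHat_of_notMem ht hc hq]
      rfl
    by_cases hz : z ∈ t
    · right
      have hy : y ∉ t := fun hy => h.not_ge
        (hK.dist_le_meshSize ht (subset_convexHull ℝ _ hz) (subset_convexHull ℝ _ hy))
      have : EqOn (hatN K Ω y) (fun _ => 0) (convexHull ℝ (t : Set (Pt d))) := fun x' hx' => by
        rw [hatN, hzero y hy hx', zero_div]
      exact ⟨gradient_eq_zero_of_eqOn this hxt, this (interior_subset hxt)⟩
    · left
      exact ⟨gradient_eq_zero_of_eqOn (hzero z hz) hxt, hzero z hz (interior_subset hxt)⟩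
  have e1 : ∫ x in Ω, inner ℝ (gradient (hat K z) x) (gradient (hatN K Ω y) x) = 0 := by
    refine integral_eq_zero_of_ae ?_
    filter_upwards [key] with x hx
    rcases hx with hx | hx <;> simp [hx.1]
  have e2 : ∫ x in Ω, (-(inner ℝ (b x) (gradient (hat K z) x)) + c x * hat K z x) *
      hatN K Ω y x = 0 := by
    refine integral_eq_zero_of_ae ?_
    filter_upwards [key] with x hx
    rcases hx with hx | hx <;> simp [hx.1, hx.2]
  rw [discreteOp, e1, e2, mul_zero, add_zero]

/-- The action of the discrete operators on the nodal basis. -/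
theorem discreteOp_eq_sum (hK : IsMesh K Ω) (hΩ : IsLipschitzDomain Ω) (a : Pt d → ℝ)
    {b : Pt d → Pt d} {c : Pt d → ℝ} (hb : MemLp b ∞ (volume.restrict Ω))
    (hc : MemLp c ∞ (volume.restrict Ω)) {w : Pt d → ℝ} (hw : w ∈ P1Space K) (y : Pt d) :
    discreteOp K Ω a b c w y =
      ∑ z ∈ hK.finite_vertices.toFinset, w z * discreteOp K Ω a b c (hat K z) y := by
  let W : P1Space K := ⟨w, hw⟩
  have hW : W = ∑ z ∈ hK.finite_vertices.toFinset,
      w z • (⟨hat K z, hat_mem_P1Space hK z⟩ : P1Space K) := by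
    apply Subtype.ext
    rw [Submodule.coe_sum]
    exact hK.eq_sum_hat hw
  have h := congrArg (discreteLin hK hΩ a hb hc y) hW
  rw [map_sum] at h
  simp_rw [map_smul, smul_eq_mul] at h
  exact h

theorem discreteOp_sub (hK : IsMesh K Ω) (hΩ : IsLipschitzDomain Ω) (a : Pt d → ℝ)
    {b : Pt d → Pt d} {c : Pt d → ℝ} (hb : MemLp b ∞ (volume.restrict Ω))
    (hc : MemLp c ∞ (volume.restrict Ω)) (u w : P1Space K) (y : Pt d) :
    discreteOp K Ω a b c ((u - w : P1Space K) : Pt d → ℝ) y =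
      discreteOp K Ω a b c u y - discreteOp K Ω a b c w y :=
  map_sub (discreteLin hK hΩ a hb hc y) u w

theorem discreteOp_add (hK : IsMesh K Ω) (hΩ : IsLipschitzDomain Ω) (a : Pt d → ℝ)
    {b : Pt d → Pt d} {c : Pt d → ℝ} (hb : MemLp b ∞ (volume.restrict Ω))
    (hc : MemLp c ∞ (volume.restrict Ω)) (u w : P1Space K) (y : Pt d) :
    discreteOp K Ω a b c ((u + w : P1Space K) : Pt d → ℝ) y =
      discreteOp K Ω a b c u y + discreteOp K Ω a b c w y :=
  map_add (discreteLin hK hΩ a hb hc y) u w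

theorem discreteOp_neg (hK : IsMesh K Ω) (hΩ : IsLipschitzDomain Ω) (a : Pt d → ℝ)
    {b : Pt d → Pt d} {c : Pt d → ℝ} (hb : MemLp b ∞ (volume.restrict Ω))
    (hc : MemLp c ∞ (volume.restrict Ω)) (w : P1Space K) (y : Pt d) :
    discreteOp K Ω a b c ((-w : P1Space K) : Pt d → ℝ) y = -discreteOp K Ω a b c w y :=
  map_neg (discreteLin hK hΩ a hb hc y) w

/-- The sum of two discrete operators, in terms of the sums of the coefficients. -/
theorem discreteOp_add_discreteOp (hK : IsMesh K Ω) (hΩ : IsLipschitzDomain Ω) (a a' : Pt d → ℝ)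
    {b b' : Pt d → Pt d} {c c' : Pt d → ℝ} (hb : MemLp b ∞ (volume.restrict Ω))
    (hb' : MemLp b' ∞ (volume.restrict Ω)) (hc : MemLp c ∞ (volume.restrict Ω))
    (hc' : MemLp c' ∞ (volume.restrict Ω)) {w : Pt d → ℝ} (hw : w ∈ P1Space K) (y : Pt d) :
    discreteOp K Ω a b c w y + discreteOp K Ω a' b' c' w y =
      discreteOp K Ω (a + a') (b + b') (c + c') w y := by
  have hm := hΩ.isOpen.measurableSet
  have e : (∫ x in Ω, (-(inner ℝ (b x) (gradient w x)) + c x * w x) * hatN K Ω y x) +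
      ∫ x in Ω, (-(inner ℝ (b' x) (gradient w x)) + c' x * w x) * hatN K Ω y x =
      ∫ x in Ω, (-(inner ℝ ((b + b') x) (gradient w x)) + (c + c') x * w x) * hatN K Ω y x := by
    rw [← integral_add (hK.integrable_mul_hatN hΩ (hK.memLp_drift hm hb hc hw) y)
        (hK.integrable_mul_hatN hΩ (hK.memLp_drift hm hb' hc' hw) y)]
    refine integral_congr_ae (Eventually.of_forall fun x => ?_)
    simp only [Pi.add_apply, inner_add_left]
    ring
  simp only [discreteOp]
  rw [← e, Pi.add_apply]
  ring

/-! ### Essential bounds -/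

theorem ae_norm_le_of_normLinf_le {F : Type*} [NormedAddCommGroup F] {u : Pt d → F} {ε : ℝ}
    (hε : 0 ≤ ε) (h : normLinf Ω u ≤ ENNReal.ofReal ε) : ∀ᵐ x ∂volume.restrict Ω, ‖u x‖ ≤ ε := by
  rw [normLinf, eLpNorm_exponent_top] at h
  filter_upwards [ae_le_eLpNormEssSup (f := u) (μ := volume.restrict Ω)] with x hx
  have := hx.trans h
  rwa [← ofReal_norm, ENNReal.ofReal_le_ofReal_iff hε] at this

/-- An essential bound of a continuous function holds everywhere. -/
theorem abs_le_of_ae_abs_le (hΩ : IsOpen Ω) {u : Pt d → ℝ} (hu : ContinuousOn u (closure Ω)) {ε : ℝ}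
    (h : ∀ᵐ x ∂volume.restrict Ω, |u x| ≤ ε) {x : Pt d} (hx : x ∈ closure Ω) : |u x| ≤ ε := by
  by_contra! hlt
  have h1 : ∀ᶠ z in 𝓝[closure Ω] x, ε < |u z| := (hu x hx).abs.eventually (lt_mem_nhds hlt)
  obtain ⟨U, hU, hxU, hsub⟩ := mem_nhdsWithin.1 h1
  have hne : (U ∩ Ω).Nonempty := mem_closure_iff.1 hx U hU hxU
  have hpos : 0 < volume (U ∩ Ω) := (hU.inter hΩ).measure_pos volume hne
  have h2 := (ae_restrict_iff' hΩ.measurableSet).1 h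
  have h3 : volume (U ∩ Ω) = 0 := by
    refine measure_mono_null (fun z hz => ?_) (ae_iff.1 h2)
    intro hcon
    have h4 : ε < |u z| := hsub ⟨hz.1, subset_closure hz.2⟩
    exact absurd (hcon hz.2) (not_le.2 h4)
  exact hpos.ne' h3

/-! ### Uniform continuity of the coefficients -/

/-- Compactness of `A × B × S` makes the bound and the modulus of continuity in space independent of
the controls. Functions without controls are covered by taking one-point control sets. -/
theorem exists_uniform_modulus {A B F : Type*} [MetricSpace A] [CompactSpace A] [MetricSpace B]
    [CompactSpace B] [NormedAddCommGroup F] {S : Set (Pt d)} (hS : IsCompact S)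
    {u : A → B → Pt d → F}
    (hu : ContinuousOn (fun z : A × B × Pt d => u z.1 z.2.1 z.2.2) {z | z.2.2 ∈ S}) :
    (∃ C, ∀ α β, ∀ x ∈ S, ‖u α β x‖ ≤ C) ∧
      ∀ ε > 0, ∃ η > 0, ∀ x ∈ S, ∀ y ∈ S, dist x y < η → ∀ α β, ‖u α β x - u α β y‖ ≤ ε := by
  have hc : IsCompact {z : A × B × Pt d | z.2.2 ∈ S} := by
    have : {z : A × B × Pt d | z.2.2 ∈ S} = univ ×ˢ (univ ×ˢ S) := by
      ext z
      simp
    rw [this]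
    exact isCompact_univ.prod (isCompact_univ.prod hS)
  constructor
  · obtain ⟨C, hC⟩ := hc.exists_bound_of_continuousOn hu
    exact ⟨C, fun α β x hx => hC (α, β, x) hx⟩
  · intro ε hε
    obtain ⟨η, hη, h⟩ := Metric.uniformContinuousOn_iff.1
      (hc.uniformContinuousOn_of_continuous hu) ε hε
    refine ⟨η, hη, fun x hx y hy hxy α β => ?_⟩
    have := h (α, β, x) hx (α, β, y) hy (by simpa [Prod.dist_eq] using hxy)
    rw [dist_eq_norm] at this
    exact this.le

/-! ### The consistency error at a node -/

/-- The diffusion term is exact up to the error of its coefficient, because the gradient pairing is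
prescribed; this costs `M * δ`. The other terms are averages over the hat function of integrands
within `(4 * M + 1) * δ` of their frozen values: `(2 * M + 1) * δ` from the drift and `2 * M * δ`
from the zeroth order term. The summand with `s - w y` is the effect of shifting `w` to the value
`s` at the node. -/
theorem abs_discreteOp_sub_le (hK : IsMesh K Ω) (hΩ : IsLipschitzDomain Ω) {y : Pt d}
    (hy : y ∈ K.vertices ∩ Ω) {ā : Pt d → ℝ} {b : Pt d → Pt d} {c : Pt d → ℝ}
    (hb : MemLp b ∞ (volume.restrict Ω)) (hc : MemLp c ∞ (volume.restrict Ω))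
    {w : Pt d → ℝ} (hw : w ∈ P1Space K) {a₀ c₀ L s M δ : ℝ} {b₀ g₀ : Pt d}
    (hδ0 : 0 ≤ δ) (hδ : δ ≤ 1) (hL : |L| ≤ M) (hb₀ : ‖b₀‖ ≤ M) (hg₀ : ‖g₀‖ ≤ M) (hs : |s| ≤ M)
    (hgal : ∫ x in Ω, inner ℝ (gradient w x) (gradient (hatN K Ω y) x) = -L)
    (ha : |ā y - a₀| ≤ δ)
    (hloc : ∀ᵐ x ∂volume.restrict Ω, hat K y x ≠ 0 →
      ‖b x - b₀‖ ≤ δ ∧ ‖gradient w x - g₀‖ ≤ δ ∧ |c x - c₀| ≤ δ ∧ |c x| ≤ M ∧ |w x - w y| ≤ δ) :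
    |discreteOp K Ω ā b c w y + (s - w y) * (∫ x in Ω, c x * hatN K Ω y x) -
      (-a₀ * L - inner ℝ b₀ g₀ + c₀ * s)| ≤ (5 * M + 1) * δ := by
  have hM : 0 ≤ M := (abs_nonneg _).trans hL
  have hm := hΩ.isOpen.measurableSet
  have hu : MemLp (fun x => -(inner ℝ (b x) (gradient w x)) + c x * w x + (s - w y) * c x) ∞
      (volume.restrict Ω) := (hK.memLp_drift hm hb hc hw).add (hc.const_mul _)
  have e : discreteOp K Ω ā b c w y + (s - w y) * (∫ x in Ω, c x * hatN K Ω y x) =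
      -(ā y * L) + ∫ x in Ω, (-(inner ℝ (b x) (gradient w x)) + c x * w x + (s - w y) * c x) *
        hatN K Ω y x := by
    rw [discreteOp, hgal, ← integral_const_mul, add_assoc,
      ← integral_add (hK.integrable_mul_hatN hΩ (hK.memLp_drift hm hb hc hw) y)
        ((hK.integrable_mul_hatN hΩ hc y).const_mul _)]
    congr 1
    · ring
    · refine integral_congr_ae (Eventually.of_forall fun x => ?_)
      ring
  have hav := hK.abs_average_sub_le hΩ hy hu (m := -(inner ℝ b₀ g₀) + c₀ * s)
    (δ := (4 * M + 1) * δ) (by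
      filter_upwards [hloc] with x hx h0
      obtain ⟨h1, h2, h3, h4, h5⟩ := hx h0
      have hgw : ‖gradient w x‖ ≤ M + 1 := by
        have := norm_le_norm_add_norm_sub' (gradient w x) g₀
        linarith
      have i1 : |inner ℝ (b x) (gradient w x) - inner ℝ b₀ g₀| ≤ δ * (M + 1) + M * δ := by
        have : inner ℝ (b x) (gradient w x) - inner ℝ b₀ g₀ =
            inner ℝ (b x - b₀) (gradient w x) + inner ℝ b₀ (gradient w x - g₀) := by
          rw [inner_sub_left, inner_sub_right]
          ring
        rw [this]
        refine (abs_add_le _ _).trans (add_le_add ?_ ?_)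
        · exact (abs_real_inner_le_norm _ _).trans
            (mul_le_mul h1 hgw (norm_nonneg _) hδ0)
        · exact (abs_real_inner_le_norm _ _).trans (mul_le_mul hb₀ h2 (norm_nonneg _) hM)
      have i2 : |c x * (w x - w y)| ≤ M * δ := by
        rw [abs_mul]
        exact mul_le_mul h4 h5 (abs_nonneg _) hM
      have i3 : |(c x - c₀) * s| ≤ δ * M := by
        rw [abs_mul]
        exact mul_le_mul h3 hs (abs_nonneg _) hδ0
      have : -(inner ℝ (b x) (gradient w x)) + c x * w x + (s - w y) * c x -
          (-(inner ℝ b₀ g₀) + c₀ * s) = -(inner ℝ (b x) (gradient w x) - inner ℝ b₀ g₀) +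
          c x * (w x - w y) + (c x - c₀) * s := by ring
      rw [this]
      rw [abs_le] at i1 i2 i3 ⊢
      constructor <;> linarith [i1.1, i1.2, i2.1, i2.2, i3.1, i3.2])
  have i4 : |(ā y - a₀) * L| ≤ δ * M := by
    rw [abs_mul]
    exact mul_le_mul ha hL (abs_nonneg _) hδ0
  rw [e]
  rw [abs_le] at hav i4 ⊢
  constructor <;> linarith [hav.1, hav.2, i4.1, i4.2]

/-! ### Elliptic projections of quadratic functions -/

/-- The classical gradient of a smooth function is its weak gradient. -/
theorem isWeakGradient_of_hasGradientAt {w : Pt d → ℝ} {G : Pt d → Pt d}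
    (hG : ∀ x, HasGradientAt w (G x) x) (hGc : Continuous G) : IsWeakGradient Ω w G := by
  intro θ hθ hθc hθΩ
  have hw : Continuous w := continuous_iff_continuousAt.2 fun x => (hG x).continuousAt
  have hgθ : Continuous (gradient θ) :=
    (InnerProductSpace.toDual ℝ (Pt d)).symm.continuous.comp (hθ.continuous_fderiv (by simp))
  have hθg0 : ∀ x ∉ tsupport θ, gradient θ x = 0 := fun x hx => by
    rw [gradient, (notMem_tsupport_iff_eventuallyEq.1 hx).fderiv_eq]
    simp
  have hθ0 : ∀ x ∉ tsupport θ, θ x = 0 := fun x hx => image_eq_zero_of_notMem_tsupport hx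
  have s1 : HasCompactSupport fun x => w x • gradient θ x :=
    HasCompactSupport.intro hθc fun x hx => by simp [hθg0 x hx]
  have s2 : HasCompactSupport fun x => θ x • G x :=
    HasCompactSupport.intro hθc fun x hx => by simp [hθ0 x hx]
  rw [setIntegral_eq_integral_of_forall_compl_eq_zero fun x hx => by
      rw [hθg0 x fun h => hx (hθΩ h), smul_zero],
    setIntegral_eq_integral_of_forall_compl_eq_zero fun x hx => by
      rw [hθ0 x fun h => hx (hθΩ h), zero_smul]]
  have c1 : Integrable fun x => w x • gradient θ x :=
    (hw.smul hgθ).integrable_of_hasCompactSupport s1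
  have c2 : Integrable fun x => θ x • G x :=
    (hθ.continuous.smul hGc).integrable_of_hasCompactSupport s2
  have hgj : ∀ (u : Pt d → ℝ) x (j : Fin d),
      gradient u x j = fderiv ℝ u x (EuclideanSpace.single j 1) := by
    intro u x j
    rw [gradient, ← InnerProductSpace.toDual_symm_apply, real_inner_comm,
      EuclideanSpace.inner_single_left]
    simp
  ext j
  have l1 := (EuclideanSpace.proj j : Pt d →L[ℝ] ℝ).integral_comp_comm c1
  have l2 := (EuclideanSpace.proj j : Pt d →L[ℝ] ℝ).integral_comp_comm c2
  change ∫ x, (w x • gradient θ x) j = (∫ x, w x • gradient θ x) j at l1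
  change ∫ x, (θ x • G x) j = (∫ x, θ x • G x) j at l2
  simp only [PiLp.smul_apply, smul_eq_mul, hgj] at l1 l2
  rw [PiLp.neg_apply, ← l1, ← l2]
  have hGj : ∀ x, G x j = fderiv ℝ w x (EuclideanSpace.single j 1) := fun x => by
    rw [← hgj, (hG x).gradient]
  have hjc : Continuous fun x => fderiv ℝ w x (EuclideanSpace.single j 1) := by
    simp_rw [← hGj]
    exact (EuclideanSpace.proj j : Pt d →L[ℝ] ℝ).continuous.comp hGc
  simp_rw [hGj]
  have hθd : Differentiable ℝ θ := hθ.differentiable (by simp)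
  rw [integral_mul_fderiv_eq_neg_fderiv_mul_of_integrable (f := w) (g := θ)]
  · simp_rw [mul_comm]
  · exact (hjc.mul hθ.continuous).integrable_of_hasCompactSupport
      (HasCompactSupport.intro hθc fun x hx => by simp [hθ0 x hx])
  · refine (hw.mul ((hθ.continuous_fderiv (by simp)).clm_apply continuous_const)
      ).integrable_of_hasCompactSupport (HasCompactSupport.intro hθc fun x hx => ?_)
    rw [Pi.mul_apply, ← hgj, hθg0 x hx]
    simp
  · exact (hw.mul hθ.continuous).integrable_of_hasCompactSupport
      (HasCompactSupport.intro hθc fun x hx => by simp [hθ0 x hx])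
  · exact fun x _ => (hG x).differentiableAt
  · exact fun x _ => hθd x

theorem memLp_of_continuous {F : Type*} [NormedAddCommGroup F] (hΩ : IsLipschitzDomain Ω)
    {u : Pt d → F} (hu : Continuous u) [SecondCountableTopology F] (q : ℝ≥0∞) :
    MemLp u q (volume.restrict Ω) := by
  have := hΩ.isFiniteMeasure
  obtain ⟨C, hC⟩ := (hΩ.isBounded.isCompact_closure).exists_bound_of_continuousOn hu.continuousOn
  refine MemLp.of_bound hu.aestronglyMeasurable C ?_
  filter_upwards [ae_restrict_mem hΩ.isOpen.measurableSet] with x hx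
  exact hC x (subset_closure hx)

section Consistency

variable {A B : Type*} [MetricSpace A] [MetricSpace B] {pb : Problem d A B} {me : Method d A B}

/-- The Galerkin identity replaces the projection by `w`, and integration by parts evaluates the
result. No approximation of second derivatives by piecewise affine functions is involved, and the
identity is exact on every mesh. -/
theorem Method.IsEllipticProjection.integral_inner (h_proj : me.IsEllipticProjection pb)
    (h_adm : me.IsAdmissible pb) {w : Pt d → ℝ} {p : Pt d} {H : Pt d →L[ℝ] Pt d}
    (hG : ∀ x, HasGradientAt w (p + H x) x) {i : ℕ} {y : Pt d}
    (hy : y ∈ (me.mesh i).vertices ∩ pb.Ω) :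
    ∫ x in pb.Ω, inner ℝ (gradient (me.P i w : Pt d → ℝ) x)
      (gradient (hatN (me.mesh i) pb.Ω y) x) = -∑ j, H (EuclideanSpace.single j 1) j := by
  have hGc : Continuous fun x => p + H x := by fun_prop
  have hw : Continuous w := continuous_iff_continuousAt.2 fun x => (hG x).continuousAt
  rw [h_proj.galerkin i w (fun x => p + H x) (memLp_of_continuous pb.domain hw 2)
    (memLp_of_continuous pb.domain hGc 2) (isWeakGradient_of_hasGradientAt hG hGc) y hy]
  exact (h_adm.mesh i).integral_inner_gradient_hatN pb.domain hy p H

/-- The `L^∞` bound on the values holds at every point by continuity, so it may be used at nodes;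
the bound on the gradients remains an almost everywhere statement. -/
theorem Method.IsEllipticProjection.eventually_close (h_proj : me.IsEllipticProjection pb)
    (h_adm : me.IsAdmissible pb) {w : Pt d → ℝ} (hw : ContDiff ℝ ∞ w) {ε : ℝ} (hε : 0 < ε) :
    ∀ᶠ i in atTop, (∀ x ∈ closure pb.Ω, |(me.P i w : Pt d → ℝ) x - w x| ≤ ε) ∧
      ∀ᵐ x ∂volume.restrict pb.Ω, ‖gradient (me.P i w : Pt d → ℝ) x - gradient w x‖ ≤ ε := by
  have hpos : 0 < ENNReal.ofReal ε := ENNReal.ofReal_pos.2 hε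
  filter_upwards [ENNReal.tendsto_nhds_zero.1 (h_proj.convergent w hw) _ hpos] with i hi
  have hK := h_adm.mesh i
  have hd : Differentiable ℝ w := hw.differentiable (by simp)
  constructor
  · intro x hx
    refine abs_le_of_ae_abs_le pb.domain.isOpen
      (u := fun x => (me.P i w : Pt d → ℝ) x - w x) ?_ ?_ hx
    · exact (hK.continuousOn (me.P i w).2).sub hw.continuous.continuousOn
    · exact ae_norm_le_of_normLinf_le hε.le (le_trans le_self_add hi)
  · filter_upwards [ae_norm_le_of_normLinf_le hε.le (le_trans le_add_self hi),
      hK.ae_differentiableAt pb.domain.isOpen.measurableSet (me.P i w).2] with x hx hdx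
    have : gradient (fun x => (me.P i w : Pt d → ℝ) x - w x) x =
        gradient (me.P i w : Pt d → ℝ) x - gradient w x := by
      rw [gradient, fderiv_fun_sub hdx (hd x), map_sub]
      rfl
    rwa [this] at hx

theorem Method.IsConsistent.eventually_close (h_cons : me.IsConsistent pb) {ε : ℝ} (hε : 0 < ε) :
    ∀ᶠ i in atTop, ∀ α β,
      (∀ y ∈ (me.mesh i).vertices ∩ pb.Ω, ∀ᵐ x ∂volume.restrict pb.Ω, hat (me.mesh i) y x ≠ 0 →
        |pb.a α β x - (me.aE i α β y + me.aI i α β y)| ≤ ε) ∧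
      (∀ᵐ x ∂volume.restrict pb.Ω, ‖pb.b α β x - (me.bE i α β x + me.bI i α β x)‖ ≤ ε) ∧
      (∀ᵐ x ∂volume.restrict pb.Ω, |pb.c α β x - (me.cE i α β x + me.cI i α β x)| ≤ ε) ∧
      ∀ᵐ x ∂volume.restrict pb.Ω, |pb.f α β x - me.fD i α β x| ≤ ε := by
  have hpos : 0 < ENNReal.ofReal ε := ENNReal.ofReal_pos.2 hε
  filter_upwards [ENNReal.tendsto_nhds_zero.1 h_cons.limit _ hpos] with i hi α β
  have h := (le_iSup₂ (f := fun (α : A) (β : B) =>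
      ((⨆ y ∈ (me.mesh i).vertices ∩ pb.Ω,
          normLinf (tsupport (hat (me.mesh i) y))
            (fun x => pb.a α β x - (me.aE i α β y + me.aI i α β y))) +
        normLinf pb.Ω (fun x => pb.b α β x - (me.bE i α β x + me.bI i α β x)) +
        normLinf pb.Ω (fun x => pb.c α β x - (me.cE i α β x + me.cI i α β x)) +
        normLinf pb.Ω (fun x => pb.f α β x - me.fD i α β x))) α β).trans hi
  refine ⟨fun y hy => ?_, ?_, ?_, ?_⟩
  · have h1 : normLinf (tsupport (hat (me.mesh i) y))
        (fun x => pb.a α β x - (me.aE i α β y + me.aI i α β y)) ≤ ENNReal.ofReal ε :=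
      (le_iSup₂ (f := fun y (_ : y ∈ (me.mesh i).vertices ∩ pb.Ω) =>
        normLinf (tsupport (hat (me.mesh i) y))
          (fun x => pb.a α β x - (me.aE i α β y + me.aI i α β y))) y hy).trans
        ((le_self_add.trans (le_self_add.trans le_self_add)).trans h)
    have h2 := ae_norm_le_of_normLinf_le hε.le h1
    rw [ae_restrict_iff' (isClosed_tsupport _).measurableSet] at h2
    filter_upwards [ae_restrict_of_ae h2] with x hx h0
    exact hx (subset_tsupport _ h0)
  · exact ae_norm_le_of_normLinf_le hε.le ((le_add_self.trans (le_self_add.trans le_self_add)).trans h)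
  · exact ae_norm_le_of_normLinf_le hε.le ((le_add_self.trans le_self_add).trans h)
  · exact ae_norm_le_of_normLinf_le hε.le (le_add_self.trans h)

end Consistency

section Consistency

variable {A B : Type*} [MetricSpace A] [MetricSpace B]
  {pb : Problem d A B} {me : Method d A B}

/-! ### Consistency of the scheme -/

theorem Method.IsConsistent.exists_ae_c_le (h_cons : me.IsConsistent pb) :
    ∃ γ : ℝ, ∀ i α β, ∀ᵐ x ∂volume.restrict pb.Ω, |me.cE i α β x + me.cI i α β x| ≤ γ := by
  obtain ⟨γ, hγ⟩ := h_cons.c_bound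
  refine ⟨γ + γ, fun i α β => ?_⟩
  have h : ENNReal.ofReal (γ : ℝ) = γ := ENNReal.ofReal_coe_nnreal
  filter_upwards [ae_norm_le_of_normLinf_le γ.2 (h ▸ le_self_add.trans (hγ i α β)),
    ae_norm_le_of_normLinf_le γ.2 (h ▸ le_add_self.trans (hγ i α β))] with x h1 h2
  exact (abs_add_le _ _).trans (add_le_add h1 h2)

theorem Method.IsConsistent.sum_eq (h_cons : me.IsConsistent pb) (h_adm : me.IsAdmissible pb)
    (i : ℕ) (α : A) (β : B) (w : P1Space (me.mesh i)) (y : Pt d) :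
    me.opE pb i α β w y + me.opI pb i α β w y =
      discreteOp (me.mesh i) pb.Ω (me.aE i α β + me.aI i α β) (me.bE i α β + me.bI i α β)
        (me.cE i α β + me.cI i α β) w y :=
  discreteOp_add_discreteOp (h_adm.mesh i) pb.domain _ _ ((h_cons.bE_cont i).1 α β)
    ((h_cons.bI_cont i).1 α β) ((h_cons.cE_cont i).1 α β) ((h_cons.cI_cont i).1 α β) w.2 y

theorem Method.IsAdmissible.eventually_dist_lt (h_adm : me.IsAdmissible pb) {η : ℝ} (hη : 0 < η) :
    ∀ᶠ i in atTop, ∀ x y, hat (me.mesh i) y x ≠ 0 → dist x y < η := by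
  filter_upwards [h_adm.meshSize_tendsto.eventually (gt_mem_nhds hη)] with i hi x y h
  exact ((h_adm.mesh i).dist_le_of_hat_ne_zero h).trans_lt hi

variable [CompactSpace A] [CompactSpace B]

/-- The discrete operators, applied to the elliptic projection of a smooth function with an affine
gradient and shifted by a constant such that the value `s` is attained at the node `y`. -/
theorem Method.IsConsistent.eventually_op_close (h_cons : me.IsConsistent pb)
    (h_adm : me.IsAdmissible pb) (h_proj : me.IsEllipticProjection pb) {w : Pt d → ℝ} {p : Pt d}
    {H : Pt d →L[ℝ] Pt d} (hw : ContDiff ℝ ∞ w) (hG : ∀ x, HasGradientAt w (p + H x) x)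
    (S : ℝ) {ε : ℝ} (hε : 0 < ε) :
    ∀ᶠ i in atTop, ∀ α β, ∀ y ∈ (me.mesh i).vertices ∩ pb.Ω, ∀ s : ℝ, |s| ≤ S →
      |me.opE pb i α β (me.P i w) y + me.opI pb i α β (me.P i w) y +
          (s - (me.P i w : Pt d → ℝ) y) *
            (∫ x in pb.Ω, (me.cE i α β x + me.cI i α β x) * hatN (me.mesh i) pb.Ω y x) -
        (-pb.a α β y * (∑ j, H (EuclideanSpace.single j 1) j) - inner ℝ (pb.b α β y) (p + H y) +
          pb.c α β y * s)| ≤ ε := by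
  have hcpt : IsCompact (closure pb.Ω) := pb.domain.isBounded.isCompact_closure
  obtain ⟨γ, hγ⟩ := h_cons.exists_ae_c_le
  obtain ⟨-, hamod⟩ := exists_uniform_modulus hcpt pb.a_cont
  obtain ⟨Cb, hCb⟩ := (exists_uniform_modulus hcpt pb.b_cont).1
  have hbmod := (exists_uniform_modulus hcpt pb.b_cont).2
  obtain ⟨-, hcmod⟩ := exists_uniform_modulus hcpt pb.c_cont
  have hGcont : Continuous fun x => p + H x := by fun_prop
  obtain ⟨⟨Cg, hCg⟩, hgmod⟩ := exists_uniform_modulus (A := Unit) (B := Unit) hcpt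
    (u := fun _ _ x => p + H x)
    ((hGcont.comp (continuous_snd.comp continuous_snd)).continuousOn)
  obtain ⟨-, hwmod⟩ := exists_uniform_modulus (A := Unit) (B := Unit) hcpt (u := fun _ _ x => w x)
    ((hw.continuous.comp (continuous_snd.comp continuous_snd)).continuousOn)
  set L := ∑ j, H (EuclideanSpace.single j 1) j with hL
  -- One constant dominates the trace, the drift, the gradient, the admissible values `s` and the
  -- zeroth order coefficient. The tolerance `δ` below makes the error `(5 * M + 1) * δ` at most
  -- `ε`, and each oscillation or approximation error is allowed `δ / 3`.
  set M : ℝ := |L| + |Cb| + |Cg| + |S| + |γ| with hM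
  have hM0 : 0 ≤ M := by positivity
  set δ : ℝ := min 1 (ε / (5 * M + 1)) with hδ
  have hδ0 : 0 < δ := lt_min one_pos (by positivity)
  have hδ3 : 0 < δ / 3 := by positivity
  obtain ⟨η1, hη1, ha⟩ := hamod _ hδ3
  obtain ⟨η2, hη2, hb⟩ := hbmod _ hδ3
  obtain ⟨η3, hη3, hc⟩ := hcmod _ hδ3
  obtain ⟨η4, hη4, hg⟩ := hgmod _ hδ3
  obtain ⟨η5, hη5, hw5⟩ := hwmod _ hδ3
  filter_upwards [h_adm.eventually_dist_lt hη1, h_adm.eventually_dist_lt hη2,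
    h_adm.eventually_dist_lt hη3, h_adm.eventually_dist_lt hη4, h_adm.eventually_dist_lt hη5,
    h_cons.eventually_close hδ3, h_proj.eventually_close h_adm hw hδ3]
    with i d1 d2 d3 d4 d5 hcl hpr α β y hy s hs
  have hK := h_adm.mesh i
  have hyc : y ∈ closure pb.Ω := subset_closure hy.2
  obtain ⟨hcla, hclb, hclc, -⟩ := hcl α β
  have hmeas := pb.domain.isOpen.measurableSet
  have ha' : |(me.aE i α β + me.aI i α β) y - pb.a α β y| ≤ δ := by
    -- The estimate for the nodal diffusion coefficient is known only almost everywhere on the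
    -- support of the hat function. Averaging a constant against the hat function returns the
    -- constant and yields the bound at the node.
    have := hK.abs_average_sub_le pb.domain hy
      (u := fun _ => (me.aE i α β + me.aI i α β) y) (m := pb.a α β y) (δ := δ)
      (memLp_of_continuous pb.domain continuous_const _) (by
        filter_upwards [hcla y hy, ae_restrict_mem hmeas] with x hx hxΩ h0
        have h1 := ha x (subset_closure hxΩ) y hyc (d1 x y h0) α β
        have h2 := hx h0
        rw [Real.norm_eq_abs] at h1
        rw [Pi.add_apply]
        rw [abs_le] at h1 h2 ⊢
        constructor <;> linarith [h1.1, h1.2, h2.1, h2.2])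
    rwa [integral_const_mul, hK.integral_hatN pb.domain hy, mul_one] at this
  rw [h_cons.sum_eq h_adm]
  refine (abs_discreteOp_sub_le hK pb.domain hy (M := M) (δ := δ)
    (((h_cons.bE_cont i).1 α β).add ((h_cons.bI_cont i).1 α β))
    (((h_cons.cE_cont i).1 α β).add ((h_cons.cI_cont i).1 α β)) (me.P i w).2 hδ0.le
    (min_le_left _ _) ?_ ?_ ?_ ?_ (h_proj.integral_inner h_adm hG hy) ha' ?_).trans ?_
  · rw [hM]
    linarith [abs_nonneg Cb, abs_nonneg Cg, abs_nonneg S, abs_nonneg γ]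
  · have := (hCb α β y hyc).trans (le_abs_self Cb)
    rw [hM]
    linarith [abs_nonneg L, abs_nonneg Cg, abs_nonneg S, abs_nonneg γ]
  · have := (hCg () () y hyc).trans (le_abs_self Cg)
    rw [hM]
    linarith [abs_nonneg L, abs_nonneg Cb, abs_nonneg S, abs_nonneg γ]
  · have := hs.trans (le_abs_self S)
    rw [hM]
    linarith [abs_nonneg L, abs_nonneg Cb, abs_nonneg Cg, abs_nonneg γ]
  · filter_upwards [hclb, hclc, hγ i α β, hpr.2, ae_restrict_mem hmeas]
      with x hxb hxc hxγ hxg hxΩ h0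
    have hxc' : x ∈ closure pb.Ω := subset_closure hxΩ
    refine ⟨?_, ?_, ?_, ?_, ?_⟩
    · have h1 := hb x hxc' y hyc (d2 x y h0) α β
      rw [norm_sub_rev] at hxb
      calc ‖(me.bE i α β + me.bI i α β) x - pb.b α β y‖ ≤
            ‖(me.bE i α β x + me.bI i α β x) - pb.b α β x‖ + ‖pb.b α β x - pb.b α β y‖ :=
              norm_sub_le_norm_sub_add_norm_sub _ _ _
        _ ≤ δ := by linarith
    · have h1 := hg x hxc' y hyc (d4 x y h0) () ()
      rw [(hG x).gradient] at hxg
      calc ‖gradient (me.P i w : Pt d → ℝ) x - (p + H y)‖ ≤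
            ‖gradient (me.P i w : Pt d → ℝ) x - (p + H x)‖ + ‖(p + H x) - (p + H y)‖ :=
              norm_sub_le_norm_sub_add_norm_sub _ _ _
        _ ≤ δ := by linarith
    · have h1 := hc x hxc' y hyc (d3 x y h0) α β
      rw [Real.norm_eq_abs] at h1
      rw [Pi.add_apply]
      rw [abs_le] at h1 hxc ⊢
      constructor <;> linarith [h1.1, h1.2, hxc.1, hxc.2]
    · rw [Pi.add_apply]
      have := hxγ.trans (le_abs_self γ)
      rw [hM]
      linarith [abs_nonneg L, abs_nonneg Cb, abs_nonneg Cg, abs_nonneg S]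
    · have h1 := hw5 x hxc' y hyc (d5 x y h0) () ()
      have h2 := hpr.1 x hxc'
      have h3 := hpr.1 y hyc
      rw [Real.norm_eq_abs] at h1
      rw [abs_le] at h1 h2 h3 ⊢
      constructor <;> linarith [h1.1, h1.2, h2.1, h2.2, h3.1, h3.2]
  · calc (5 * M + 1) * δ ≤ (5 * M + 1) * (ε / (5 * M + 1)) :=
        mul_le_mul_of_nonneg_left (min_le_right _ _) (by positivity)
      _ = ε := by field_simp

theorem Method.IsConsistent.eventually_opF_close (h_cons : me.IsConsistent pb)
    (h_adm : me.IsAdmissible pb) {ε : ℝ} (hε : 0 < ε) :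
    ∀ᶠ i in atTop, ∀ α β, ∀ y ∈ (me.mesh i).vertices ∩ pb.Ω,
      |me.opF pb i α β y - pb.f α β y| ≤ ε := by
  have hcpt : IsCompact (closure pb.Ω) := pb.domain.isBounded.isCompact_closure
  obtain ⟨-, hfmod⟩ := exists_uniform_modulus hcpt pb.f_cont
  have hε2 : 0 < ε / 2 := by positivity
  obtain ⟨η, hη, hf⟩ := hfmod _ hε2
  filter_upwards [h_adm.eventually_dist_lt hη, h_cons.eventually_close hε2] with i hd hcl α β y hy
  obtain ⟨-, -, -, hclf⟩ := hcl α β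
  refine (h_adm.mesh i).abs_average_sub_le pb.domain hy ((h_cons.fD_cont i).1 α β) ?_
  filter_upwards [hclf, ae_restrict_mem pb.domain.isOpen.measurableSet] with x hx hxΩ h0
  have h1 := hf x (subset_closure hxΩ) y (subset_closure hy.2) (hd x y h0) α β
  rw [Real.norm_eq_abs] at h1
  rw [abs_le] at h1 hx ⊢
  constructor <;> linarith [h1.1, h1.2, hx.1, hx.2]

/-! ### Boundedness with respect to the controls -/

/-- A continuous family in `L^∞` is locally bounded, and compactness of the set of controls makes
the bound uniform. -/
theorem ContinuousIntoLinf.exists_bound {F : Type*} [NormedAddCommGroup F] {Ω : Set (Pt d)}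
    {u : A → B → Pt d → F} (hu : ContinuousIntoLinf Ω u) :
    ∃ C, ∀ α β, ∀ᵐ x ∂volume.restrict Ω, ‖u α β x‖ ≤ C := by
  suffices h : ∃ C, ∀ p ∈ (univ : Set (A × B)), ∀ᵐ x ∂volume.restrict Ω, ‖u p.1 p.2 x‖ ≤ C by
    obtain ⟨C, hC⟩ := h
    exact ⟨C, fun α β => hC (α, β) (mem_univ _)⟩
  refine isCompact_univ.induction_on (p := fun s : Set (A × B) =>
    ∃ C, ∀ p ∈ s, ∀ᵐ x ∂volume.restrict Ω, ‖u p.1 p.2 x‖ ≤ C) ⟨0, by simp⟩ ?_ ?_ ?_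
  · rintro s t hst ⟨C, hC⟩
    exact ⟨C, fun p hp => hC p (hst hp)⟩
  · rintro s t ⟨C, hC⟩ ⟨D, hD⟩
    refine ⟨max C D, fun p hp => ?_⟩
    rcases hp with hp | hp
    · filter_upwards [hC p hp] with x hx using hx.trans (le_max_left _ _)
    · filter_upwards [hD p hp] with x hx using hx.trans (le_max_right _ _)
  · intro p _
    have h1 : ∀ᶠ q in 𝓝 p, normLinf Ω (fun x => u q.1 q.2 x - u p.1 p.2 x) ≤ ENNReal.ofReal 1 :=
      ENNReal.tendsto_nhds_zero.1 (hu.2 p) _ (by simp)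
    refine ⟨_, nhdsWithin_le_nhds h1, 1 + (normLinf Ω (u p.1 p.2)).toReal, fun q hq => ?_⟩
    have hp : normLinf Ω (u p.1 p.2) ≤ ENNReal.ofReal (normLinf Ω (u p.1 p.2)).toReal :=
      (ENNReal.ofReal_toReal (hu.1 p.1 p.2).2.ne).ge
    filter_upwards [ae_norm_le_of_normLinf_le zero_le_one hq,
      ae_norm_le_of_normLinf_le ENNReal.toReal_nonneg hp] with x h2 h3
    calc ‖u q.1 q.2 x‖ ≤ ‖u q.1 q.2 x - u p.1 p.2 x‖ + ‖u p.1 p.2 x‖ := by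
          simpa using norm_add_le (u q.1 q.2 x - u p.1 p.2 x) (u p.1 p.2 x)
      _ ≤ _ := add_le_add h2 h3

/-- A family of real numbers, indexed by the controls, is bounded. -/
def IsBddFamily {A B : Type*} (u : A → B → ℝ) : Prop := ∃ C, ∀ α β, |u α β| ≤ C

theorem IsBddFamily.add {A B : Type*} {u w : A → B → ℝ} (hu : IsBddFamily u) (hw : IsBddFamily w) :
    IsBddFamily fun α β => u α β + w α β := by
  obtain ⟨C, hC⟩ := hu
  obtain ⟨D, hD⟩ := hw
  exact ⟨C + D, fun α β => (abs_add_le _ _).trans (add_le_add (hC α β) (hD α β))⟩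

theorem IsBddFamily.neg {A B : Type*} {u : A → B → ℝ} (hu : IsBddFamily u) :
    IsBddFamily fun α β => -u α β := by
  obtain ⟨C, hC⟩ := hu
  exact ⟨C, fun α β => by rw [abs_neg]; exact hC α β⟩

theorem IsBddFamily.sub {A B : Type*} {u w : A → B → ℝ} (hu : IsBddFamily u) (hw : IsBddFamily w) :
    IsBddFamily fun α β => u α β - w α β := by
  simpa only [sub_eq_add_neg] using hu.add hw.neg

theorem IsBddFamily.mul_const {A B : Type*} {u : A → B → ℝ} (hu : IsBddFamily u) (r : ℝ) :
    IsBddFamily fun α β => u α β * r := by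
  obtain ⟨C, hC⟩ := hu
  exact ⟨C * |r|, fun α β => by
    rw [abs_mul]
    exact mul_le_mul_of_nonneg_right (hC α β) (abs_nonneg r)⟩

theorem isBddFamily_of_continuous {u : A → B → ℝ} (hu : Continuous fun p : A × B => u p.1 p.2) :
    IsBddFamily u := by
  obtain ⟨C, hC⟩ := isCompact_univ.exists_bound_of_continuousOn hu.continuousOn
  exact ⟨C, fun α β => hC (α, β) (mem_univ _)⟩

theorem isBddFamily_average {A B : Type*} {K : Geometry.SimplicialComplex ℝ (Pt d)} {Ω : Set (Pt d)}
    (hK : IsMesh K Ω) (hΩ : IsLipschitzDomain Ω) {y : Pt d} (hy : y ∈ K.vertices ∩ Ω)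
    {u : A → B → Pt d → ℝ} (hu : ∀ α β, MemLp (u α β) ∞ (volume.restrict Ω)) {C : ℝ}
    (hC : ∀ α β, ∀ᵐ x ∂volume.restrict Ω, |u α β x| ≤ C) :
    IsBddFamily fun α β => ∫ x in Ω, u α β x * hatN K Ω y x := by
  refine ⟨C, fun α β => ?_⟩
  have := hK.abs_average_sub_le hΩ hy (hu α β) (m := 0) (δ := C) (by
    filter_upwards [hC α β] with x hx _
    simpa using hx)
  simpa using this

theorem isBddFamily_discreteOp {K : Geometry.SimplicialComplex ℝ (Pt d)} {Ω : Set (Pt d)}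
    (hK : IsMesh K Ω) (hΩ : IsLipschitzDomain Ω) {y : Pt d} (hy : y ∈ K.vertices ∩ Ω)
    {a : A → B → Pt d → ℝ} {b : A → B → Pt d → Pt d} {c : A → B → Pt d → ℝ}
    (ha : Continuous fun p : A × B => a p.1 p.2 y) (hb : ContinuousIntoLinf Ω b)
    (hc : ContinuousIntoLinf Ω c) {w : Pt d → ℝ} (hw : w ∈ P1Space K) :
    IsBddFamily fun α β => discreteOp K Ω (a α β) (b α β) (c α β) w y := by
  have hm := hΩ.isOpen.measurableSet
  obtain ⟨Cb, hCb⟩ := hb.exists_bound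
  obtain ⟨Cc, hCc⟩ := hc.exists_bound
  obtain ⟨Cw, hCw⟩ := hK.exists_abs_le hw
  have hg := ae_norm_le_of_normLinf_le ENNReal.toReal_nonneg
    (ENNReal.ofReal_toReal (hK.memLp_gradient hm hw).2.ne).ge
  refine ((isBddFamily_of_continuous ha).mul_const _).add
    (isBddFamily_average hK hΩ hy (fun α β => hK.memLp_drift hm (hb.1 α β) (hc.1 α β) hw)
      (C := Cb * (normLinf Ω (gradient w)).toReal + Cc * Cw) fun α β => ?_)
  filter_upwards [hCb α β, hCc α β, hg, ae_restrict_mem hm] with x h1 h2 h3 hx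
  refine (abs_add_le _ _).trans (add_le_add ?_ ?_)
  · rw [abs_neg]
    exact (abs_real_inner_le_norm _ _).trans
      (mul_le_mul h1 h3 (norm_nonneg _) ((norm_nonneg _).trans h1))
  · rw [abs_mul]
    exact mul_le_mul h2 (hCw x (subset_closure hx)) (abs_nonneg _) ((norm_nonneg _).trans h2)

theorem Method.IsConsistent.isBddFamily_opE (h_cons : me.IsConsistent pb)
    (h_adm : me.IsAdmissible pb) {i : ℕ} {y : Pt d} (hy : y ∈ (me.mesh i).vertices ∩ pb.Ω)
    (w : P1Space (me.mesh i)) : IsBddFamily fun α β => me.opE pb i α β w y :=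
  isBddFamily_discreteOp (h_adm.mesh i) pb.domain hy (h_cons.aE_cont i y hy) (h_cons.bE_cont i)
    (h_cons.cE_cont i) w.2

theorem Method.IsConsistent.isBddFamily_opI (h_cons : me.IsConsistent pb)
    (h_adm : me.IsAdmissible pb) {i : ℕ} {y : Pt d} (hy : y ∈ (me.mesh i).vertices ∩ pb.Ω)
    (w : P1Space (me.mesh i)) : IsBddFamily fun α β => me.opI pb i α β w y :=
  isBddFamily_discreteOp (h_adm.mesh i) pb.domain hy (h_cons.aI_cont i y hy) (h_cons.bI_cont i)
    (h_cons.cI_cont i) w.2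

theorem Method.IsConsistent.isBddFamily_opF (h_cons : me.IsConsistent pb)
    (h_adm : me.IsAdmissible pb) {i : ℕ} {y : Pt d} (hy : y ∈ (me.mesh i).vertices ∩ pb.Ω) :
    IsBddFamily fun α β => me.opF pb i α β y := by
  obtain ⟨C, hC⟩ := (h_cons.fD_cont i).exists_bound
  exact isBddFamily_average (h_adm.mesh i) pb.domain hy (h_cons.fD_cont i).1 hC

end Consistency

/-! ### Values of games -/

/-- A monotone functional of families of pay-offs that commutes with the addition of constants. -/
structure IsValue {A B : Type*} (Φ : (A → B → ℝ) → ℝ) : Prop where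
  zero : Φ (fun _ _ => 0) = 0
  le_add : ∀ {u u' : A → B → ℝ} {δ : ℝ}, IsBddFamily u → IsBddFamily u' →
    (∀ α β, u α β ≤ u' α β + δ) → Φ u ≤ Φ u' + δ

/-- Boundedness of the families is essential: real infima and suprema of unbounded families take
default values and are not monotone. -/
theorem isValue_iInf_iSup {A B : Type*} [Nonempty A] [Nonempty B] :
    IsValue fun u : A → B → ℝ => ⨅ β, ⨆ α, u α β := by
  have hbdd : ∀ {u : A → B → ℝ}, IsBddFamily u → (∀ β, BddAbove (range fun α => u α β)) ∧
      BddBelow (range fun β => ⨆ α, u α β) := by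
    rintro u ⟨C, hC⟩
    have h1 : ∀ β, BddAbove (range fun α => u α β) := fun β =>
      ⟨C, by rintro _ ⟨α, rfl⟩; exact (abs_le.1 (hC α β)).2⟩
    refine ⟨h1, -C, ?_⟩
    rintro _ ⟨β, rfl⟩
    obtain ⟨α⟩ := ‹Nonempty A›
    exact (abs_le.1 (hC α β)).1.trans (le_ciSup (h1 β) α)
  refine ⟨by simp, fun {u u' δ} hu hu' h => ?_⟩
  rw [← sub_le_iff_le_add]
  refine le_ciInf fun β => ?_
  rw [sub_le_iff_le_add]
  refine (ciInf_le (hbdd hu).2 β).trans (ciSup_le fun α => (h α β).trans ?_)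
  have := le_ciSup ((hbdd hu').1 β) α
  linarith

/-- The value of the game in which the players have exchanged their aims. -/
theorem IsValue.dual {A B : Type*} {Φ : (A → B → ℝ) → ℝ} (hΦ : IsValue Φ) :
    IsValue fun u => -Φ fun α β => -u α β := by
  refine ⟨by simp [hΦ.zero], fun {u u' δ} hu hu' h => ?_⟩
  have := hΦ.le_add (δ := δ) hu'.neg hu.neg fun α β => by linarith [h α β]
  linarith

theorem IsValue.le_of_le {A B : Type*} {Φ : (A → B → ℝ) → ℝ} (hΦ : IsValue Φ) {u : A → B → ℝ}
    (hu : IsBddFamily u) {C : ℝ} (h : ∀ α β, -C ≤ u α β) : -C ≤ Φ u := by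
  have := hΦ.le_add (u := fun _ _ => 0) (δ := C) ⟨0, by simp⟩ hu fun α β => by linarith [h α β]
  rw [hΦ.zero] at this
  linarith

section Scheme

variable {A B : Type*} [MetricSpace A] [MetricSpace B]
  {pb : Problem d A B} {me : Method d A B}

/-- `u` solves the numerical scheme with the value functional `Φ` and the sources `S` at the
internal nodes. -/
def Method.IsSolution (pb : Problem d A B) (me : Method d A B) (Φ : (A → B → ℝ) → ℝ)
    (S : ℕ → A → B → Pt d → ℝ) (u : ∀ i, ℕ → P1Space (me.mesh i)) : Prop :=
  ∀ i, ∀ k < me.N i, ∀ y ∈ (me.mesh i).vertices ∩ pb.Ω,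
    -(((u i (k + 1) : Pt d → ℝ) y - (u i k : Pt d → ℝ) y) / me.h pb i) +
      Φ (fun α β => me.opE pb i α β (u i (k + 1)) y + me.opI pb i α β (u i k) y - S i α β y) = 0

theorem Method.IsAdmissible.h_pos (h_adm : me.IsAdmissible pb) (i : ℕ) : 0 < me.h pb i :=
  div_pos pb.T_pos (Nat.cast_pos.2 (h_adm.N_pos i))

theorem Method.IsAdmissible.N_mul_h (h_adm : me.IsAdmissible pb) (i : ℕ) :
    me.N i * me.h pb i = pb.T :=
  mul_div_cancel₀ _ (Nat.cast_pos.2 (h_adm.N_pos i)).ne'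

/-- The explicit part of the scheme is monotone. -/
theorem Method.IsMonotone.opE_le (h_mono : me.IsMonotone pb) (h_adm : me.IsAdmissible pb)
    (h_cons : me.IsConsistent pb) {i : ℕ} {y : Pt d} (hy : y ∈ (me.mesh i).vertices ∩ pb.Ω)
    (α : A) (β : B) {w : P1Space (me.mesh i)}
    (hw : ∀ z ∈ (me.mesh i).vertices, dist z y ≤ meshSize (me.mesh i) → 0 ≤ (w : Pt d → ℝ) z) :
    me.opE pb i α β w y ≤ (w : Pt d → ℝ) y / me.h pb i := by
  have hK := h_adm.mesh i
  have hh := h_adm.h_pos i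
  have hsum : me.opE pb i α β w y = ∑ z ∈ hK.finite_vertices.toFinset,
      (w : Pt d → ℝ) z * me.opE pb i α β (hat (me.mesh i) z) y :=
    discreteOp_eq_sum hK pb.domain _ ((h_cons.bE_cont i).1 α β) ((h_cons.cE_cont i).1 α β) w.2 y
  have hdiag : me.opE pb i α β (hat (me.mesh i) y) y ≤ 1 / me.h pb i := by
    rw [le_div_iff₀ hh, mul_comm]
    linarith [h_mono.diag i α β y hy]
  have hmesh : 0 ≤ meshSize (me.mesh i) := by
    obtain ⟨t, ht, -, hyt⟩ := hK.exists_element (subset_closure hy.2)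
    exact dist_nonneg.trans (hK.dist_le_meshSize ht hyt hyt)
  have hyy : 0 ≤ (w : Pt d → ℝ) y := hw y hy.1 (by rw [dist_self]; exact hmesh)
  -- The diagonal entry is at most `1 / h`. Every other term is a non-negative nodal value times a
  -- non-positive entry, or vanishes by locality when the node is too far away for its value to be
  -- controlled.
  rw [hsum, ← Finset.add_sum_erase _ _ (hK.finite_vertices.mem_toFinset.2 hy.1)]
  have hrest : ∑ z ∈ hK.finite_vertices.toFinset.erase y,
      (w : Pt d → ℝ) z * me.opE pb i α β (hat (me.mesh i) z) y ≤ 0 := by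
    refine Finset.sum_nonpos fun z hz => ?_
    obtain ⟨hzy, hz⟩ := Finset.mem_erase.1 hz
    have hz := hK.finite_vertices.mem_toFinset.1 hz
    by_cases hd : dist z y ≤ meshSize (me.mesh i)
    · exact mul_nonpos_of_nonneg_of_nonpos (hw z hz hd) (h_mono.offdiag i α β y hy z hz hzy)
    · have h0 : me.opE pb i α β (hat (me.mesh i) z) y = 0 :=
        discreteOp_hat_eq_zero hK pb.domain _ _ _ (not_le.1 hd)
      rw [h0, mul_zero]
  have := mul_le_mul_of_nonneg_left hdiag hyy
  rw [mul_one_div] at this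
  linarith

variable [CompactSpace A] [CompactSpace B]

/-- Comparison at a node where the solution is touched from above by `(ζ₁, ζ₀)`. -/
theorem Method.IsMonotone.touching (h_mono : me.IsMonotone pb) (h_adm : me.IsAdmissible pb)
    (h_cons : me.IsConsistent pb) {Φ : (A → B → ℝ) → ℝ} (hΦ : IsValue Φ)
    {S : ℕ → A → B → Pt d → ℝ} {u : ∀ i, ℕ → P1Space (me.mesh i)} (hu : me.IsSolution pb Φ S u)
    {i k : ℕ} (hk : k < me.N i) {y : Pt d} (hy : y ∈ (me.mesh i).vertices ∩ pb.Ω)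
    (hS : IsBddFamily fun α β => S i α β y) {ζ₀ ζ₁ : P1Space (me.mesh i)}
    (h1 : ∀ z ∈ (me.mesh i).vertices, dist z y ≤ meshSize (me.mesh i) →
      (u i (k + 1) : Pt d → ℝ) z ≤ (ζ₁ : Pt d → ℝ) z)
    (h0 : IsLocalMinOn (fun x => (ζ₀ : Pt d → ℝ) x - (u i k : Pt d → ℝ) x) (closure pb.Ω) y)
    (h0y : (ζ₀ : Pt d → ℝ) y ≤ (u i k : Pt d → ℝ) y) :
    -(((ζ₁ : Pt d → ℝ) y - (u i k : Pt d → ℝ) y) / me.h pb i) +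
      Φ (fun α β => me.opE pb i α β ζ₁ y + me.opI pb i α β ζ₀ y - S i α β y) ≤ 0 := by
  have hK := h_adm.mesh i
  have hbE := fun w => h_cons.isBddFamily_opE h_adm hy w
  have hbI := fun w => h_cons.isBddFamily_opI h_adm hy w
  -- The choice of `δ` is the bound of `opE_le` for `ζ₁ - u i (k + 1)`; it is exactly the change of
  -- the time difference when `u i (k + 1)` is replaced by `ζ₁`, so the two cancel.
  have key := hΦ.le_add (((hbE ζ₁).add (hbI ζ₀)).sub hS)
    (((hbE (u i (k + 1))).add (hbI (u i k))).sub hS)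
    (δ := ((ζ₁ : Pt d → ℝ) y - (u i (k + 1) : Pt d → ℝ) y) / me.h pb i) (by
      intro α β
      have e1 := h_mono.opE_le h_adm h_cons hy α β (w := ζ₁ - u i (k + 1)) (fun z hz hd => by
        have := h1 z hz hd
        rw [Submodule.coe_sub, Pi.sub_apply]
        linarith)
      have e2 : me.opE pb i α β ((ζ₁ - u i (k + 1) : P1Space (me.mesh i)) : Pt d → ℝ) y =
          me.opE pb i α β ζ₁ y - me.opE pb i α β (u i (k + 1)) y :=
        discreteOp_sub hK pb.domain _ ((h_cons.bE_cont i).1 α β) ((h_cons.cE_cont i).1 α β) _ _ _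
      have e3 : me.opI pb i α β ((ζ₀ - u i k : P1Space (me.mesh i)) : Pt d → ℝ) y =
          me.opI pb i α β ζ₀ y - me.opI pb i α β (u i k) y :=
        discreteOp_sub hK pb.domain _ ((h_cons.bI_cont i).1 α β) ((h_cons.cI_cont i).1 α β) _ _ _
      have e4 := h_mono.lmp i α β _ (ζ₀ - u i k).2 y hy (by
        rw [Submodule.coe_sub, Pi.sub_apply]
        linarith) h0
      rw [e2, Submodule.coe_sub, Pi.sub_apply] at e1
      rw [e3] at e4
      linarith)
  have hsol := hu i k hk y hy
  rw [sub_div] at key hsol ⊢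
  linarith

/-- The comparison with a barrier. -/
theorem Method.IsMonotone.le_barrier (h_mono : me.IsMonotone pb) (h_adm : me.IsAdmissible pb)
    (h_cons : me.IsConsistent pb) {Φ : (A → B → ℝ) → ℝ} (hΦ : IsValue Φ)
    {S : ℕ → A → B → Pt d → ℝ} {u : ∀ i, ℕ → P1Space (me.mesh i)} (hu : me.IsSolution pb Φ S u)
    {i : ℕ} (hS : ∀ y ∈ (me.mesh i).vertices ∩ pb.Ω, IsBddFamily fun α β => S i α β y)
    {W : P1Space (me.mesh i)} {m C : ℝ} (hm : 0 ≤ m) (hC : 0 ≤ C)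
    (hop : ∀ α β, ∀ y ∈ (me.mesh i).vertices ∩ pb.Ω,
      -C ≤ me.opE pb i α β W y + me.opI pb i α β W y - S i α β y)
    (hfin : ∀ z ∈ (me.mesh i).vertices, (u i (me.N i) : Pt d → ℝ) z ≤ (W : Pt d → ℝ) z + m)
    (hbd : ∀ k < me.N i, ∀ z ∈ (me.mesh i).vertices ∩ frontier pb.Ω,
      (u i k : Pt d → ℝ) z ≤ (W : Pt d → ℝ) z + m) :
    ∀ k ≤ me.N i, ∀ z ∈ (me.mesh i).vertices,
      (u i k : Pt d → ℝ) z ≤ (W : Pt d → ℝ) z + (m + C * (pb.T - k * me.h pb i)) := by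
  have hK := h_adm.mesh i
  have hh := h_adm.h_pos i
  have hNh := h_adm.N_mul_h i
  have hTk : ∀ k ≤ me.N i, 0 ≤ pb.T - k * me.h pb i := fun k hk => by
    rw [← hNh, ← sub_mul]
    exact mul_nonneg (sub_nonneg.2 (Nat.cast_le.2 hk)) hh.le
  intro k hk
  -- Time runs backwards from the final condition. If the bound fails at step `k`, the node where
  -- the barrier minus the solution is smallest is internal, and the barrier at step `k + 1`
  -- dominates by induction.
  induction hk using Nat.decreasingInduction with
  | self =>
    intro z hz
    rw [hNh, sub_self, mul_zero, add_zero]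
    exact hfin z hz
  | of_succ k hk ih =>
    intro z hz
    by_contra! hlt
    set r₀ := m + C * (pb.T - k * me.h pb i) with hr₀
    set r₁ := m + C * (pb.T - (k + 1 : ℕ) * me.h pb i) with hr₁
    have hr₁0 : 0 ≤ r₁ := add_nonneg hm (mul_nonneg hC (hTk _ hk))
    have hr₀0 : 0 ≤ r₀ := add_nonneg hm (mul_nonneg hC (hTk _ hk.le))
    let ζ₀ : P1Space (me.mesh i) := W + constP1 (me.mesh i) r₀
    let ζ₁ : P1Space (me.mesh i) := W + constP1 (me.mesh i) r₁
    have hζ₀ : ∀ x ∈ closure pb.Ω, (ζ₀ : Pt d → ℝ) x = (W : Pt d → ℝ) x + r₀ := fun x hx => by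
      rw [Submodule.coe_add, Pi.add_apply, hK.constP1_apply r₀ hx]
    have hζ₁ : ∀ x ∈ closure pb.Ω, (ζ₁ : Pt d → ℝ) x = (W : Pt d → ℝ) x + r₁ := fun x hx => by
      rw [Submodule.coe_add, Pi.add_apply, hK.constP1_apply r₁ hx]
    obtain ⟨y, hyv, hymin⟩ := hK.finite_vertices.toFinset.exists_min_image
      (fun x => ((ζ₀ - u i k : P1Space (me.mesh i)) : Pt d → ℝ) x)
      ⟨z, hK.finite_vertices.mem_toFinset.2 hz⟩
    have hyv := hK.finite_vertices.mem_toFinset.1 hyv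
    have hyc := hK.vertices_subset hyv
    have hyneg : (ζ₀ : Pt d → ℝ) y < (u i k : Pt d → ℝ) y := by
      have h1 := hymin z (hK.finite_vertices.mem_toFinset.2 hz)
      simp only [Submodule.coe_sub, Pi.sub_apply] at h1
      rw [hζ₀ z (hK.vertices_subset hz)] at h1
      linarith
    have hyΩ : y ∈ pb.Ω := by
      by_contra hyΩ
      have := hbd k hk y ⟨hyv, hyc, by rwa [pb.domain.isOpen.interior_eq]⟩
      rw [hζ₀ y hyc] at hyneg
      have h2 := mul_nonneg hC (hTk k hk.le)
      linarith
    have hmin : IsLocalMinOn (fun x => (ζ₀ : Pt d → ℝ) x - (u i k : Pt d → ℝ) x)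
        (closure pb.Ω) y := by
      filter_upwards [self_mem_nhdsWithin] with x hx
      exact hK.le_of_vertices_ge (ζ₀ - u i k).2
        (fun z hz => hymin z (hK.finite_vertices.mem_toFinset.2 hz)) hx
    have htouch := h_mono.touching h_adm h_cons hΦ hu hk ⟨hyv, hyΩ⟩ (hS y ⟨hyv, hyΩ⟩) (ζ₁ := ζ₁)
      (fun z hz _ => by
        rw [hζ₁ z (hK.vertices_subset hz)]
        exact ih z hz) hmin hyneg.le
    have hval : -C ≤ Φ (fun α β => me.opE pb i α β ζ₁ y + me.opI pb i α β ζ₀ y - S i α β y) := by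
      refine hΦ.le_of_le (((h_cons.isBddFamily_opE h_adm ⟨hyv, hyΩ⟩ ζ₁).add
        (h_cons.isBddFamily_opI h_adm ⟨hyv, hyΩ⟩ ζ₀)).sub (hS y ⟨hyv, hyΩ⟩)) fun α β => ?_
      have e1 : me.opE pb i α β ζ₁ y = me.opE pb i α β W y +
          r₁ * ∫ x in pb.Ω, me.cE i α β x * hatN (me.mesh i) pb.Ω y x := by
        rw [← discreteOp_constP1 hK pb.domain (me.aE i α β) (me.bE i α β)]
        exact discreteOp_add hK pb.domain _ ((h_cons.bE_cont i).1 α β)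
          ((h_cons.cE_cont i).1 α β) _ _ _
      have e2 : me.opI pb i α β ζ₀ y = me.opI pb i α β W y +
          r₀ * ∫ x in pb.Ω, me.cI i α β x * hatN (me.mesh i) pb.Ω y x := by
        rw [← discreteOp_constP1 hK pb.domain (me.aI i α β) (me.bI i α β)]
        exact discreteOp_add hK pb.domain _ ((h_cons.bI_cont i).1 α β)
          ((h_cons.cI_cont i).1 α β) _ _ _
      have p1 : 0 ≤ ∫ x in pb.Ω, me.cE i α β x * hatN (me.mesh i) pb.Ω y x := by
        refine integral_nonneg_of_ae ?_
        filter_upwards [h_cons.cE_nonneg i α β] with x hx using mul_nonneg hx (hatN_nonneg y x)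
      have p2 : 0 ≤ ∫ x in pb.Ω, me.cI i α β x * hatN (me.mesh i) pb.Ω y x := by
        refine integral_nonneg_of_ae ?_
        filter_upwards [h_cons.cI_nonneg i α β] with x hx using mul_nonneg hx (hatN_nonneg y x)
      have := hop α β y ⟨hyv, hyΩ⟩
      rw [e1, e2]
      linarith [mul_nonneg hr₁0 p1, mul_nonneg hr₀0 p2]
    -- At the contact node the solution exceeds `ζ₀`, which is larger than `ζ₁` by `C * h`. The
    -- quotient is thus strictly below `-C`, a contradiction.
    have hfinal : -C ≤ ((ζ₁ : Pt d → ℝ) y - (u i k : Pt d → ℝ) y) / me.h pb i := by linarith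
    rw [le_div_iff₀ hh, hζ₁ y hyc] at hfinal
    rw [hζ₀ y hyc] at hyneg
    have hr : r₀ = r₁ + C * me.h pb i := by
      rw [hr₀, hr₁]
      push_cast
      ring
    linarith

end Scheme

/-! ### Upper and lower limits -/

/-- The real infimum is defined as the negative of the supremum of the reflected set, so no
boundedness is needed, not even for default values. -/
theorem limsup_neg_eq {ι : Type*} (f : ι → ℝ) (l : Filter ι) :
    limsup (fun j => -f j) l = -liminf f l := by
  rw [limsup_eq, liminf_eq, Real.sInf_def]
  congr 2
  ext a
  simp

theorem uscEnv_neg {X : Type*} [TopologicalSpace X] (S : Set X) (v : X → ℝ) (x : X) :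
    uscEnv S (fun z => -v z) x = -lscEnv S v x := limsup_neg_eq v _

theorem lscEnv_eq_neg_uscEnv_neg {X : Type*} [TopologicalSpace X] (S : Set X) (v : X → ℝ) (x : X) :
    lscEnv S v x = -uscEnv S (fun z => -v z) x := by rw [uscEnv_neg, neg_neg]

/-- A bounded upper semicontinuous function coincides with its envelope. -/
theorem uscEnv_eq_self {X : Type*} [TopologicalSpace X] {S : Set X} {v : X → ℝ} {x : X} (hx : x ∈ S)
    {M : ℝ} (hM : ∀ z ∈ S, |v z| ≤ M) (h : ∀ c, v x < c → ∀ᶠ z in 𝓝[S] x, v z ≤ c) :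
    uscEnv S v x = v x := by
  have : (𝓝[S] x).NeBot := mem_closure_iff_nhdsWithin_neBot.1 (subset_closure hx)
  have hev : ∀ᶠ z in 𝓝[S] x, |v z| ≤ M := by
    filter_upwards [self_mem_nhdsWithin] with z hz using hM z hz
  have hb : IsBoundedUnder (· ≤ ·) (𝓝[S] x) v :=
    ⟨M, by rw [eventually_map]; exact hev.mono fun z hz => (abs_le.1 hz).2⟩
  have hb' : IsBoundedUnder (· ≥ ·) (𝓝[S] x) v :=
    ⟨-M, by rw [eventually_map]; exact hev.mono fun z hz => (abs_le.1 hz).1⟩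
  refine le_antisymm (le_of_forall_gt_imp_ge_of_dense fun c hc =>
    limsup_le_of_le hb'.isCoboundedUnder_le (h c hc)) ?_
  refine le_limsup_of_frequently_le ?_ hb
  rw [frequently_iff]
  intro U hU
  exact ⟨x, mem_of_mem_nhdsWithin hx hU, le_rfl⟩

section Grid

variable {A B : Type*} [MetricSpace A] [MetricSpace B]
  {pb : Problem d A B} {me : Method d A B}

/-! ### The numerical envelopes -/

theorem Method.eventually_gridFilter {p : ℝ × Pt d} {Q : ℕ × ℕ × Pt d → Prop} :
    (∀ᶠ j in me.gridFilter pb p, Q j) ↔ ∃ i₀, ∃ η > 0, ∀ i ≥ i₀, ∀ k ≤ me.N i,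
      ∀ y ∈ (me.mesh i).vertices, dist ((k : ℝ) * me.h pb i, y) p < η → Q (i, k, y) := by
  have hbasis := (atTop_basis (α := ℕ)).prod (Metric.nhds_basis_ball (x := p))
  rw [Method.gridFilter, eventually_inf_principal, eventually_comap, hbasis.eventually_iff]
  constructor
  · rintro ⟨⟨i₀, η⟩, ⟨-, hη⟩, h⟩
    exact ⟨i₀, η, hη, fun i hi k hk y hy hd =>
      h (x := (i, ((k : ℝ) * me.h pb i, y))) ⟨hi, hd⟩ (i, k, y) rfl ⟨hk, hy⟩⟩
  · rintro ⟨i₀, η, hη, h⟩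
    refine ⟨(i₀, η), ⟨trivial, hη⟩, ?_⟩
    rintro q ⟨hq1, hq2⟩ ⟨i, k, y⟩ rfl ⟨hk, hy⟩
    exact h i hq1 k hk y hy hq2

theorem Method.IsAdmissible.grid_mem_cyl (h_adm : me.IsAdmissible pb) {i k : ℕ} (hk : k ≤ me.N i)
    {y : Pt d} (hy : y ∈ (me.mesh i).vertices) : ((k : ℝ) * me.h pb i, y) ∈ pb.cyl := by
  refine ⟨⟨mul_nonneg (Nat.cast_nonneg k) (h_adm.h_pos i).le, ?_⟩,
    (h_adm.mesh i).vertices_subset hy⟩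
  rw [← h_adm.N_mul_h i]
  exact mul_le_mul_of_nonneg_right (Nat.cast_le.2 hk) (h_adm.h_pos i).le

/-- Rounding the time down to the grid and taking a vertex of an element that contains the point
gives grid points that converge to it. Without this the numerical envelopes would be default values.
-/
theorem Method.IsAdmissible.neBot_gridFilter (h_adm : me.IsAdmissible pb) {p : ℝ × Pt d}
    (hp : p ∈ pb.cyl) : (me.gridFilter pb p).NeBot := by
  obtain ⟨t, x⟩ := p
  obtain ⟨⟨ht0, htT⟩, hx⟩ := hp
  choose y hy hyx using fun i => (h_adm.mesh i).exists_vertex_near hx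
  let k : ℕ → ℕ := fun i => ⌊t / me.h pb i⌋₊
  have hk1 : ∀ i, (k i : ℝ) * me.h pb i ≤ t := fun i => by
    rw [← le_div_iff₀ (h_adm.h_pos i)]
    exact Nat.floor_le (div_nonneg ht0 (h_adm.h_pos i).le)
  have hk2 : ∀ i, t ≤ (k i : ℝ) * me.h pb i + me.h pb i := fun i => by
    have := (Nat.lt_floor_add_one (t / me.h pb i)).le
    rw [div_le_iff₀ (h_adm.h_pos i)] at this
    linarith
  have hkN : ∀ i, k i ≤ me.N i := fun i => by
    have h1 := (hk1 i).trans htT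
    rw [← h_adm.N_mul_h i] at h1
    exact_mod_cast le_of_mul_le_mul_right h1 (h_adm.h_pos i)
  have hlim : Tendsto (fun i => (i, k i, y i)) atTop (me.gridFilter pb (t, x)) := by
    intro Q hQ
    obtain ⟨i₀, η, hη, h⟩ := Method.eventually_gridFilter.1 hQ
    rw [mem_map]
    filter_upwards [eventually_ge_atTop i₀, h_adm.h_tendsto.eventually (gt_mem_nhds hη),
      h_adm.meshSize_tendsto.eventually (gt_mem_nhds hη)] with i hi h1 h2
    refine h i hi (k i) (hkN i) (y i) (hy i) ?_
    rw [Prod.dist_eq, max_lt_iff]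
    refine ⟨?_, (hyx i).trans_lt h2⟩
    rw [Real.dist_eq, abs_lt]
    constructor <;> linarith [hk1 i, hk2 i]
  exact hlim.neBot

/-- The numerical solutions are bounded by `M` at the nodes. -/
def Method.IsNodallyBounded (me : Method d A B) (u : ∀ i, ℕ → P1Space (me.mesh i)) (M : ℝ) : Prop :=
  ∀ i, ∀ k ≤ me.N i, ∀ z ∈ (me.mesh i).vertices, |(u i k : Pt d → ℝ) z| ≤ M

theorem Method.IsNodallyBounded.eventually {u : ∀ i, ℕ → P1Space (me.mesh i)} {M : ℝ}
    (hM : me.IsNodallyBounded u M) (p : ℝ × Pt d) :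
    ∀ᶠ j in me.gridFilter pb p, |(u j.1 j.2.1 : Pt d → ℝ) j.2.2| ≤ M :=
  Method.eventually_gridFilter.2 ⟨0, 1, one_pos, fun i _ k hk y hy _ => hM i k hk y hy⟩

theorem Method.IsNodallyBounded.isBoundedUnder_le {u : ∀ i, ℕ → P1Space (me.mesh i)} {M : ℝ}
    (hM : me.IsNodallyBounded u M) (p : ℝ × Pt d) :
    IsBoundedUnder (· ≤ ·) (me.gridFilter pb p)
      fun j : ℕ × ℕ × Pt d => (u j.1 j.2.1 : Pt d → ℝ) j.2.2 :=
  ⟨M, by rw [eventually_map]; exact (hM.eventually p).mono fun _ h => (abs_le.1 h).2⟩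

theorem Method.IsNodallyBounded.isBoundedUnder_ge {u : ∀ i, ℕ → P1Space (me.mesh i)} {M : ℝ}
    (hM : me.IsNodallyBounded u M) (p : ℝ × Pt d) :
    IsBoundedUnder (· ≥ ·) (me.gridFilter pb p)
      fun j : ℕ × ℕ × Pt d => (u j.1 j.2.1 : Pt d → ℝ) j.2.2 :=
  ⟨-M, by rw [eventually_map]; exact (hM.eventually p).mono fun _ h => (abs_le.1 h).1⟩

theorem Method.IsNodallyBounded.neg {A B : Type*} {me : Method d A B} {u : ∀ i, ℕ → P1Space (me.mesh i)} {M : ℝ}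
    (hM : me.IsNodallyBounded u M) : me.IsNodallyBounded (fun i k => -u i k) M :=
  fun i k hk z hz => by
    rw [Submodule.coe_neg, Pi.neg_apply, abs_neg]
    exact hM i k hk z hz

theorem Method.upperEnv_neg (u : ∀ i, ℕ → P1Space (me.mesh i)) (p : ℝ × Pt d) :
    me.upperEnv pb (fun i k => -u i k) p = -me.lowerEnv pb u p :=
  limsup_neg_eq _ _

theorem Method.upperEnv_le (h_adm : me.IsAdmissible pb) {u : ∀ i, ℕ → P1Space (me.mesh i)} {M : ℝ}
    (hM : me.IsNodallyBounded u M) {p : ℝ × Pt d} (hp : p ∈ pb.cyl) {c : ℝ}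
    (h : ∀ᶠ j in me.gridFilter pb p, (u j.1 j.2.1 : Pt d → ℝ) j.2.2 ≤ c) :
    me.upperEnv pb u p ≤ c := by
  have := h_adm.neBot_gridFilter hp
  exact limsup_le_of_le (hM.isBoundedUnder_ge p).isCoboundedUnder_le h

theorem Method.abs_upperEnv_le (h_adm : me.IsAdmissible pb) {u : ∀ i, ℕ → P1Space (me.mesh i)}
    {M : ℝ} (hM : me.IsNodallyBounded u M) {p : ℝ × Pt d} (hp : p ∈ pb.cyl) :
    |me.upperEnv pb u p| ≤ M := by
  have := h_adm.neBot_gridFilter hp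
  rw [abs_le]
  exact ⟨le_limsup_of_frequently_le
      ((hM.eventually p).mono fun j h => (abs_le.1 h).1).frequently (hM.isBoundedUnder_le p),
    Method.upperEnv_le h_adm hM hp ((hM.eventually p).mono fun j h => (abs_le.1 h).2)⟩

theorem Method.lowerEnv_le_upperEnv (h_adm : me.IsAdmissible pb)
    {u : ∀ i, ℕ → P1Space (me.mesh i)} {M : ℝ} (hM : me.IsNodallyBounded u M) {p : ℝ × Pt d}
    (hp : p ∈ pb.cyl) : me.lowerEnv pb u p ≤ me.upperEnv pb u p := by
  have := h_adm.neBot_gridFilter hp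
  exact liminf_le_limsup (hM.isBoundedUnder_le p) (hM.isBoundedUnder_ge p)

/-- Half-relaxed limits are upper semicontinuous: grid points within `η / 2` of `q` are within `η`
of `p` when `q` is within `η / 2` of `p`. -/
theorem Method.eventually_upperEnv_le (h_adm : me.IsAdmissible pb)
    {u : ∀ i, ℕ → P1Space (me.mesh i)} {M : ℝ} (hM : me.IsNodallyBounded u M) {p : ℝ × Pt d} {c : ℝ}
    (hc : me.upperEnv pb u p < c) : ∀ᶠ q in 𝓝[pb.cyl] p, me.upperEnv pb u q ≤ c := by
  have h1 : ∀ᶠ j in me.gridFilter pb p, (u j.1 j.2.1 : Pt d → ℝ) j.2.2 < c :=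
    eventually_lt_of_limsup_lt hc (hM.isBoundedUnder_le p)
  obtain ⟨i₀, η, hη, h⟩ := Method.eventually_gridFilter.1 h1
  filter_upwards [self_mem_nhdsWithin, nhdsWithin_le_nhds (Metric.ball_mem_nhds p (half_pos hη))]
    with q hq hqp
  refine Method.upperEnv_le h_adm hM hq (Method.eventually_gridFilter.2
    ⟨i₀, η / 2, half_pos hη, fun i hi k hk y hy hd => (h i hi k hk y hy ?_).le⟩)
  calc _ ≤ dist ((k : ℝ) * me.h pb i, y) q + dist q p := dist_triangle _ _ _
    _ < η / 2 + η / 2 := add_lt_add hd hqp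
    _ = η := add_halves η

theorem Method.uscEnv_upperEnv (h_adm : me.IsAdmissible pb) {u : ∀ i, ℕ → P1Space (me.mesh i)}
    {M : ℝ} (hM : me.IsNodallyBounded u M) {p : ℝ × Pt d} (hp : p ∈ pb.cyl) :
    uscEnv pb.cyl (me.upperEnv pb u) p = me.upperEnv pb u p :=
  uscEnv_eq_self hp (fun _ hz => Method.abs_upperEnv_le h_adm hM hz)
    fun _ hc => Method.eventually_upperEnv_le h_adm hM hc

/-! ### Points of contact -/

/-- If the upper envelope is touched strictly from above by a test function, then the numerical
solutions are touched from above, relative to the nodes near the point of contact, by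
approximations of the test function. -/
theorem Method.exists_contact (h_adm : me.IsAdmissible pb) {u : ∀ i, ℕ → P1Space (me.mesh i)}
    {M : ℝ} (hM : me.IsNodallyBounded u M) {t₀ : ℝ} {x₀ : Pt d} (ht₀ : t₀ ∈ Ico 0 pb.T)
    (hx₀ : x₀ ∈ closure pb.Ω) {κ : ℝ → ℝ} {w : Pt d → ℝ} (hκ : Continuous κ) (hw : Continuous w)
    (hκ0 : κ t₀ = 0) (hw0 : w x₀ = 0) {W : ℕ → Pt d → ℝ}
    (hW : ∀ σ > 0, ∀ᶠ i in atTop, ∀ x ∈ closure pb.Ω, |W i x - w x| ≤ σ) {ε r : ℝ} (hε : 0 < ε)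
    (hr : 0 < r) (hmax : ∀ p ∈ pb.cyl, dist p (t₀, x₀) < r →
      me.upperEnv pb u p ≤ me.upperEnv pb u (t₀, x₀) + κ p.1 + w p.2 -
        ((p.1 - t₀) ^ 2 + ε * ‖p.2 - x₀‖ ^ 2)) :
    ∃ ρ > 0, ∀ η > 0, ∃ᶠ i in atTop, ∃ k < me.N i, ∃ y ∈ (me.mesh i).vertices,
      dist ((k : ℝ) * me.h pb i, y) (t₀, x₀) < η ∧
      |(u i k : Pt d → ℝ) y - me.upperEnv pb u (t₀, x₀)| < η ∧
      ∀ k' ≤ me.N i, ∀ z ∈ (me.mesh i).vertices,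
        dist ((k' : ℝ) * me.h pb i, z) (t₀, x₀) < ρ →
        (u i k' : Pt d → ℝ) z - κ (k' * me.h pb i) - W i z ≤
          (u i k : Pt d → ℝ) y - κ (k * me.h pb i) - W i y := by
  have hp₀ : (t₀, x₀) ∈ pb.cyl := ⟨⟨ht₀.1, ht₀.2.le⟩, hx₀⟩
  set U₀ := me.upperEnv pb u (t₀, x₀) with hU₀
  -- The closed ball of radius `ρ` lies inside the ball where the gap inequality is known, and grid
  -- points in the open ball have times below `T`, so the maximiser satisfies `k < N`.
  set ρ := min (r / 2) (pb.T - t₀) with hρ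
  have hρ0 : 0 < ρ := lt_min (half_pos hr) (sub_pos.2 ht₀.2)
  refine ⟨ρ, hρ0, fun η hη => ?_⟩
  have hcont : Continuous fun p : ℝ × Pt d => κ p.1 + w p.2 := by fun_prop
  have hcont' : Continuous fun p : ℝ × Pt d =>
      U₀ + κ p.1 + w p.2 - ((p.1 - t₀) ^ 2 + ε * ‖p.2 - x₀‖ ^ 2) := by fun_prop
  obtain ⟨η₁, hη₁, hnear⟩ := Metric.continuous_iff.1 hcont (t₀, x₀) (η / 2) (half_pos hη)
  simp only [hκ0, hw0, add_zero, Real.dist_eq, sub_zero] at hnear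
  set η₂ := min η η₁ with hη₂
  have hη₂0 : 0 < η₂ := lt_min hη hη₁
  -- Four errors of size `σ` add up: `W` against `w` at two nodes, the uniform upper bound, and the
  -- defect of the near-optimal nodes. So the penalty at the maximiser is at most `4 * σ`, which is
  -- too small for a point at distance `η₂` or more.
  set σ := min (η / 8) (min 1 ε * η₂ ^ 2 / 8) with hσ
  have hmin0 : 0 < min 1 ε := lt_min one_pos hε
  have hσ0 : 0 < σ := lt_min (by positivity) (by positivity)
  -- an upper bound that is uniform on a compact neighbourhood
  have hR : IsCompact (pb.cyl ∩ Metric.closedBall (t₀, x₀) ρ) :=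
    (isCompact_Icc.prod pb.domain.isBounded.isCompact_closure).inter_right Metric.isClosed_closedBall
  have hup : ∃ i₀, ∀ i ≥ i₀, ∀ k ≤ me.N i, ∀ z ∈ (me.mesh i).vertices,
      ((k : ℝ) * me.h pb i, z) ∈ pb.cyl ∩ Metric.closedBall (t₀, x₀) ρ →
      (u i k : Pt d → ℝ) z ≤ U₀ + κ (k * me.h pb i) + w z -
        ((k * me.h pb i - t₀) ^ 2 + ε * ‖z - x₀‖ ^ 2) + σ := by
    refine hR.induction_on (p := fun s : Set (ℝ × Pt d) => ∃ i₀, ∀ i ≥ i₀, ∀ k ≤ me.N i,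
      ∀ z ∈ (me.mesh i).vertices, ((k : ℝ) * me.h pb i, z) ∈ s →
      (u i k : Pt d → ℝ) z ≤ U₀ + κ (k * me.h pb i) + w z -
        ((k * me.h pb i - t₀) ^ 2 + ε * ‖z - x₀‖ ^ 2) + σ) ⟨0, by simp⟩ ?_ ?_ ?_
    · rintro s t hst ⟨i₀, h⟩
      exact ⟨i₀, fun i hi k hk z hz hs => h i hi k hk z hz (hst hs)⟩
    · rintro s t ⟨i₀, h⟩ ⟨i₁, h'⟩
      refine ⟨max i₀ i₁, fun i hi k hk z hz hs => ?_⟩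
      rcases hs with hs | hs
      · exact h i ((le_max_left _ _).trans hi) k hk z hz hs
      · exact h' i ((le_max_right _ _).trans hi) k hk z hz hs
    · rintro p ⟨hp, hpρ⟩
      have hpr : dist p (t₀, x₀) < r := by
        have h1 : dist p (t₀, x₀) ≤ ρ := hpρ
        have h2 : ρ ≤ r / 2 := min_le_left _ _
        linarith
      have h1 : me.upperEnv pb u p < U₀ + κ p.1 + w p.2 -
          ((p.1 - t₀) ^ 2 + ε * ‖p.2 - x₀‖ ^ 2) + σ / 2 := by linarith [hmax p hp hpr]
      have h2 := eventually_lt_of_limsup_lt h1 (hM.isBoundedUnder_le p)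
      obtain ⟨i₀, η₃, hη₃, h3⟩ := Method.eventually_gridFilter.1 h2
      obtain ⟨η₄, hη₄, h4⟩ := Metric.continuous_iff.1 hcont' p (σ / 2) (half_pos hσ0)
      refine ⟨Metric.ball p (min η₃ η₄), nhdsWithin_le_nhds
        (Metric.ball_mem_nhds p (lt_min hη₃ hη₄)), i₀, fun i hi k hk z hz hs => ?_⟩
      have h5 := h3 i hi k hk z hz (lt_of_lt_of_le hs (min_le_left _ _))
      have h6 := h4 _ (lt_of_lt_of_le hs (min_le_right _ _))
      rw [Real.dist_eq, abs_lt] at h6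
      simp only at h5 h6
      linarith [h6.1]
  obtain ⟨i₀, hup⟩ := hup
  -- nodes where the upper limit is attained
  have hfreq : ∃ᶠ i in atTop, ∃ k ≤ me.N i, ∃ y ∈ (me.mesh i).vertices,
      dist ((k : ℝ) * me.h pb i, y) (t₀, x₀) < ρ ∧
        U₀ - σ < (u i k : Pt d → ℝ) y - κ (k * me.h pb i) - w y := by
    obtain ⟨η₃, hη₃, h3⟩ := Metric.continuous_iff.1 hcont (t₀, x₀) (σ / 2) (half_pos hσ0)
    simp only [hκ0, hw0, add_zero, Real.dist_eq, sub_zero] at h3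
    rw [frequently_atTop]
    intro i₁
    have h1 : ∃ᶠ j in me.gridFilter pb (t₀, x₀),
        U₀ - σ / 2 < (u j.1 j.2.1 : Pt d → ℝ) j.2.2 := by
      have := h_adm.neBot_gridFilter hp₀
      exact frequently_lt_of_lt_limsup (hM.isBoundedUnder_ge _).isCoboundedUnder_le
        (show U₀ - σ / 2 < me.upperEnv pb u (t₀, x₀) by linarith)
    have h2 : ∀ᶠ j in me.gridFilter pb (t₀, x₀), i₁ ≤ j.1 ∧ j.2.1 ≤ me.N j.1 ∧
        j.2.2 ∈ (me.mesh j.1).vertices ∧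
        dist ((j.2.1 : ℝ) * me.h pb j.1, j.2.2) (t₀, x₀) < min ρ η₃ :=
      Method.eventually_gridFilter.2 ⟨i₁, min ρ η₃, lt_min hρ0 hη₃,
        fun i hi k hk y hy hd => ⟨hi, hk, hy, hd⟩⟩
    obtain ⟨⟨i, k, y⟩, hj, hi, hk, hy, hd⟩ := (h1.and_eventually h2).exists
    refine ⟨i, hi, k, hk, y, hy, lt_of_lt_of_le hd (min_le_left _ _), ?_⟩
    have h4 := abs_lt.1 (h3 _ (lt_of_lt_of_le hd (min_le_right _ _)))
    simp only at hj h4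
    linarith [h4.2]
  refine (hfreq.and_eventually ((eventually_ge_atTop i₀).and (hW σ hσ0))).mono ?_
  rintro i ⟨⟨k₁, hk₁, y₁, hy₁, hd₁, hlow⟩, hi, hWi⟩
  have hK := h_adm.mesh i
  have hfin : {q : ℕ × Pt d | q.1 ≤ me.N i ∧ q.2 ∈ (me.mesh i).vertices ∧
      dist ((q.1 : ℝ) * me.h pb i, q.2) (t₀, x₀) < ρ}.Finite :=
    ((finite_Iic (me.N i)).prod hK.finite_vertices).subset fun q hq => ⟨hq.1, hq.2.1⟩
  -- The maximum is taken over the finitely many grid points of the ball of fixed radius `ρ`; the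
  -- penalty then forces the maximiser to within `η₂` of the point of contact.
  obtain ⟨⟨k, y⟩, hky, hmaxky⟩ := hfin.exists_maximalFor
    (fun q : ℕ × Pt d => (u i q.1 : Pt d → ℝ) q.2 - κ (q.1 * me.h pb i) - W i q.2) _
    ⟨(k₁, y₁), hk₁, hy₁, hd₁⟩
  obtain ⟨hk, hy, hd⟩ := hky
  have hmax' : ∀ k' ≤ me.N i, ∀ z ∈ (me.mesh i).vertices,
      dist ((k' : ℝ) * me.h pb i, z) (t₀, x₀) < ρ →
      (u i k' : Pt d → ℝ) z - κ (k' * me.h pb i) - W i z ≤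
        (u i k : Pt d → ℝ) y - κ (k * me.h pb i) - W i y := by
    intro k' hk' z hz hd'
    by_contra! hlt
    exact absurd (hmaxky (j := (k', z)) ⟨hk', hz, hd'⟩ hlt.le) (not_le.2 hlt)
  simp only at hk hy hd
  have h1 := hmax' k₁ hk₁ y₁ hy₁ hd₁
  have h2 := abs_le.1 (hWi y (hK.vertices_subset hy))
  have h3 := abs_le.1 (hWi y₁ (hK.vertices_subset hy₁))
  have h4 := hup i hi k hk y hy ⟨h_adm.grid_mem_cyl hk hy, hd.le⟩
  have hω : (k * me.h pb i - t₀) ^ 2 + ε * ‖y - x₀‖ ^ 2 ≤ 4 * σ := by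
    linarith [h2.1, h2.2, h3.1, h3.2]
  have hσ2 : 4 * σ < min 1 ε * η₂ ^ 2 := by
    have : σ ≤ min 1 ε * η₂ ^ 2 / 8 := min_le_right _ _
    have : 0 < min 1 ε * η₂ ^ 2 := by positivity
    linarith
  have hdη : dist ((k : ℝ) * me.h pb i, y) (t₀, x₀) < η₂ := by
    rw [Prod.dist_eq, max_lt_iff]
    constructor
    · rw [Real.dist_eq]
      refine abs_lt_of_sq_lt_sq ?_ hη₂0.le
      have : min 1 ε * η₂ ^ 2 ≤ 1 * η₂ ^ 2 :=
        mul_le_mul_of_nonneg_right (min_le_left _ _) (sq_nonneg _)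
      have : 0 ≤ ε * ‖y - x₀‖ ^ 2 := by positivity
      linarith
    · rw [dist_eq_norm]
      refine lt_of_pow_lt_pow_left₀ 2 hη₂0.le ?_
      have h5 : min 1 ε * η₂ ^ 2 ≤ ε * η₂ ^ 2 :=
        mul_le_mul_of_nonneg_right (min_le_right _ _) (sq_nonneg _)
      have h6 : 0 ≤ (k * me.h pb i - t₀) ^ 2 := sq_nonneg _
      exact lt_of_mul_lt_mul_left (by linarith) hε.le
  have h5 := abs_lt.1 (hnear _ (lt_of_lt_of_le hdη (min_le_right _ _)))
  simp only at h5
  have hση : σ ≤ η / 8 := min_le_left _ _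
  refine ⟨k, ?_, y, hy, lt_of_lt_of_le hdη (min_le_left _ _), ?_, hmax'⟩
  · have h6 : (k : ℝ) * me.h pb i < pb.T := by
      have h7 : dist ((k : ℝ) * me.h pb i) t₀ < ρ := lt_of_le_of_lt (le_max_left _ _) hd
      rw [Real.dist_eq] at h7
      have h8 := (abs_lt.1 h7).2
      have : ρ ≤ pb.T - t₀ := min_le_right _ _
      linarith
    rw [← h_adm.N_mul_h i] at h6
    exact_mod_cast lt_of_mul_lt_mul_right h6 (h_adm.h_pos i).le
  · have h6 : 0 ≤ (k * me.h pb i - t₀) ^ 2 + ε * ‖y - x₀‖ ^ 2 := by positivity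
    rw [abs_lt]
    constructor <;> linarith [h2.1, h2.2, h3.1, h3.2, h5.1, h5.2]

end Grid

/-! ### Second order expansions -/

/-- The derivative of the remainder at `q` is the first order remainder of `fderiv ℝ ψ`, which is
`o(‖q - p₀‖)` because `fderiv ℝ ψ` is differentiable at `p₀`. The mean value inequality on a ball
gains the second power. -/
theorem eventually_abs_taylor_two_le {E : Type*} [NormedAddCommGroup E] [NormedSpace ℝ E]
    {ψ : E → ℝ} (hψ : ContDiff ℝ 2 ψ) (p₀ : E) {ε : ℝ} (hε : 0 < ε) :
    ∀ᶠ p in 𝓝 p₀, |ψ p - ψ p₀ - fderiv ℝ ψ p₀ (p - p₀) -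
      1 / 2 * fderiv ℝ (fderiv ℝ ψ) p₀ (p - p₀) (p - p₀)| ≤ ε * ‖p - p₀‖ ^ 2 := by
  set D := fderiv ℝ ψ p₀ with hD
  set D2 := fderiv ℝ (fderiv ℝ ψ) p₀ with hD2
  have hd : Differentiable ℝ ψ := hψ.differentiable (by simp)
  have hd1 : Differentiable ℝ (fderiv ℝ ψ) :=
    (hψ.fderiv_right (m := 1) (by norm_num)).differentiable (by simp)
  have hsymm : ∀ u v, D2 u v = D2 v u :=
    (hψ.contDiffAt (x := p₀)).isSymmSndFDerivAt (by simp)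
  have hlo := (hd1 p₀).hasFDerivAt.isLittleO.def hε
  obtain ⟨δ, hδ, hball⟩ := Metric.eventually_nhds_iff_ball.1 hlo
  filter_upwards [Metric.ball_mem_nhds p₀ hδ] with p hp
  let R : E → ℝ := fun q => ψ q - D (q - p₀) - 1 / 2 * D2 (q - p₀) (q - p₀)
  have hR : ∀ q, HasFDerivAt R (fderiv ℝ ψ q - D - D2 (q - p₀)) q := by
    intro q
    have h1 : HasFDerivAt (fun q : E => q - p₀) (ContinuousLinearMap.id ℝ E) q :=
      (hasFDerivAt_id q).sub_const p₀
    have h2 := D.hasFDerivAt.comp q h1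
    have h3 := ((D2.hasFDerivAt.comp q h1).clm_apply h1).const_mul (1 / 2 : ℝ)
    refine (((hd q).hasFDerivAt.sub h2).sub h3).congr_fderiv ?_
    ext v
    simp only [_root_.sub_apply, ContinuousLinearMap.comp_apply,
      _root_.smul_apply, _root_.add_apply,
      ContinuousLinearMap.flip_apply, ContinuousLinearMap.id_apply, smul_eq_mul,
      Function.comp_apply]
    rw [hsymm v (q - p₀)]
    ring
  have hsub : Metric.closedBall p₀ (dist p p₀) ⊆ Metric.ball p₀ δ :=
    Metric.closedBall_subset_ball hp
  have key := (convex_closedBall p₀ (dist p p₀)).norm_image_sub_le_of_norm_hasFDerivWithin_le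
    (f := R) (C := ε * ‖p - p₀‖) (fun q _ => (hR q).hasFDerivWithinAt) (fun q hq => by
      refine (hball q (hsub hq)).trans (mul_le_mul_of_nonneg_left ?_ hε.le)
      rw [← dist_eq_norm, ← dist_eq_norm]
      exact hq) (Metric.mem_closedBall_self dist_nonneg)
    (Metric.mem_closedBall.2 le_rfl)
  have e : R p - R p₀ = ψ p - ψ p₀ - D (p - p₀) - 1 / 2 * D2 (p - p₀) (p - p₀) := by
    simp only [R, sub_self, map_zero]
    ring
  rw [e, Real.norm_eq_abs] at key
  calc _ ≤ _ := key
    _ = ε * ‖p - p₀‖ ^ 2 := by ring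

/-- A test function is bounded from above, near a point, by a quadratic function of the space
variable plus a quadratic function of time. -/
theorem exists_quadratic_upper_bound {d : ℕ} {ψ : ℝ × Pt d → ℝ} (hψ : ContDiff ℝ 2 ψ) (t₀ : ℝ)
    (x₀ : Pt d) : ∃ H : Pt d →L[ℝ] Pt d, (∀ u v, inner ℝ (H u) v = inner ℝ u (H v)) ∧
      ∑ j, H (EuclideanSpace.single j 1) j = Laplacian.laplacian (fun y => ψ (t₀, y)) x₀ ∧
      ∀ ε > 0, ∃ k : ℝ, ∀ᶠ p in 𝓝 (t₀, x₀), ψ p ≤ ψ (t₀, x₀) +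
        (deriv (fun τ => ψ (τ, x₀)) t₀ * (p.1 - t₀) + k * (p.1 - t₀) ^ 2) +
        (inner ℝ (gradient (fun y => ψ (t₀, y)) x₀) (p.2 - x₀) +
          1 / 2 * inner ℝ (H (p.2 - x₀)) (p.2 - x₀) + ε * ‖p.2 - x₀‖ ^ 2) := by
  set D := fderiv ℝ ψ (t₀, x₀) with hD
  set D2 := fderiv ℝ (fderiv ℝ ψ) (t₀, x₀) with hD2
  have hd : Differentiable ℝ ψ := hψ.differentiable (by simp)
  have hd1 : Differentiable ℝ (fderiv ℝ ψ) :=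
    (hψ.fderiv_right (m := 1) (by norm_num)).differentiable (by simp)
  have hsymm : ∀ u v, D2 u v = D2 v u :=
    (hψ.contDiffAt (x := (t₀, x₀))).isSymmSndFDerivAt (by simp)
  let inr := ContinuousLinearMap.inr ℝ ℝ (Pt d)
  have hinr : ∀ y : Pt d, HasFDerivAt (fun y : Pt d => (t₀, y)) inr y := fun y =>
    hasFDerivAt_prodMk_right t₀ y
  have hf1 : ∀ y, fderiv ℝ (fun y => ψ (t₀, y)) y = (fderiv ℝ ψ (t₀, y)).comp inr := fun y =>
    (((hd (t₀, y)).hasFDerivAt).comp y (hinr y)).fderiv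
  have hf2 : HasFDerivAt (fderiv ℝ fun y => ψ (t₀, y))
      (((ContinuousLinearMap.compL ℝ (Pt d) (ℝ × Pt d) ℝ).flip inr).comp (D2.comp inr)) x₀ := by
    have h1 : HasFDerivAt (fun y => fderiv ℝ ψ (t₀, y)) (D2.comp inr) x₀ :=
      ((hd1 (t₀, x₀)).hasFDerivAt).comp x₀ (hinr x₀)
    have h2 := (((ContinuousLinearMap.compL ℝ (Pt d) (ℝ × Pt d) ℝ).flip inr).hasFDerivAt).comp x₀ h1
    refine h2.congr_of_eventuallyEq (Eventually.of_forall fun y => ?_)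
    rw [hf1]
    rfl
  -- The operator that represents the spatial block of the second derivative.
  let Hlin : Pt d →ₗ[ℝ] Pt d :=
    { toFun := fun u => (InnerProductSpace.toDual ℝ (Pt d)).symm ((D2 (0, u)).comp inr)
      map_add' := fun u v => by
        have : ((0 : ℝ), u + v) = (0, u) + (0, v) := by simp
        rw [this, map_add, ContinuousLinearMap.add_comp, map_add]
      map_smul' := fun r u => by
        have : ((0 : ℝ), r • u) = r • (0, u) := by simp
        rw [this, map_smul, ContinuousLinearMap.smul_comp]
        simp }
  have hH : ∀ u v, inner ℝ (LinearMap.toContinuousLinearMap Hlin u) v = D2 (0, u) (0, v) := by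
    intro u v
    exact InnerProductSpace.toDual_symm_apply
  refine ⟨LinearMap.toContinuousLinearMap Hlin, fun u v => ?_, ?_, fun ε hε => ?_⟩
  · rw [hH, real_inner_comm, hH, hsymm]
  · rw [InnerProductSpace.laplacian_eq_iteratedFDeriv_orthonormalBasis _
      (EuclideanSpace.basisFun (Fin d) ℝ)]
    refine Finset.sum_congr rfl fun j _ => ?_
    rw [iteratedFDeriv_two_apply, hf2.fderiv]
    have := hH (EuclideanSpace.single j 1) (EuclideanSpace.single j 1)
    rw [EuclideanSpace.inner_single_right] at this
    simp only [one_mul] at this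
    simpa [inr] using this
  · have hk : ∀ s : ℝ, ∀ v : Pt d, D2 (s, v) (s, v) ≤
        s ^ 2 * D2 (1, 0) (1, 0) + 2 * (|s| * (‖D2‖ * ‖v‖)) + D2 (0, v) (0, v) := by
      intro s v
      have hsv : (s, v) = s • ((1 : ℝ), (0 : Pt d)) + (0, v) := by simp
      have hmix : s * D2 (1, 0) (0, v) ≤ |s| * (‖D2‖ * ‖v‖) := by
        refine (le_abs_self _).trans ?_
        rw [abs_mul]
        refine mul_le_mul_of_nonneg_left ?_ (abs_nonneg _)
        have := D2.le_opNorm₂ (1, 0) (0, v)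
        simpa [Prod.norm_def] using this
      have e : D2 (s, v) (s, v) = s ^ 2 * D2 (1, 0) (1, 0) + 2 * (s * D2 (1, 0) (0, v)) +
          D2 (0, v) (0, v) := by
        rw [hsv]
        simp only [map_add, map_smul, _root_.add_apply,
          _root_.smul_apply, smul_eq_mul]
        rw [hsymm (0, v) (1, 0)]
        ring
      rw [e]
      linarith
    -- The mixed term is removed by Young's inequality, so that time and space separate and the
    -- elliptic projection acts on the spatial part alone. It uses `ε / 2` of the allowance in
    -- space; the other half, and the last summand here, are the Taylor remainder.
    refine ⟨1 / 2 * D2 (1, 0) (1, 0) + ‖D2‖ ^ 2 / (2 * ε) + ε / 2, ?_⟩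
    filter_upwards [eventually_abs_taylor_two_le hψ (t₀, x₀) (half_pos hε)] with p hp
    obtain ⟨t, x⟩ := p
    set s := t - t₀ with hs
    set v := x - x₀ with hv
    have hsub : (t, x) - (t₀, x₀) = (s, v) := rfl
    rw [hsub, ← hD, ← hD2] at hp
    have h1 := (abs_le.1 hp).2
    have h2 := hk s v
    have hDt : deriv (fun τ => ψ (τ, x₀)) t₀ = D (1, 0) := by
      have := ((hd (t₀, x₀)).hasFDerivAt).comp_hasDerivAt t₀
        ((hasDerivAt_id t₀).prodMk (hasDerivAt_const t₀ x₀))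
      exact this.deriv
    have hDx : inner ℝ (gradient (fun y => ψ (t₀, y)) x₀) v = D (0, v) := by
      rw [gradient, InnerProductSpace.toDual_symm_apply, hf1]
      rfl
    have hDsv : D (s, v) = D (1, 0) * s + D (0, v) := by
      have hsv : (s, v) = s • ((1 : ℝ), (0 : Pt d)) + (0, v) := by simp
      rw [hsv, map_add, map_smul, smul_eq_mul, mul_comm]
    have hnorm : ‖(s, v)‖ ^ 2 ≤ s ^ 2 + ‖v‖ ^ 2 := by
      have hmax : ‖(s, v)‖ = max ‖s‖ ‖v‖ := rfl
      rw [hmax]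
      rcases max_choice ‖s‖ ‖v‖ with h | h
      · rw [h, Real.norm_eq_abs, sq_abs]
        linarith [sq_nonneg ‖v‖]
      · rw [h]
        linarith [sq_nonneg s]
    have hyoung : |s| * (‖D2‖ * ‖v‖) ≤ ‖D2‖ ^ 2 / (2 * ε) * s ^ 2 + ε / 2 * ‖v‖ ^ 2 := by
      have h3 : 0 ≤ (‖D2‖ * |s| - ε * ‖v‖) ^ 2 / (2 * ε) := by positivity
      have h4 : (‖D2‖ * |s| - ε * ‖v‖) ^ 2 / (2 * ε) =
          ‖D2‖ ^ 2 / (2 * ε) * |s| ^ 2 + ε / 2 * ‖v‖ ^ 2 - |s| * (‖D2‖ * ‖v‖) := by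
        field_simp
        ring
      rw [h4, sq_abs] at h3
      linarith
    have h5 := mul_le_mul_of_nonneg_left hnorm (half_pos hε).le
    simp only
    rw [hDt, hDx, hH]
    rw [hDsv] at h1
    linarith

section Test

variable {A B : Type*} [MetricSpace A] [MetricSpace B]
  {pb : Problem d A B} {me : Method d A B}

/-! ### Passage to the limit at a point of contact -/

/-- The implicit coefficient is non-negative, so a bound of the sum bounds the explicit one. This
controls the error that arises because the explicit operator sees the test function one time step
later. -/
theorem Method.IsConsistent.exists_abs_average_cE_le (h_cons : me.IsConsistent pb)
    (h_adm : me.IsAdmissible pb) : ∃ γ : ℝ, 0 ≤ γ ∧ ∀ i α β,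
      ∀ y ∈ (me.mesh i).vertices ∩ pb.Ω,
        |∫ x in pb.Ω, me.cE i α β x * hatN (me.mesh i) pb.Ω y x| ≤ γ := by
  obtain ⟨γ, hγ⟩ := h_cons.exists_ae_c_le
  refine ⟨|γ|, abs_nonneg γ, fun i α β y hy => ?_⟩
  have := (h_adm.mesh i).abs_average_sub_le pb.domain hy ((h_cons.cE_cont i).1 α β) (m := 0)
    (δ := |γ|) (by
      filter_upwards [hγ i α β, h_cons.cE_nonneg i α β, h_cons.cI_nonneg i α β] with x h1 h2 h3 _
      have h4 := (le_abs_self _).trans h1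
      rw [sub_zero, abs_of_nonneg h2]
      linarith [le_abs_self γ])
  rwa [sub_zero] at this

/-- Near a point where the boundary condition is violated, the nodes at which a numerical solution
is close to its upper envelope are internal. -/
theorem Method.exists_forall_mem_of_close (h_adm : me.IsAdmissible pb)
    {u : ∀ i, ℕ → P1Space (me.mesh i)} {g : Pt d → ℝ} (hg : Continuous g)
    (hbd : ∀ ε > 0, ∀ᶠ i in atTop, ∀ k < me.N i, ∀ z ∈ (me.mesh i).vertices ∩ frontier pb.Ω,
      |(u i k : Pt d → ℝ) z - g z| ≤ ε) {x₀ : Pt d} (hx₀ : x₀ ∈ closure pb.Ω) {U₀ : ℝ}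
    (hU₀ : x₀ ∈ frontier pb.Ω → g x₀ < U₀) :
    ∃ η > 0, ∀ᶠ i in atTop, ∀ k < me.N i, ∀ y ∈ (me.mesh i).vertices, dist y x₀ < η →
      |(u i k : Pt d → ℝ) y - U₀| < η → y ∈ pb.Ω := by
  by_cases hx : x₀ ∈ pb.Ω
  · obtain ⟨η, hη, hball⟩ := Metric.isOpen_iff.1 pb.domain.isOpen x₀ hx
    exact ⟨η, hη, Eventually.of_forall fun i k _ y _ hd _ => hball hd⟩
  · have hxf : x₀ ∈ frontier pb.Ω := ⟨hx₀, by rwa [pb.domain.isOpen.interior_eq]⟩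
    -- At a boundary node the solution is within `θ` of `g`, which is within `θ` of `g x₀`; if the
    -- solution were also within `θ` of `U₀`, the gap `4 * θ` would be less than `3 * θ`.
    set θ := (U₀ - g x₀) / 4 with hθ
    have hθ0 : 0 < θ := by linarith [hU₀ hxf]
    obtain ⟨η, hη, hgη⟩ := Metric.continuous_iff.1 hg x₀ θ hθ0
    refine ⟨min η θ, lt_min hη hθ0, ?_⟩
    filter_upwards [hbd θ hθ0] with i hi k hk y hy hd hu
    by_contra hyΩ
    have h1 := abs_le.1 (hi k hk y ⟨hy, (h_adm.mesh i).vertices_subset hy,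
      by rwa [pb.domain.isOpen.interior_eq]⟩)
    have h2 := hgη y (lt_of_lt_of_le hd (min_le_left _ _))
    rw [Real.dist_eq, abs_lt] at h2
    have h3 := abs_lt.1 (lt_of_lt_of_le hu (min_le_right _ _))
    linarith [h1.2, h2.2, h3.1]

variable [CompactSpace A] [CompactSpace B]

theorem Problem.isBddFamily_operator (pb : Problem d A B) {φ : A → B → ℝ} (hφ : IsBddFamily φ)
    {x : Pt d} (hx : x ∈ closure pb.Ω) (q s : ℝ) (v : Pt d) :
    IsBddFamily fun α β =>
      -(pb.a α β x) * q - inner ℝ (pb.b α β x) v + pb.c α β x * s - φ α β := by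
  have hcpt : IsCompact (closure pb.Ω) := pb.domain.isBounded.isCompact_closure
  obtain ⟨Ca, hCa⟩ := (exists_uniform_modulus hcpt pb.a_cont).1
  obtain ⟨Cb, hCb⟩ := (exists_uniform_modulus hcpt pb.b_cont).1
  obtain ⟨Cc, hCc⟩ := (exists_uniform_modulus hcpt pb.c_cont).1
  have ha : IsBddFamily fun α β => pb.a α β x := ⟨Ca, fun α β => hCa α β x hx⟩
  have hc : IsBddFamily fun α β => pb.c α β x := ⟨Cc, fun α β => hCc α β x hx⟩
  have hb : IsBddFamily fun α β => inner ℝ (pb.b α β x) v := ⟨Cb * ‖v‖, fun α β =>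
    (abs_real_inner_le_norm _ _).trans
      (mul_le_mul_of_nonneg_right (hCb α β x hx) (norm_nonneg _))⟩
  exact (((ha.neg.mul_const q).sub hb).add (hc.mul_const s)).sub hφ

/-- The scheme is consistent at points where the upper envelope of the numerical solutions is
touched strictly from above by the sum of a quadratic function of time and a smooth function of
space with an affine gradient. -/
theorem Method.IsMonotone.subsolution_at_contact (h_mono : me.IsMonotone pb)
    (h_adm : me.IsAdmissible pb) (h_cons : me.IsConsistent pb) (h_proj : me.IsEllipticProjection pb)
    {Φ : (A → B → ℝ) → ℝ} (hΦ : IsValue Φ) {S : ℕ → A → B → Pt d → ℝ}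
    {u : ∀ i, ℕ → P1Space (me.mesh i)} (hu : me.IsSolution pb Φ S u)
    (hS : ∀ i, ∀ y ∈ (me.mesh i).vertices ∩ pb.Ω, IsBddFamily fun α β => S i α β y)
    {φ : A → B → Pt d → ℝ} (hφ : ∀ y ∈ closure pb.Ω, IsBddFamily fun α β => φ α β y)
    (hSφ : ∀ ε > 0, ∀ᶠ i in atTop, ∀ α β, ∀ y ∈ (me.mesh i).vertices ∩ pb.Ω,
      |S i α β y - φ α β y| ≤ ε)
    {g : Pt d → ℝ} (hg : Continuous g)
    (hbd : ∀ ε > 0, ∀ᶠ i in atTop, ∀ k < me.N i, ∀ z ∈ (me.mesh i).vertices ∩ frontier pb.Ω,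
      |(u i k : Pt d → ℝ) z - g z| ≤ ε)
    {M : ℝ} (hM : me.IsNodallyBounded u M) {t₀ : ℝ} {x₀ : Pt d} (ht₀ : t₀ ∈ Ico 0 pb.T)
    (hx₀ : x₀ ∈ closure pb.Ω) (hU₀ : x₀ ∈ frontier pb.Ω → g x₀ < me.upperEnv pb u (t₀, x₀))
    {w : Pt d → ℝ} {p : Pt d} {H : Pt d →L[ℝ] Pt d} (hw : ContDiff ℝ ∞ w)
    (hG : ∀ x, HasGradientAt w (p + H x) x) (hw0 : w x₀ = 0) (r₀ κ₀ : ℝ) {ε r : ℝ} (hε : 0 < ε)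
    (hr : 0 < r) (hmax : ∀ q ∈ pb.cyl, dist q (t₀, x₀) < r →
      me.upperEnv pb u q ≤ me.upperEnv pb u (t₀, x₀) +
        (r₀ * (q.1 - t₀) + κ₀ * (q.1 - t₀) ^ 2) + w q.2 -
        ((q.1 - t₀) ^ 2 + ε * ‖q.2 - x₀‖ ^ 2)) {δ : ℝ} (hδ : 0 < δ) :
    ∃ t ∈ Ico 0 pb.T, ∃ x ∈ pb.Ω, ∃ r' s : ℝ, |t - t₀| < δ ∧ dist x x₀ < δ ∧ |r' - r₀| < δ ∧
      |s - me.upperEnv pb u (t₀, x₀)| < δ ∧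
      -r' + Φ (fun α β => -(pb.a α β x) * (∑ j, H (EuclideanSpace.single j 1) j) -
        inner ℝ (pb.b α β x) (p + H x) + pb.c α β x * s - φ α β x) ≤ δ := by
  set U₀ := me.upperEnv pb u (t₀, x₀) with hU₀def
  set κ : ℝ → ℝ := fun t => r₀ * (t - t₀) + κ₀ * (t - t₀) ^ 2 with hκ
  obtain ⟨γ, hγ0, hγ⟩ := h_cons.exists_abs_average_cE_le h_adm
  obtain ⟨ηb, hηb, hint⟩ := Method.exists_forall_mem_of_close h_adm hg hbd hx₀ hU₀
  obtain ⟨ρ, hρ, hcontact⟩ := Method.exists_contact h_adm hM ht₀ hx₀ (κ := κ) (w := w)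
    (by fun_prop) hw.continuous (by simp [hκ]) hw0 (W := fun i => (me.P i w : Pt d → ℝ))
    (fun σ hσ => (h_proj.eventually_close h_adm hw hσ).mono fun i h => h.1) hε hr hmax
  set η := min (min δ ηb) (min (ρ / 2) (δ / (4 * (|κ₀| + 1)))) with hη
  have hη0 : 0 < η := by
    refine lt_min (lt_min hδ hηb) (lt_min (half_pos hρ) ?_)
    positivity
  have hhsmall : ∀ c > 0, ∀ᶠ i in atTop, me.h pb i < c := fun c hc =>
    h_adm.h_tendsto.eventually (gt_mem_nhds hc)
  obtain ⟨i, ⟨k, hk, y, hy, hd, hs, hmaxi⟩, hinti, hop, hSi, hh1, hh2, hh3, hmesh⟩ :=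
    ((hcontact η hη0).and_eventually (hint.and ((h_cons.eventually_op_close h_adm h_proj hw hG
      (|U₀| + δ) (show 0 < δ / 4 by positivity)).and
      ((hSφ (δ / 4) (by positivity)).and ((hhsmall (ρ / 2) (by positivity)).and
      ((hhsmall (δ / (4 * (|κ₀| + 1))) (by positivity)).and
      ((hhsmall (δ / (4 * ((|r₀| + δ) * γ + 1))) (by positivity)).and
      (h_adm.meshSize_tendsto.eventually (gt_mem_nhds (show 0 < ρ / 2 by positivity)))))))))).exists
  have hK := h_adm.mesh i
  have hh := h_adm.h_pos i
  have hd1 : |k * me.h pb i - t₀| < η := by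
    rw [← Real.dist_eq]
    exact lt_of_le_of_lt (le_max_left _ _) hd
  have hd2 : dist y x₀ < η := lt_of_le_of_lt (le_max_right _ _) hd
  have hηδ : η ≤ δ := (min_le_left _ _).trans (min_le_left _ _)
  have hηb' : η ≤ ηb := (min_le_left _ _).trans (min_le_right _ _)
  have hηρ : η ≤ ρ / 2 := (min_le_right _ _).trans (min_le_left _ _)
  have hηκ : η ≤ δ / (4 * (|κ₀| + 1)) := (min_le_right _ _).trans (min_le_right _ _)
  have hyΩ : y ∈ pb.Ω := hinti k hk y hy (hd2.trans_le hηb') (hs.trans_le hηb')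
  have hyc := subset_closure hyΩ
  set s := (u i k : Pt d → ℝ) y with hsdef
  set W : P1Space (me.mesh i) := me.P i w with hWdef
  set τ := (k : ℝ) * me.h pb i with hτ
  set τ' := ((k + 1 : ℕ) : ℝ) * me.h pb i with hτ'
  have hττ' : τ' = τ + me.h pb i := by
    rw [hτ', hτ]
    push_cast
    ring
  -- The time derivative seen by the scheme is the difference quotient of the quadratic `κ`; it
  -- differs from `r₀` by terms in `τ - t₀` and `h`, which `η` and the restrictions on `h` keep
  -- small.
  set r' := (κ τ' - κ τ) / me.h pb i with hr'
  have hr'eq : r' = r₀ + κ₀ * (2 * (τ - t₀) + me.h pb i) := by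
    rw [hr', hττ', div_eq_iff hh.ne']
    simp only [hκ]
    ring
  have hκ1 : (|κ₀| + 1) * (δ / (4 * (|κ₀| + 1))) = δ / 4 := by
    field_simp
  have hr'close : |r' - r₀| < δ := by
    rw [hr'eq, add_sub_cancel_left, abs_mul]
    have h1 : |2 * (τ - t₀) + me.h pb i| ≤ 3 * (δ / (4 * (|κ₀| + 1))) := by
      have h2 := abs_lt.1 hd1
      rw [abs_le]
      constructor <;> linarith [h2.1, h2.2]
    calc |κ₀| * |2 * (τ - t₀) + me.h pb i| ≤ (|κ₀| + 1) * (3 * (δ / (4 * (|κ₀| + 1)))) :=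
          mul_le_mul (by linarith) h1 (abs_nonneg _) (by positivity)
      _ = 3 * (δ / 4) := by rw [← hκ1]; ring
      _ < δ := by linarith
  -- the shifted projections of the test function
  let ζ₀ : P1Space (me.mesh i) := W + constP1 (me.mesh i) (s - (W : Pt d → ℝ) y)
  let ζ₁ : P1Space (me.mesh i) :=
    W + constP1 (me.mesh i) (s - (W : Pt d → ℝ) y + (κ τ' - κ τ))
  have hζ₀ : ∀ x ∈ closure pb.Ω, (ζ₀ : Pt d → ℝ) x = (W : Pt d → ℝ) x + (s - (W : Pt d → ℝ) y) :=
    fun x hx => by rw [Submodule.coe_add, Pi.add_apply, hK.constP1_apply _ hx]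
  have hζ₁ : ∀ x ∈ closure pb.Ω, (ζ₁ : Pt d → ℝ) x =
      (W : Pt d → ℝ) x + (s - (W : Pt d → ℝ) y + (κ τ' - κ τ)) :=
    fun x hx => by rw [Submodule.coe_add, Pi.add_apply, hK.constP1_apply _ hx]
  have hnear : ∀ k' : ℕ, |(k' : ℝ) * me.h pb i - t₀| < ρ → ∀ z, dist z y ≤ meshSize (me.mesh i) →
      dist ((k' : ℝ) * me.h pb i, z) (t₀, x₀) < ρ := by
    intro k' hk' z hz
    rw [Prod.dist_eq, max_lt_iff, Real.dist_eq]
    refine ⟨hk', ?_⟩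
    calc dist z x₀ ≤ dist z y + dist y x₀ := dist_triangle _ _ _
      _ < ρ := by linarith
  have hτρ : |τ - t₀| < ρ := by linarith
  have hτ'ρ : |τ' - t₀| < ρ := by
    have h2 := abs_lt.1 hd1
    rw [hττ', abs_lt]
    constructor <;> linarith [h2.1, h2.2]
  have htouch := h_mono.touching h_adm h_cons hΦ hu hk ⟨hy, hyΩ⟩ (hS i y ⟨hy, hyΩ⟩) (ζ₀ := ζ₀)
    (ζ₁ := ζ₁) (fun z hz hzy => by
      rw [hζ₁ z (hK.vertices_subset hz)]
      have := hmaxi (k + 1) hk z hz (hnear (k + 1) hτ'ρ z hzy)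
      linarith) (by
      -- Maximality is known only at nodes. Close to `y` every element contains `y`, so its vertices
      -- lie within one mesh size of `y`, and non-negativity passes from them to the element.
      filter_upwards [self_mem_nhdsWithin, nhdsWithin_le_nhds (hK.eventually_mem_star hy)]
        with x hx hstar
      obtain ⟨t, ht, hc, hxt⟩ := hK.exists_element hx
      have hyt := hstar t ht hxt
      have h1 := P1Space.eqOn_element (ζ₀ - u i k).2 ht hc hxt
      have h2 : (ζ₀ : Pt d → ℝ) x - (u i k : Pt d → ℝ) x =
          ((ζ₀ - u i k : P1Space (me.mesh i)) : Pt d → ℝ) x := rfl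
      have h3 : (ζ₀ : Pt d → ℝ) y - (u i k : Pt d → ℝ) y = 0 := by
        rw [hζ₀ y hyc]
        ring
      rw [h3, h2, h1]
      refine Finset.sum_nonneg fun z hz => mul_nonneg ?_
        ((mem_convexHull_iff_elementHat ht hc).1 hxt z hz)
      have hzv := mem_vertices_of_mem_face ht hz
      have hzy := hK.dist_le_meshSize ht (subset_convexHull ℝ _ hz) (subset_convexHull ℝ _ hyt)
      have := hmaxi k hk.le z hzv (hnear k hτρ z hzy)
      rw [Submodule.coe_sub, Pi.sub_apply, hζ₀ z (hK.vertices_subset hzv)]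
      linarith) (by rw [hζ₀ y hyc]; linarith)
  have hS0 : |s| ≤ |U₀| + δ := by
    have h1 := abs_sub_abs_le_abs_sub s U₀
    linarith
  -- Three errors of at most `δ / 4`: consistency of the operators, consistency of the sources, and
  -- the extra shift `κ τ' - κ τ = h * r'` in the explicit zeroth order term.
  have hkey := hΦ.le_add (pb.isBddFamily_operator (hφ y hyc) hyc
      (∑ j, H (EuclideanSpace.single j 1) j) s (p + H y))
    (((h_cons.isBddFamily_opE h_adm ⟨hy, hyΩ⟩ ζ₁).add
      (h_cons.isBddFamily_opI h_adm ⟨hy, hyΩ⟩ ζ₀)).sub (hS i y ⟨hy, hyΩ⟩)) (δ := δ) (by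
      intro α β
      have e1 : me.opE pb i α β ζ₁ y = me.opE pb i α β W y +
          (s - (W : Pt d → ℝ) y + (κ τ' - κ τ)) *
            ∫ x in pb.Ω, me.cE i α β x * hatN (me.mesh i) pb.Ω y x := by
        rw [← discreteOp_constP1 hK pb.domain (me.aE i α β) (me.bE i α β)]
        exact discreteOp_add hK pb.domain _ ((h_cons.bE_cont i).1 α β)
          ((h_cons.cE_cont i).1 α β) _ _ _
      have e2 : me.opI pb i α β ζ₀ y = me.opI pb i α β W y + (s - (W : Pt d → ℝ) y) *
          ∫ x in pb.Ω, me.cI i α β x * hatN (me.mesh i) pb.Ω y x := by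
        rw [← discreteOp_constP1 hK pb.domain (me.aI i α β) (me.bI i α β)]
        exact discreteOp_add hK pb.domain _ ((h_cons.bI_cont i).1 α β)
          ((h_cons.cI_cont i).1 α β) _ _ _
      have e3 : ∫ x in pb.Ω, (me.cE i α β x + me.cI i α β x) * hatN (me.mesh i) pb.Ω y x =
          (∫ x in pb.Ω, me.cE i α β x * hatN (me.mesh i) pb.Ω y x) +
          ∫ x in pb.Ω, me.cI i α β x * hatN (me.mesh i) pb.Ω y x := by
        rw [← integral_add (hK.integrable_mul_hatN pb.domain ((h_cons.cE_cont i).1 α β) y)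
          (hK.integrable_mul_hatN pb.domain ((h_cons.cI_cont i).1 α β) y)]
        simp_rw [add_mul]
      have h1 := abs_le.1 (hop α β y ⟨hy, hyΩ⟩ s hS0)
      rw [e3] at h1
      have h2 := abs_le.1 (hSi α β y ⟨hy, hyΩ⟩)
      have h3 : |(κ τ' - κ τ) *
          ∫ x in pb.Ω, me.cE i α β x * hatN (me.mesh i) pb.Ω y x| ≤ δ / 4 := by
        have h4 : κ τ' - κ τ = me.h pb i * r' := by
          rw [hr']
          field_simp
        have h5 : |r'| ≤ |r₀| + δ := by
          have := abs_sub_abs_le_abs_sub r' r₀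
          linarith
        rw [h4, abs_mul, abs_mul, abs_of_pos hh, mul_assoc]
        calc me.h pb i * (|r'| *
              |∫ x in pb.Ω, me.cE i α β x * hatN (me.mesh i) pb.Ω y x|) ≤
              (δ / (4 * ((|r₀| + δ) * γ + 1))) * ((|r₀| + δ) * γ + 1) := by
              refine mul_le_mul hh3.le ?_ (by positivity) (by positivity)
              have := mul_le_mul h5 (hγ i α β y ⟨hy, hyΩ⟩) (abs_nonneg _) (by positivity)
              linarith
          _ = δ / 4 := by
              have : 0 < (|r₀| + δ) * γ + 1 := by positivity
              field_simp
      have h3 := abs_le.1 h3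
      rw [e1, e2]
      linarith [h1.1, h2.2, h3.1])
  have hdiff : (ζ₁ : Pt d → ℝ) y - (u i k : Pt d → ℝ) y = κ τ' - κ τ := by
    rw [hζ₁ y hyc]
    ring
  rw [hdiff] at htouch
  have hτT : τ < pb.T := by
    rw [← h_adm.N_mul_h i]
    exact mul_lt_mul_of_pos_right (Nat.cast_lt.2 hk) hh
  refine ⟨τ, ⟨mul_nonneg (Nat.cast_nonneg k) hh.le, hτT⟩, y, hyΩ, r', s, hd1.trans_le hηδ,
    hd2.trans_le hηδ, hr'close, hs.trans_le hηδ, ?_⟩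
  linarith

end Test

/-! ### Quadratic functions -/

/-- A quadratic function on the Euclidean space. -/
def quadFun {d : ℕ} (r : ℝ) (p : Pt d) (H : Pt d →L[ℝ] Pt d) (x₀ x : Pt d) : ℝ :=
  r + inner ℝ p (x - x₀) + 1 / 2 * inner ℝ (H (x - x₀)) (x - x₀)

theorem contDiff_quadFun {d : ℕ} (r : ℝ) (p : Pt d) (H : Pt d →L[ℝ] Pt d) (x₀ : Pt d) :
    ContDiff ℝ ∞ (quadFun r p H x₀) := by
  have h1 : ContDiff ℝ ∞ fun x : Pt d => x - x₀ := contDiff_id.sub contDiff_const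
  exact (contDiff_const.add (contDiff_const.inner ℝ h1)).add
    (contDiff_const.mul ((H.contDiff.comp h1).inner ℝ h1))

theorem hasGradientAt_quadFun {d : ℕ} (r : ℝ) (p : Pt d) {H : Pt d →L[ℝ] Pt d}
    (hH : ∀ u v, inner ℝ (H u) v = inner ℝ u (H v)) (x₀ x : Pt d) :
    HasGradientAt (quadFun r p H x₀) (p - H x₀ + H x) x := by
  rw [hasGradientAt_iff_hasFDerivAt]
  have h1 : HasFDerivAt (fun x : Pt d => x - x₀) (ContinuousLinearMap.id ℝ (Pt d)) x :=
    (hasFDerivAt_id x).sub_const x₀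
  have h2 := H.hasFDerivAt.comp x h1
  have h3 := ((hasFDerivAt_const p x).inner ℝ h1).const_add r
  have h4 := (h2.inner ℝ h1).const_mul (1 / 2 : ℝ)
  refine (h3.add h4).congr_fderiv ?_
  ext v
  simp only [_root_.add_apply, _root_.smul_apply, ContinuousLinearMap.comp_apply,
    ContinuousLinearMap.prod_apply, fderivInnerCLM_apply, ContinuousLinearMap.id_apply,
    Function.comp_apply, InnerProductSpace.toDual_apply_apply, smul_eq_mul]
  rw [hH v, real_inner_comm (H (x - x₀)) v, inner_add_left, inner_sub_left, map_sub, inner_sub_left]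
  simp
  ring

section Limit

variable {A B : Type*} [MetricSpace A] [CompactSpace A] [MetricSpace B] [CompactSpace B]
  {pb : Problem d A B} {me : Method d A B}

/-- The hypotheses on a sequence of numerical solutions under which one-sided estimates are proved:
the scheme with value functional `Φ` and consistent sources, and the attainment of the boundary data
`g` and of the final data `vT` in the limit. -/
structure Method.IsApproximation (pb : Problem d A B) (me : Method d A B) (Φ : (A → B → ℝ) → ℝ)
    (S : ℕ → A → B → Pt d → ℝ) (φ : A → B → Pt d → ℝ) (g vT : Pt d → ℝ)
    (u : ∀ i, ℕ → P1Space (me.mesh i)) : Prop where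
  value : IsValue Φ
  solution : me.IsSolution pb Φ S u
  source_bdd : ∀ i, ∀ y ∈ (me.mesh i).vertices ∩ pb.Ω, IsBddFamily fun α β => S i α β y
  bound : ∃ C, ∀ α β, ∀ y ∈ closure pb.Ω, |φ α β y| ≤ C
  source : ∀ ε > 0, ∀ᶠ i in atTop, ∀ α β, ∀ y ∈ (me.mesh i).vertices ∩ pb.Ω,
    |S i α β y - φ α β y| ≤ ε
  g_cont : Continuous g
  vT_cont : ContinuousOn vT (closure pb.Ω)
  vT_eq_g : ∀ x ∈ frontier pb.Ω, vT x = g x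
  boundary : ∀ ε > 0, ∀ᶠ i in atTop, ∀ k < me.N i,
    ∀ z ∈ (me.mesh i).vertices ∩ frontier pb.Ω, |(u i k : Pt d → ℝ) z - g z| ≤ ε
  final : ∀ ε > 0, ∀ᶠ i in atTop, ∀ z ∈ (me.mesh i).vertices,
    |(u i (me.N i) : Pt d → ℝ) z - vT z| ≤ ε

variable {Φ : (A → B → ℝ) → ℝ} {S : ℕ → A → B → Pt d → ℝ} {φ : A → B → Pt d → ℝ} {g vT : Pt d → ℝ}
  {u : ∀ i, ℕ → P1Space (me.mesh i)}

/-! ### Barriers -/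

/-- Numerical solutions are bounded from above by smooth barriers. -/
theorem Method.IsApproximation.exists_le_barrier (hu : me.IsApproximation pb Φ S φ g vT u)
    (h_mono : me.IsMonotone pb) (h_adm : me.IsAdmissible pb) (h_cons : me.IsConsistent pb)
    (h_proj : me.IsEllipticProjection pb) {w : Pt d → ℝ} {p : Pt d} {H : Pt d →L[ℝ] Pt d}
    (hw : ContDiff ℝ ∞ w) (hG : ∀ x, HasGradientAt w (p + H x) x)
    (hvT : ∀ x ∈ closure pb.Ω, vT x ≤ w x) {ε : ℝ} (hε : 0 < ε) :
    ∃ C ≥ 0, ∀ᶠ i in atTop, ∀ k ≤ me.N i, ∀ z ∈ (me.mesh i).vertices,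
      (u i k : Pt d → ℝ) z ≤ w z + ε + C * (pb.T - k * me.h pb i) := by
  have hcpt : IsCompact (closure pb.Ω) := pb.domain.isBounded.isCompact_closure
  obtain ⟨Ca, hCa⟩ := (exists_uniform_modulus hcpt pb.a_cont).1
  obtain ⟨Cb, hCb⟩ := (exists_uniform_modulus hcpt pb.b_cont).1
  obtain ⟨Cc, hCc⟩ := (exists_uniform_modulus hcpt pb.c_cont).1
  have hGc : Continuous fun x => p + H x := by fun_prop
  obtain ⟨Cg, hCg⟩ := hcpt.exists_bound_of_continuousOn hGc.continuousOn
  obtain ⟨Cw, hCw⟩ := hcpt.exists_bound_of_continuousOn hw.continuous.continuousOn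
  obtain ⟨Cφ, hCφ⟩ := hu.bound
  set L := ∑ j, H (EuclideanSpace.single j 1) j with hL
  -- A bound of the operator on the projection of `w`; the final `2` pays for the consistency errors
  -- of the operators and of the sources, each at most one.
  refine ⟨|Ca| * |L| + |Cb| * |Cg| + |Cc| * (|Cw| + ε) + |Cφ| + 2, by positivity, ?_⟩
  filter_upwards [h_proj.eventually_close h_adm hw (show 0 < ε / 3 by positivity),
    h_cons.eventually_op_close h_adm h_proj hw hG (|Cw| + ε) one_pos, hu.source 1 one_pos,
    hu.boundary (ε / 3) (by positivity), hu.final (ε / 3) (by positivity)]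
    with i hpr hop hsrc hbd hfin k hk z hz
  have hK := h_adm.mesh i
  have hPw := fun x hx => abs_le.1 (hpr.1 x hx)
  have hbar := h_mono.le_barrier h_adm h_cons hu.value hu.solution (hu.source_bdd i)
    -- One third of `ε` covers the error of the data and one third that of the projection; the last
    -- third is spent on returning from the projection to `w`.
    (W := me.P i w) (m := 2 * ε / 3)
    (C := |Ca| * |L| + |Cb| * |Cg| + |Cc| * (|Cw| + ε) + |Cφ| + 2) (by positivity) (by positivity)
    (fun α β y hy => by
      have hyc := subset_closure hy.2
      have hs : |(me.P i w : Pt d → ℝ) y| ≤ |Cw| + ε := by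
        have h1 := abs_le.1 ((hCw y hyc).trans (le_abs_self Cw))
        rw [abs_le]
        constructor <;> linarith [(hPw y hyc).1, (hPw y hyc).2, h1.1, h1.2]
      have h1 := abs_le.1 (hop α β y hy _ hs)
      rw [sub_self, zero_mul, add_zero] at h1
      have h2 := abs_le.1 (hsrc α β y hy)
      have h3 : |pb.a α β y * L| ≤ |Ca| * |L| := by
        rw [abs_mul]
        exact mul_le_mul_of_nonneg_right ((hCa α β y hyc).trans (le_abs_self _)) (abs_nonneg _)
      have h4 : |inner ℝ (pb.b α β y) (p + H y)| ≤ |Cb| * |Cg| :=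
        (abs_real_inner_le_norm _ _).trans (mul_le_mul ((hCb α β y hyc).trans (le_abs_self _))
          ((hCg y hyc).trans (le_abs_self _)) (norm_nonneg _) (abs_nonneg _))
      have h5 : |pb.c α β y * (me.P i w : Pt d → ℝ) y| ≤ |Cc| * (|Cw| + ε) := by
        rw [abs_mul]
        exact mul_le_mul ((hCc α β y hyc).trans (le_abs_self _)) hs (abs_nonneg _) (abs_nonneg _)
      have h6 := abs_le.1 ((hCφ α β y hyc).trans (le_abs_self _))
      have h3 := abs_le.1 h3
      have h4 := abs_le.1 h4
      have h5 := abs_le.1 h5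
      linarith [h1.1, h2.2, h3.2, h4.2, h5.1, h6.2])
    (fun z hz => by
      have hzc := hK.vertices_subset hz
      linarith [(abs_le.1 (hfin z hz)).2, (hPw z hzc).1, hvT z hzc])
    (fun k hk z hz => by
      have hzc := hK.vertices_subset hz.1
      have h1 := hvT z hzc
      rw [hu.vT_eq_g z hz.2] at h1
      linarith [(abs_le.1 (hbd k hk z hz)).2, (hPw z hzc).1])
    k hk z hz
  linarith [(hPw z (hK.vertices_subset hz)).2]

/-- A constant above the final data is a barrier; it also dominates the boundary data, which
coincide with the final data on the boundary. -/
theorem Method.IsApproximation.eventually_bounded_above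
    (hu : me.IsApproximation pb Φ S φ g vT u)
    (h_mono : me.IsMonotone pb) (h_adm : me.IsAdmissible pb) (h_cons : me.IsConsistent pb)
    (h_proj : me.IsEllipticProjection pb) :
    ∃ M, ∀ᶠ i in atTop, ∀ k ≤ me.N i, ∀ z ∈ (me.mesh i).vertices, (u i k : Pt d → ℝ) z ≤ M := by
  obtain ⟨Cv, hCv⟩ := pb.domain.isBounded.isCompact_closure.exists_bound_of_continuousOn hu.vT_cont
  obtain ⟨C, hC, h⟩ := hu.exists_le_barrier h_mono h_adm h_cons h_proj (w := fun _ => Cv) (p := 0)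
    (H := 0) contDiff_const (fun x => by simpa using hasGradientAt_const x Cv)
    (fun x hx => (le_abs_self _).trans (hCv x hx)) one_pos
  refine ⟨Cv + 1 + C * pb.T, ?_⟩
  filter_upwards [h] with i hi k hk z hz
  refine (hi k hk z hz).trans (add_le_add le_rfl (mul_le_mul_of_nonneg_left ?_ hC))
  linarith [mul_nonneg (Nat.cast_nonneg (α := ℝ) k) (h_adm.h_pos i).le]

/-- The upper envelope attains the final data from below. -/
theorem Method.IsApproximation.upperEnv_final_le (hu : me.IsApproximation pb Φ S φ g vT u)
    (h_mono : me.IsMonotone pb) (h_adm : me.IsAdmissible pb) (h_cons : me.IsConsistent pb)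
    (h_proj : me.IsEllipticProjection pb) {M : ℝ} (hM : me.IsNodallyBounded u M) {x₀ : Pt d}
    (hx₀ : x₀ ∈ closure pb.Ω) : me.upperEnv pb u (pb.T, x₀) ≤ vT x₀ := by
  refine le_of_forall_gt_imp_ge_of_dense fun c hc => ?_
  set ε := (c - vT x₀) / 4 with hε
  have hε0 : 0 < ε := by linarith
  obtain ⟨Cv, hCv⟩ := pb.domain.isBounded.isCompact_closure.exists_bound_of_continuousOn hu.vT_cont
  obtain ⟨η, hη, hnear⟩ := Metric.continuousWithinAt_iff.1 (hu.vT_cont x₀ hx₀) ε hε0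
  -- Outside the ball of radius `η` the parabola has risen by at least `2 * |Cv|`, which is at least
  -- the oscillation of the final data; inside the ball continuity and the offset `ε` suffice.
  set m : ℝ := 4 * |Cv| / η ^ 2 with hm
  let H : Pt d →L[ℝ] Pt d := m • ContinuousLinearMap.id ℝ (Pt d)
  have hH : ∀ u v, inner ℝ (H u) v = inner ℝ u (H v) := fun u v => by
    simp [H, inner_smul_left, inner_smul_right]
  let w := quadFun (vT x₀ + ε) 0 H x₀
  have hwx : ∀ x, w x = vT x₀ + ε + m / 2 * ‖x - x₀‖ ^ 2 := fun x => by
    simp only [w, quadFun, H, _root_.smul_apply, ContinuousLinearMap.id_apply,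
      inner_smul_left, inner_zero_left, real_inner_self_eq_norm_sq]
    simp
    ring
  have hm0 : 0 ≤ m := by positivity
  have hvw : ∀ x ∈ closure pb.Ω, vT x ≤ w x := by
    intro x hx
    rw [hwx]
    by_cases hd : dist x x₀ < η
    · have h1 := hnear hx hd
      rw [Real.dist_eq, abs_lt] at h1
      have : 0 ≤ m / 2 * ‖x - x₀‖ ^ 2 := by positivity
      linarith [h1.2]
    · have h1 : η ^ 2 ≤ ‖x - x₀‖ ^ 2 := by
        rw [← dist_eq_norm]
        exact pow_le_pow_left₀ hη.le (not_lt.1 hd) 2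
      have h2 : 2 * |Cv| ≤ m / 2 * ‖x - x₀‖ ^ 2 := by
        calc 2 * |Cv| = m / 2 * η ^ 2 := by
              rw [hm]
              field_simp
              ring
          _ ≤ _ := mul_le_mul_of_nonneg_left h1 (by positivity)
      have h3 := abs_le.1 ((hCv x hx).trans (le_abs_self Cv))
      have h4 := abs_le.1 ((hCv x₀ hx₀).trans (le_abs_self Cv))
      linarith [h3.2, h4.1]
  obtain ⟨C, hC, h⟩ := hu.exists_le_barrier h_mono h_adm h_cons h_proj (contDiff_quadFun _ _ _ _)
    (fun x => hasGradientAt_quadFun (vT x₀ + ε) 0 hH x₀ x) hvw hε0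
  have hcont : Continuous fun q : ℝ × Pt d => w q.2 + ε + C * (pb.T - q.1) := by
    have : Continuous w := (contDiff_quadFun _ _ _ _).continuous
    fun_prop
  have hval : w x₀ + ε + C * (pb.T - pb.T) < c := by
    rw [hwx]
    simp
    linarith
  obtain ⟨η', hη', hball⟩ := Metric.eventually_nhds_iff_ball.1
    (hcont.continuousAt.eventually (gt_mem_nhds hval) : ∀ᶠ q in 𝓝 (pb.T, x₀), _)
  obtain ⟨i₀, hi₀⟩ := eventually_atTop.1 h
  exact Method.upperEnv_le h_adm hM ⟨⟨pb.T_pos.le, le_rfl⟩, hx₀⟩ (Method.eventually_gridFilter.2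
    ⟨i₀, η', hη', fun i hi k hk y hy hd => (hi₀ i hi k hk y hy).trans (hball _ hd).le⟩)

/-! ### Test functions -/

/-- The test function is replaced by its quadratic majorant, with `4 * ε` times the identity added
to the Hessian: half of this is the Taylor error and half makes the contact strict in space. The
trace grows by `4 * ε * d`, less than `δ`. In time, strictness comes from the coefficient `k + 1` in
place of `k`. -/
theorem Method.IsApproximation.subsolution_test (hu : me.IsApproximation pb Φ S φ g vT u)
    (h_mono : me.IsMonotone pb) (h_adm : me.IsAdmissible pb) (h_cons : me.IsConsistent pb)
    (h_proj : me.IsEllipticProjection pb) {M : ℝ} (hM : me.IsNodallyBounded u M)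
    {ψ : ℝ × Pt d → ℝ} (hψ : ContDiff ℝ 2 ψ) {t₀ : ℝ} {x₀ : Pt d} (ht₀ : t₀ ∈ Ico 0 pb.T)
    (hx₀ : x₀ ∈ closure pb.Ω) (hU₀ : x₀ ∈ frontier pb.Ω → g x₀ < me.upperEnv pb u (t₀, x₀))
    (hmax : IsLocalMaxOn (fun q => me.upperEnv pb u q - ψ q) (Ico 0 pb.T ×ˢ closure pb.Ω) (t₀, x₀))
    {δ : ℝ} (hδ : 0 < δ) :
    ∃ z : ℝ × Pt d × ℝ × Pt d × ℝ × ℝ, z.1 ∈ Ico 0 pb.T ∧ z.2.1 ∈ pb.Ω ∧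
      dist z (jet ψ t₀ x₀ (me.upperEnv pb u (t₀, x₀))) < δ ∧
      -z.2.2.2.2.1 + Φ (fun α β => -(pb.a α β z.2.1) * z.2.2.1 -
        inner ℝ (pb.b α β z.2.1) z.2.2.2.1 + pb.c α β z.2.1 * z.2.2.2.2.2 - φ α β z.2.1) ≤ δ := by
  obtain ⟨H₀, hH₀, htr, htaylor⟩ := exists_quadratic_upper_bound hψ t₀ x₀
  set ε := δ / (4 * (d + 1)) with hε
  have hε0 : 0 < ε := by positivity
  obtain ⟨k, hk⟩ := htaylor ε hε0
  set r₀ := deriv (fun τ => ψ (τ, x₀)) t₀ with hr₀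
  set G := gradient (fun y => ψ (t₀, y)) x₀ with hGdef
  let H : Pt d →L[ℝ] Pt d := H₀ + (4 * ε) • ContinuousLinearMap.id ℝ (Pt d)
  have hHx : ∀ x, H x = H₀ x + (4 * ε) • x := fun x => by simp [H]
  have hH : ∀ u v, inner ℝ (H u) v = inner ℝ u (H v) := fun u v => by
    rw [hHx, hHx, inner_add_left, inner_add_right, hH₀, real_inner_smul_left, real_inner_smul_right]
  have hwx : ∀ x, quadFun 0 G H x₀ x = inner ℝ G (x - x₀) +
      1 / 2 * inner ℝ (H₀ (x - x₀)) (x - x₀) + ε * ‖x - x₀‖ ^ 2 + ε * ‖x - x₀‖ ^ 2 := fun x => by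
    rw [quadFun, hHx, inner_add_left, real_inner_smul_left, real_inner_self_eq_norm_sq]
    ring
  have htrH : ∑ j, H (EuclideanSpace.single j 1) j =
      Laplacian.laplacian (fun y => ψ (t₀, y)) x₀ + 4 * ε * d := by
    simp_rw [hHx]
    rw [← htr]
    simp [Finset.sum_add_distrib]
    ring
  have hloc := mem_nhdsWithin.1 hmax
  obtain ⟨V, hV, hpV, hVmax⟩ := hloc
  obtain ⟨r₁, hr₁, hball₁⟩ := Metric.isOpen_iff.1 hV _ hpV
  obtain ⟨r₂, hr₂, hball₂⟩ := Metric.eventually_nhds_iff_ball.1 hk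
  set r := min (min r₁ r₂) (pb.T - t₀) with hr
  have hr0 : 0 < r := lt_min (lt_min hr₁ hr₂) (sub_pos.2 ht₀.2)
  have hgap : ∀ q ∈ pb.cyl, dist q (t₀, x₀) < r →
      me.upperEnv pb u q ≤ me.upperEnv pb u (t₀, x₀) +
        (r₀ * (q.1 - t₀) + (k + 1) * (q.1 - t₀) ^ 2) + quadFun 0 G H x₀ q.2 -
        ((q.1 - t₀) ^ 2 + ε * ‖q.2 - x₀‖ ^ 2) := by
    rintro ⟨t, x⟩ ⟨ht, hx⟩ hd
    have hd1 : dist (t, x) (t₀, x₀) < min r₁ r₂ := lt_of_lt_of_le hd (min_le_left _ _)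
    have htT : t < pb.T := by
      have h1 : dist t t₀ < r := lt_of_le_of_lt (le_max_left _ _) hd
      rw [Real.dist_eq] at h1
      have h2 := (abs_lt.1 h1).2
      have : r ≤ pb.T - t₀ := min_le_right _ _
      linarith
    have h1 : me.upperEnv pb u (t, x) - ψ (t, x) ≤
        me.upperEnv pb u (t₀, x₀) - ψ (t₀, x₀) :=
      hVmax ⟨hball₁ (lt_of_lt_of_le hd1 (min_le_left _ _)), ⟨ht.1, htT⟩, hx⟩
    have h2 := hball₂ (t, x) (lt_of_lt_of_le hd1 (min_le_right _ _))
    simp only at h2 ⊢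
    rw [hwx]
    linarith
  obtain ⟨Cφ, hCφ⟩ := hu.bound
  set δ' := min δ (δ / (‖H‖ + 1)) with hδ'
  have hδ'0 : 0 < δ' := lt_min hδ (by positivity)
  have hδ'δ : δ' ≤ δ := min_le_left _ _
  obtain ⟨t, ht, x, hx, r', s, h1, h2, h3, h4, h5⟩ :=
    h_mono.subsolution_at_contact h_adm h_cons h_proj hu.value hu.solution hu.source_bdd
      (fun y hy => ⟨Cφ, fun α β => hCφ α β y hy⟩) hu.source hu.g_cont hu.boundary hM ht₀ hx₀ hU₀
      (contDiff_quadFun 0 G H x₀) (hasGradientAt_quadFun 0 G hH x₀) (by simp [quadFun]) r₀ (k + 1)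
      hε0 hr0 hgap hδ'0
  refine ⟨(t, x, ∑ j, H (EuclideanSpace.single j 1) j, G - H x₀ + H x, r', s), ht, hx, ?_,
    h5.trans hδ'δ⟩
  simp only [jet, Prod.dist_eq, max_lt_iff, Real.dist_eq]
  refine ⟨h1.trans_le hδ'δ, h2.trans_le hδ'δ, ?_, ?_, h3.trans_le hδ'δ, h4.trans_le hδ'δ⟩
  · rw [htrH, add_sub_cancel_left, abs_of_nonneg (by positivity)]
    have : 4 * ε * (d + 1) = δ := by
      rw [hε]
      field_simp
    linarith
  · have e : G - H x₀ + H x - G = H (x - x₀) := by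
      rw [map_sub]
      abel
    rw [dist_eq_norm, e]
    have h6 : ‖x - x₀‖ < δ / (‖H‖ + 1) := by
      rw [← dist_eq_norm]
      exact h2.trans_le (min_le_right _ _)
    calc ‖H (x - x₀)‖ ≤ ‖H‖ * ‖x - x₀‖ := H.le_opNorm _
      _ ≤ (‖H‖ + 1) * ‖x - x₀‖ := by
          linarith [norm_nonneg (x - x₀)]
      _ < (‖H‖ + 1) * (δ / (‖H‖ + 1)) := mul_lt_mul_of_pos_left h6 (by positivity)
      _ = δ := by field_simp

end Limit

section Main

variable {A B : Type*} [MetricSpace A] [MetricSpace B]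
  {pb : Problem d A B} {me : Method d A B}

/-! ### The numerical solutions as one-sided approximations -/

theorem Method.IsNumericalSolution.isApproximation [CompactSpace A] [CompactSpace B]
    [Nonempty A] [Nonempty B]
    {v : ∀ i, ℕ → P1Space (me.mesh i)} (hv : me.IsNumericalSolution pb v)
    (h_adm : me.IsAdmissible pb) (h_proj : me.IsEllipticProjection pb)
    (h_cons : me.IsConsistent pb) :
    me.IsApproximation pb (fun u => ⨅ β, ⨆ α, u α β) (me.opF pb) pb.f pb.g pb.vT v where
  value := isValue_iInf_iSup
  solution := hv.scheme
  source_bdd _ _ hy := h_cons.isBddFamily_opF h_adm hy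
  bound := (exists_uniform_modulus pb.domain.isBounded.isCompact_closure pb.f_cont).1
  source _ hε := h_cons.eventually_opF_close h_adm hε
  g_cont := pb.g_lipschitz.choose_spec.continuous
  vT_cont := pb.vT_cont
  vT_eq_g := pb.vT_eq_g
  boundary ε hε := by
    filter_upwards [Metric.tendstoUniformlyOn_iff.1 h_proj.boundary_data ε hε] with i hi k hk z hz
    have h1 := hi z hz.2
    rw [dist_comm, Real.dist_eq] at h1
    rw [hv.boundary i k hk z hz.2]
    exact h1.le
  final ε hε := by
    filter_upwards [Metric.tendstoUniformlyOn_iff.1 h_proj.final_data ε hε] with i hi z hz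
    have h1 := hi z ((h_adm.mesh i).vertices_subset hz)
    rw [dist_comm, Real.dist_eq] at h1
    rw [hv.final i]
    exact h1.le

/-- The discrete operators are linear, so a change of sign affects only the value functional, which
becomes its dual, and the data. -/
theorem Method.IsApproximation.neg {Φ : (A → B → ℝ) → ℝ} {S : ℕ → A → B → Pt d → ℝ}
    {φ : A → B → Pt d → ℝ} {g vT : Pt d → ℝ} {u : ∀ i, ℕ → P1Space (me.mesh i)}
    (hu : me.IsApproximation pb Φ S φ g vT u) (h_adm : me.IsAdmissible pb)
    (h_cons : me.IsConsistent pb) :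
    me.IsApproximation pb (fun u => -Φ fun α β => -u α β) (fun i α β y => -S i α β y)
      (fun α β y => -φ α β y) (fun x => -g x) (fun x => -vT x) (fun i k => -u i k) where
  value := hu.value.dual
  solution i k hk y hy := by
    have hK := h_adm.mesh i
    have h := hu.solution i k hk y hy
    have e : ∀ α β, -(me.opE pb i α β ((-u i (k + 1) : P1Space (me.mesh i)) : Pt d → ℝ) y +
        me.opI pb i α β ((-u i k : P1Space (me.mesh i)) : Pt d → ℝ) y - -S i α β y) =
        me.opE pb i α β (u i (k + 1)) y + me.opI pb i α β (u i k) y - S i α β y := by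
      intro α β
      have e1 : me.opE pb i α β ((-u i (k + 1) : P1Space (me.mesh i)) : Pt d → ℝ) y =
          -me.opE pb i α β (u i (k + 1)) y :=
        discreteOp_neg hK pb.domain _ ((h_cons.bE_cont i).1 α β) ((h_cons.cE_cont i).1 α β) _ _
      have e2 : me.opI pb i α β ((-u i k : P1Space (me.mesh i)) : Pt d → ℝ) y =
          -me.opI pb i α β (u i k) y :=
        discreteOp_neg hK pb.domain _ ((h_cons.bI_cont i).1 α β) ((h_cons.cI_cont i).1 α β) _ _
      rw [e1, e2]
      ring
    simp_rw [e]
    simp only [Submodule.coe_neg, Pi.neg_apply]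
    rw [sub_div] at h ⊢
    rw [neg_div, neg_div]
    linarith
  source_bdd i y hy := (hu.source_bdd i y hy).neg
  bound := by
    obtain ⟨C, hC⟩ := hu.bound
    exact ⟨C, fun α β y hy => by rw [abs_neg]; exact hC α β y hy⟩
  source ε hε := by
    filter_upwards [hu.source ε hε] with i hi α β y hy
    rw [← neg_sub', abs_neg]
    exact hi α β y hy
  g_cont := hu.g_cont.neg
  vT_cont := hu.vT_cont.neg
  vT_eq_g x hx := by rw [hu.vT_eq_g x hx]
  boundary ε hε := by
    filter_upwards [hu.boundary ε hε] with i hi k hk z hz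
    rw [Submodule.coe_neg, Pi.neg_apply, ← neg_sub', abs_neg]
    exact hi k hk z hz
  final ε hε := by
    filter_upwards [hu.final ε hε] with i hi z hz
    rw [Submodule.coe_neg, Pi.neg_apply, ← neg_sub', abs_neg]
    exact hi z hz

/-! ### Uniform bounds -/

/-- The finitely many exceptional levels each have finitely many grid values. -/
theorem Method.exists_isNodallyBounded (h_adm : me.IsAdmissible pb)
    {u : ∀ i, ℕ → P1Space (me.mesh i)} {M : ℝ}
    (h : ∀ᶠ i in atTop, ∀ k ≤ me.N i, ∀ z ∈ (me.mesh i).vertices, |(u i k : Pt d → ℝ) z| ≤ M) :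
    ∃ M', me.IsNodallyBounded u M' := by
  have hfin : ∀ i, ∃ C, ∀ k ≤ me.N i, ∀ z ∈ (me.mesh i).vertices, |(u i k : Pt d → ℝ) z| ≤ C := by
    intro i
    obtain ⟨C, hC⟩ := (((finite_Iic (me.N i)).prod (h_adm.mesh i).finite_vertices).image
      fun q : ℕ × Pt d => |(u i q.1 : Pt d → ℝ) q.2|).bddAbove
    exact ⟨C, fun k hk z hz => hC ⟨(k, z), ⟨hk, hz⟩, rfl⟩⟩
  choose C hC using hfin
  obtain ⟨i₀, hi₀⟩ := eventually_atTop.1 h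
  obtain ⟨C', hC'⟩ := ((finite_Iio i₀).image C).bddAbove
  refine ⟨max M C', fun i k hk z hz => ?_⟩
  rcases lt_or_ge i i₀ with hi | hi
  · exact (hC i k hk z hz).trans ((hC' (mem_image_of_mem C hi)).trans (le_max_right _ _))
  · exact (hi₀ i hi k hk z hz).trans (le_max_left _ _)

/-! ### Attainment of the final data -/

theorem strongFinalAt_of_tendsto {V : ℝ × Pt d → ℝ} {x : Pt d} (hx : x ∈ closure pb.Ω)
    (h : Tendsto V (𝓝[pb.cyl] (pb.T, x)) (𝓝 (pb.vT x))) : StrongFinalAt pb V x := by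
  have : (𝓝[pb.cyl] (pb.T, x)).NeBot := mem_closure_iff_nhdsWithin_neBot.1
    (subset_closure ⟨⟨pb.T_pos.le, le_rfl⟩, hx⟩)
  exact ⟨h.limsup_eq, h.liminf_eq⟩

/-- Semicontinuity of the upper envelope gives the upper half of the limit. The lower half comes
from the lower envelope, which lies below the upper one and is lower semicontinuous with value at
least `c` at the final time. -/
theorem Method.tendsto_upperEnv_of_final (h_adm : me.IsAdmissible pb)
    {u : ∀ i, ℕ → P1Space (me.mesh i)} {M : ℝ} (hM : me.IsNodallyBounded u M) {x : Pt d} {c : ℝ}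
    (h1 : me.upperEnv pb u (pb.T, x) ≤ c)
    (h2 : me.upperEnv pb (fun i k => -u i k) (pb.T, x) ≤ -c) :
    Tendsto (me.upperEnv pb u) (𝓝[pb.cyl] (pb.T, x)) (𝓝 c) := by
  refine tendsto_order.2 ⟨fun a ha => ?_, fun a ha => ?_⟩
  · obtain ⟨a', haa', ha'c⟩ := exists_between ha
    filter_upwards [Method.eventually_upperEnv_le h_adm hM.neg
      (lt_of_le_of_lt h2 (neg_lt_neg ha'c)), self_mem_nhdsWithin] with q hq hqc
    rw [Method.upperEnv_neg] at hq
    linarith [Method.lowerEnv_le_upperEnv h_adm hM hqc]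
  · obtain ⟨a', hca', ha'a⟩ := exists_between ha
    filter_upwards [Method.eventually_upperEnv_le h_adm hM (lt_of_le_of_lt h1 hca')] with q hq
    exact hq.trans_lt ha'a

/-! ### Semicontinuous envelopes of the operator -/

/-- Any lower bound of `G` near `z₀` is at most its value at the given points, hence at most every
positive number. If there is no such bound, the supremum has the default value zero, so local
boundedness of `G` is not required. -/
theorem lscEnv_nonpos {X : Type*} [PseudoMetricSpace X] {S : Set X} {G : X → ℝ} {z₀ : X}
    (h : ∀ δ > 0, ∃ z ∈ S, dist z z₀ < δ ∧ G z ≤ δ) : lscEnv S G z₀ ≤ 0 := by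
  rw [lscEnv, liminf_eq]
  refine Real.sSup_le (fun a ha => ?_) le_rfl
  obtain ⟨δ, hδ, hball⟩ := Metric.mem_nhdsWithin_iff.1 ha
  refine le_of_forall_pos_le_add fun δ' hδ' => ?_
  obtain ⟨z, hz, hd, hG⟩ := h (min δ δ') (lt_min hδ hδ')
  have h1 : a ≤ G z := hball ⟨lt_of_lt_of_le hd (min_le_left _ _), hz⟩
  have h2 := min_le_right δ δ'
  linarith

theorem uscEnv_nonneg {X : Type*} [PseudoMetricSpace X] {S : Set X} {G : X → ℝ} {z₀ : X}
    (h : ∀ δ > 0, ∃ z ∈ S, dist z z₀ < δ ∧ -G z ≤ δ) : 0 ≤ uscEnv S G z₀ := by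
  have h1 := lscEnv_nonpos (G := fun z => -G z) h
  rw [lscEnv_eq_neg_uscEnv_neg] at h1
  simp only [neg_neg] at h1
  linarith

theorem Problem.F_of_mem (pb : Problem d A B) {z : ℝ × Pt d × ℝ × Pt d × ℝ × ℝ} (ht : z.1 < pb.T)
    (hx : z.2.1 ∈ pb.Ω) : pb.F z = -z.2.2.2.2.1 + ⨅ β, ⨆ α, (-(pb.a α β z.2.1) * z.2.2.1 -
      inner ℝ (pb.b α β z.2.1) z.2.2.2.1 + pb.c α β z.2.1 * z.2.2.2.2.2 - pb.f α β z.2.1) := by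
  obtain ⟨t, x, q, p, r, s⟩ := z
  simp only [Problem.F]
  rw [if_pos ht, if_pos hx]

theorem Problem.F_of_mem_frontier (pb : Problem d A B) {t : ℝ} (ht : t < pb.T) {x : Pt d}
    (hx : x ∈ frontier pb.Ω) (q : ℝ) (p : Pt d) (r s : ℝ) : pb.F (t, x, q, p, r, s) = s - pb.g x := by
  have hxΩ : x ∉ pb.Ω := by
    have := hx.2
    rwa [pb.domain.isOpen.interior_eq] at this
  simp only [Problem.F]
  rw [if_pos ht, if_neg hxΩ]

theorem jet_neg (ψ : ℝ × Pt d → ℝ) (t : ℝ) (x : Pt d) (s : ℝ) :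
    jet (fun q => -ψ q) t x (-s) = ((jet ψ t x s).1, (jet ψ t x s).2.1, -(jet ψ t x s).2.2.1,
      -(jet ψ t x s).2.2.2.1, -(jet ψ t x s).2.2.2.2.1, -(jet ψ t x s).2.2.2.2.2) := by
  have h1 : Laplacian.laplacian (fun y => -ψ (t, y)) x =
      -Laplacian.laplacian (fun y => ψ (t, y)) x :=
    congrFun (InnerProductSpace.laplacian_neg (f := fun y => ψ (t, y))) x
  have h2 : gradient (fun y => -ψ (t, y)) x = -gradient (fun y => ψ (t, y)) x := by
    rw [gradient, fderiv_fun_neg, map_neg]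
    rfl
  have h3 : deriv (fun τ => -ψ (τ, x)) t = -deriv (fun τ => ψ (τ, x)) t := by
    rw [deriv.fun_neg]
  simp only [jet, h1, h2, h3]

variable [CompactSpace A] [CompactSpace B] [Nonempty A] [Nonempty B]

/-! ### The numerical envelopes are viscosity sub- and supersolutions -/

theorem Method.IsNumericalSolution.isViscositySubsolution {v : ∀ i, ℕ → P1Space (me.mesh i)}
    (hv : me.IsNumericalSolution pb v) (h_adm : me.IsAdmissible pb)
    (h_proj : me.IsEllipticProjection pb) (h_cons : me.IsConsistent pb)
    (h_mono : me.IsMonotone pb) {M : ℝ} (hM : me.IsNodallyBounded v M) :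
    IsViscositySubsolution pb ∅ (me.upperEnv pb v) where
  bounded := ⟨M, fun _ hp => Method.abs_upperEnv_le h_adm hM hp⟩
  test ψ hψ t ht x hx hmax := by
    have hsub : Ico 0 pb.T ×ˢ closure pb.Ω ⊆ pb.cyl := prod_mono Ico_subset_Icc_self subset_rfl
    have hE : ∀ q ∈ pb.cyl, uscEnv pb.cyl (me.upperEnv pb v) q = me.upperEnv pb v q :=
      fun q hq => Method.uscEnv_upperEnv h_adm hM hq
    have hmax' : IsLocalMaxOn (fun q => me.upperEnv pb v q - ψ q)
        (Ico 0 pb.T ×ˢ closure pb.Ω) (t, x) := by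
      filter_upwards [hmax, self_mem_nhdsWithin] with q hq hqm
      rwa [hE q (hsub hqm), hE (t, x) (hsub ⟨ht, hx⟩)] at hq
    rw [hE (t, x) (hsub ⟨ht, hx⟩)]
    refine lscEnv_nonpos fun δ hδ => ?_
    -- Where the envelope respects the boundary data, the boundary branch of `F` at the jet itself
    -- is non-positive. Otherwise the scheme is active, and nearby interior points witness the
    -- inequality.
    by_cases hb : x ∈ frontier pb.Ω ∧ me.upperEnv pb v (t, x) ≤ pb.g x
    · refine ⟨_, ⟨Ico_subset_Icc_self ht, hx⟩, by rw [dist_self]; exact hδ, ?_⟩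
      rw [jet, pb.F_of_mem_frontier ht.2 hb.1]
      linarith [hb.2]
    · obtain ⟨z, hz1, hz2, hz3, hz4⟩ :=
        (hv.isApproximation h_adm h_proj h_cons).subsolution_test h_mono h_adm h_cons h_proj hM
          hψ ht hx (fun h => not_le.1 fun h' => hb ⟨h, h'⟩) hmax' hδ
      refine ⟨z, ⟨Ico_subset_Icc_self hz1, subset_closure hz2⟩, hz3, ?_⟩
      rw [pb.F_of_mem hz1.2 hz2]
      exact hz4
  final x hx := by
    have ha := hv.isApproximation h_adm h_proj h_cons
    refine strongFinalAt_of_tendsto hx ?_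
    refine (Method.tendsto_upperEnv_of_final h_adm hM
      (ha.upperEnv_final_le h_mono h_adm h_cons h_proj hM hx)
      ((ha.neg h_adm h_cons).upperEnv_final_le h_mono h_adm h_cons h_proj hM.neg hx)).congr' ?_
    filter_upwards [self_mem_nhdsWithin] with q hq
    exact (Method.uscEnv_upperEnv h_adm hM hq).symm
  dirichlet _ hx := absurd hx (notMem_empty _)

/-- The lower envelope of `v` is minus the upper envelope of `-v`, to which the one-sided estimates
apply with the dual value; the witnesses are reflected back in all but the time and space variables.
-/
theorem Method.IsNumericalSolution.isViscositySupersolution {v : ∀ i, ℕ → P1Space (me.mesh i)}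
    (hv : me.IsNumericalSolution pb v) (h_adm : me.IsAdmissible pb)
    (h_proj : me.IsEllipticProjection pb) (h_cons : me.IsConsistent pb)
    (h_mono : me.IsMonotone pb) {M : ℝ} (hM : me.IsNodallyBounded v M) :
    IsViscositySupersolution pb ∅ (me.lowerEnv pb v) := by
  have hlow : ∀ q, me.upperEnv pb (fun i k => -v i k) q = -me.lowerEnv pb v q :=
    fun q => Method.upperEnv_neg v q
  have hE : ∀ q ∈ pb.cyl, lscEnv pb.cyl (me.lowerEnv pb v) q = me.lowerEnv pb v q := by
    intro q hq
    rw [lscEnv_eq_neg_uscEnv_neg]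
    simp_rw [← hlow]
    rw [Method.uscEnv_upperEnv h_adm hM.neg hq, hlow, neg_neg]
  have ha := hv.isApproximation h_adm h_proj h_cons
  have hneg := ha.neg h_adm h_cons
  refine ⟨⟨M, fun q hq => ?_⟩, fun ψ hψ t ht x hx hmin => ?_, fun x hx => ?_,
    fun _ hx => absurd hx (notMem_empty _)⟩
  · have := Method.abs_upperEnv_le h_adm hM.neg hq
    rwa [hlow, abs_neg] at this
  · have hsub : Ico 0 pb.T ×ˢ closure pb.Ω ⊆ pb.cyl := prod_mono Ico_subset_Icc_self subset_rfl
    have hmax' : IsLocalMaxOn (fun q => me.upperEnv pb (fun i k => -v i k) q - -ψ q)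
        (Ico 0 pb.T ×ˢ closure pb.Ω) (t, x) := by
      filter_upwards [hmin, self_mem_nhdsWithin] with q hq hqm
      rw [hE q (hsub hqm), hE (t, x) (hsub ⟨ht, hx⟩)] at hq
      rw [hlow, hlow]
      linarith
    rw [hE (t, x) (hsub ⟨ht, hx⟩)]
    refine uscEnv_nonneg fun δ hδ => ?_
    by_cases hb : x ∈ frontier pb.Ω ∧ pb.g x ≤ me.lowerEnv pb v (t, x)
    · refine ⟨_, ⟨Ico_subset_Icc_self ht, hx⟩, by rw [dist_self]; exact hδ, ?_⟩
      rw [jet, pb.F_of_mem_frontier ht.2 hb.1]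
      linarith [hb.2]
    · obtain ⟨z, hz1, hz2, hz3, hz4⟩ := hneg.subsolution_test h_mono h_adm h_cons h_proj hM.neg
          hψ.neg ht hx (fun h => by
            rw [hlow]
            exact neg_lt_neg (not_le.1 fun h' => hb ⟨h, h'⟩)) hmax' hδ
      obtain ⟨τ, y, q, p, r, s⟩ := z
      rw [hlow, jet_neg] at hz3
      simp only [Prod.dist_eq, max_lt_iff] at hz1 hz2 hz3
      obtain ⟨d1, d2, d3, d4, d5, d6⟩ := hz3
      refine ⟨(τ, y, -q, -p, -r, -s), ⟨Ico_subset_Icc_self hz1, subset_closure hz2⟩, ?_, ?_⟩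
      · simp only [Prod.dist_eq, max_lt_iff]
        refine ⟨d1, d2, ?_, ?_, ?_, ?_⟩
        · rwa [← dist_neg_neg, neg_neg]
        · rwa [← dist_neg_neg, neg_neg]
        · rwa [← dist_neg_neg, neg_neg]
        · rwa [← dist_neg_neg, neg_neg]
      · rw [pb.F_of_mem hz1.2 hz2]
        simp only at hz4 ⊢
        have e : ∀ α β, -(-(pb.a α β y) * q - inner ℝ (pb.b α β y) p + pb.c α β y * s -
            -pb.f α β y) = -(pb.a α β y) * -q - inner ℝ (pb.b α β y) (-p) + pb.c α β y * -s -
            pb.f α β y := by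
          intro α β
          rw [inner_neg_right]
          ring
        simp_rw [e] at hz4
        linarith
  · refine strongFinalAt_of_tendsto hx ?_
    have h1 := hneg.upperEnv_final_le h_mono h_adm h_cons h_proj hM.neg hx
    have h2 := ha.upperEnv_final_le h_mono h_adm h_cons h_proj hM hx
    have h3 := (Method.tendsto_upperEnv_of_final h_adm hM.neg h1 (by simpa using h2)).neg
    rw [neg_neg] at h3
    refine h3.congr' ?_
    filter_upwards [self_mem_nhdsWithin] with q hq
    rw [hE q hq, hlow, neg_neg]

end Main

end

end Isaacs

/-- The numerical solutions are uniformly bounded (so that the envelopes below are envelopes of a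
bounded family), and with no part of the boundary on which Dirichlet conditions are required strongly the numerical upper envelope is a viscosity subsolution and the
numerical lower envelope is a viscosity supersolution. -/
theorem mainTheorem3 {d : ℕ} (hd : 2 ≤ d) {A B : Type*}
    [MetricSpace A] [CompactSpace A] [Nonempty A] [MetricSpace B] [CompactSpace B] [Nonempty B]
    (pb : Isaacs.Problem d A B) (me : Isaacs.Method d A B)
    (h_adm : me.IsAdmissible pb) (h_proj : me.IsEllipticProjection pb)
    (h_cons : me.IsConsistent pb) (h_mono : me.IsMonotone pb)
    (v : ∀ i, ℕ → Isaacs.P1Space (me.mesh i)) (hv : me.IsNumericalSolution pb v) :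
    (∃ M : ℝ, ∀ i, ∀ k ≤ me.N i, ∀ x ∈ closure pb.Ω, |(v i k : Isaacs.Pt d → ℝ) x| ≤ M) ∧
      Isaacs.IsViscositySubsolution pb ∅ (me.upperEnv pb v) ∧
      Isaacs.IsViscositySupersolution pb ∅ (me.lowerEnv pb v) := by
  have ha := hv.isApproximation h_adm h_proj h_cons
  obtain ⟨M₁, h1⟩ := ha.eventually_bounded_above h_mono h_adm h_cons h_proj
  obtain ⟨M₂, h2⟩ := (ha.neg h_adm h_cons).eventually_bounded_above h_mono h_adm h_cons h_proj
  obtain ⟨M, hM⟩ := Isaacs.Method.exists_isNodallyBounded h_adm (u := v) (M := max M₁ M₂) (by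
    filter_upwards [h1, h2] with i hi1 hi2 k hk z hz
    have e1 := hi1 k hk z hz
    have e2 := hi2 k hk z hz
    have e3 : -((v i k : Isaacs.Pt d → ℝ) z) ≤ M₂ := e2
    exact abs_le.2 ⟨by linarith [le_max_right M₁ M₂], e1.trans (le_max_left _ _)⟩)
  refine ⟨⟨M, fun i k hk x hx => abs_le.2
      ⟨(h_adm.mesh i).le_of_vertices_ge (v i k).2 (fun z hz => (abs_le.1 (hM i k hk z hz)).1) hx,
        (h_adm.mesh i).le_of_vertices_le (v i k).2
          (fun z hz => (abs_le.1 (hM i k hk z hz)).2) hx⟩⟩,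
    hv.isViscositySubsolution h_adm h_proj h_cons h_mono hM,
    hv.isViscositySupersolution h_adm h_proj h_cons h_mono hM⟩
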